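/- **Setting.** Let $d\in\{1,2,3\}$ and let $S\subset\mathbb R^d$ be the projection to $\mathbb R^d$ of the unit sphere of $\mathbb R^3$ (the interval $[-1,1]$, the closed unit disk, the unit sphere). Let $\Omega_1,\dots,\Omega_n\in S$ and $w_1,\dots,w_n>0$ satisfy $$\sum_j w_j=1,\qquad \sum_j w_j\Omega_j=0,\qquad \sum_j w_j\,\Omega_j\otimes\Omega_j=\tfrac13\,\mathrm{Id}.$$ Let $\mathcal T_h$ be a finite family of pairwise disjoint open cells $K\subset\mathbb R^d$, either all nondegenerate simplices, with $Z_1(K)=P^1(K)$ (polynomials of degree at most one), or all axis-parallel boxes, with $Z_1(K)=Q^1(K)$ (multilinear polynomials). Let $D$ be the interior of $\bigcup_{K}\mathrm{cl}(K)$. (Any bounded Lipschitz domain $D$ with $\mathrm{cl}(D)=\bigcup_K \mathrm{cl}(K)$ is of this form; hanging nodes are allowed.) Let $\sigma_s,\sigma_a,q$ be integrable real functions on $D$ with $\sigma_s\ge\delta_s>0$ and $\sigma_a\ge\delta_a>0$ almost everywhere in $D$, where $\delta_s,\delta_a$ are constants. **Spaces.** Let $V_h=\{v: v|_K\in Z_1(K)\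 \forall K\in\mathcal T_h\}$ and $\mathcal V_h=V_h^{\,n}$. For $v=(v_1,\dots,v_n)\in\mathcal V_h$ let $\overline v=\sum_j w_jv_j$ and $\|v\|^2=\sum_K\sum_j w_j\int_K v_j^2\,dx$. For a piecewise polynomial vector field $\zeta$ let $\|\zeta\|^2=\sum_K\int_K|\zeta|^2\,dx$ and $\Omega\cdot\zeta=(\Omega_1\cdot\zeta,\dots,\Omega_n\cdot\zeta)$. A scalar $\varphi\in V_h$ is identified with the isotropic element $(\varphi,\dots,\varphi)\in\mathcal V_h$. Let $\mathcal C_{h,\mathrm{zero}}$ be the space of isotropic elements of $\mathcal V_h$ that are continuous on $\mathrm{cl}(D)$ and vanish on $\partial D$. For a linear subspace $\mathcal W_h\subset\mathcal V_h$ let $$\overline{\Omega\mathcal W_h}=\Big\{\sum_j w_j\Omega_jv_j: v\in\mathcal W_h\Big\},\qquad \Omega\cdot\overline{\Omega\mathcal W_h}=\{\Omega\cdot\zeta:\zeta\in\overline{\Omega\mathcal W_h}\}.$$ **Scheme** (zero inflow data $\alpha=0$). For $\varepsilon>0$ and $u,v\in\mathcal V_h$ put $$B(u,v)=\sum_K\sum_j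 w_j\Big[-\int_K u_j\,\Omega_j\cdot\nabla v_j\,dx+\int_{\partial K}\widehat u_j\,(\Omega_j\cdot\nu_K)\,v_j^{\mathrm{int}}\,ds+\int_K\Big(\frac{\sigma_s}{\varepsilon}+\varepsilon\sigma_a\Big)u_jv_j\,dx-\int_K\frac{\sigma_s}{\varepsilon}\,\overline u\,v_j\,dx\Big],$$ where $\nu_K$ is the outward unit normal, $v_j^{\mathrm{int}}$ is the trace of $v_j$ from inside $K$, and $\widehat u_j(x)=\lim_{\delta\to0^+}u_j(x-\delta\Omega_j)$ is the upwind trace, taken to be zero if the limit is taken outside $D$. The discontinuous Galerkin (DG) scheme is: find $\psi_h\in\mathcal W_h$ such that $$B(\psi_h,v)=\varepsilon\sum_K\sum_j w_j\int_K q\,v_j\,dx\qquad\forall v\in\mathcal W_h .\tag{1}$$ Let $J_h=\frac1\varepsilon\sum_j w_j\Omega_j\psi_{h,j}$. **Theorem.** Let $\mathcal W_h\subset\mathcal V_h$ be a linear subspace with $\Omega\cdot\overline{\Omega\mathcal W_h}\subset\mathcal W_h$. Then (1) has a unique solution $\psi_h$ for every $\varepsilon>0$. As $\varepsilon\to0^+$,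 with everything else fixed, $\psi_h$ and $J_h$ converge in the norms $\|\cdot\|$ to some $\psi_h^{(0)}=\overline\psi_h^{(0)}\in\mathcal C_{h,\mathrm{zero}}\cap\mathcal W_h$ and $J_h^{(0)}\in\overline{\Omega\mathcal W_h}$, respectively. The pair $(\psi_h^{(0)},J_h^{(0)})$ is the unique solution in $(\mathcal C_{h,\mathrm{zero}}\cap\mathcal W_h)\times\overline{\Omega\mathcal W_h}$ of the mixed problem $$\sum_K\int_K\big(-J_h^{(0)}\cdot\nabla\varphi+\sigma_a\psi_h^{(0)}\varphi\big)\,dx=\int_D q\,\varphi\,dx,\qquad \sum_K\int_K\Big(\tfrac13\nabla\psi_h^{(0)}+\sigma_sJ_h^{(0)}\Big)\cdot\zeta\,dx=0$$ for all $\varphi\in\mathcal C_{h,\mathrm{zero}}\cap\mathcal W_h$ and all $\zeta\in\overline{\Omega\mathcal W_h}$. -/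

import Mathlib

open MeasureTheory Set Filter Topology

noncomputable section

namespace SNDG

/-- The ambient space `ℝ^d` with its Euclidean norm. -/
abbrev E (d : ℕ) : Type := EuclideanSpace ℝ (Fin d)

/-! ### Angular discretization -/

/-- The angular domain `S`: the projection to `ℝ^d` (first `d` coordinates) of the unit sphere
of `ℝ^3`, i.e. the interval `[-1,1]`, the closed unit disk, the unit sphere for `d = 1, 2, 3`. -/
def angularDomain (d : ℕ) : Set (E d) :=
  {x | ∃ y : E 3, ‖y‖ = 1 ∧ ∀ (i : Fin d) (k : Fin 3), (i : ℕ) = (k : ℕ) → x i = y k}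

/-- A quadrature rule on `S` with `n` points and positive weights, exact for polynomials of
degree at most two. -/
structure Quadrature (d n : ℕ) where
  /-- the discrete ordinates -/
  pt : Fin n → E d
  /-- the weights -/
  wt : Fin n → ℝ
  pt_mem : ∀ j, pt j ∈ angularDomain d
  wt_pos : ∀ j, 0 < wt j
  sum_wt : ∑ j, wt j = 1
  sum_wt_pt : ∑ j, wt j • pt j = 0
  sum_wt_pt_pt : ∀ a b : Fin d, ∑ j, wt j * (pt j a * pt j b) = if a = b then 1 / 3 else 0

/-! ### Meshes and local polynomial spaces -/

/-- Polynomials of degree at most one on `ℝ^d`. -/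
def P1 (d : ℕ) : Submodule ℝ (E d → ℝ) :=
  Submodule.span ℝ ({fun _ => 1} ∪ Set.range fun (i : Fin d) (x : E d) => x i)

/-- Multilinear polynomials on `ℝ^d` (degree at most one in each variable). -/
def Q1 (d : ℕ) : Submodule ℝ (E d → ℝ) :=
  Submodule.span ℝ (Set.range fun (s : Finset (Fin d)) (x : E d) => ∏ i ∈ s, x i)

/-- `K` is an open nondegenerate `d`-simplex. -/
def IsOpenSimplex {d : ℕ} (K : Set (E d)) : Prop :=
  ∃ s : Affine.Simplex ℝ (E d) d, K = interior (convexHull ℝ (Set.range s.points))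

/-- `K` is an open axis-parallel box. -/
def IsOpenBox {d : ℕ} (K : Set (E d)) : Prop :=
  ∃ a b : E d, (∀ i, a i < b i) ∧ K = {x | ∀ i, x i ∈ Set.Ioo (a i) (b i)}

/-- A mesh: pairwise disjoint open cells, either all simplices with `Z₁ = P¹`, or all
axis-parallel boxes with `Z₁ = Q¹`. -/
structure Mesh (d : ℕ) (ι : Type*) where
  /-- the open cells -/
  cell : ι → Set (E d)
  /-- the local polynomial space `Z₁` -/
  Z : Submodule ℝ (E d → ℝ)
  shape : (Z = P1 d ∧ ∀ k, IsOpenSimplex (cell k)) ∨ (Z = Q1 d ∧ ∀ k, IsOpenBox (cell k))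
  disjoint : Pairwise fun k l => Disjoint (cell k) (cell l)

variable {d n : ℕ} {ι : Type*}

/-- The open domain `D` that is partitioned by the mesh. -/
def Mesh.domain (M : Mesh d ι) : Set (E d) := interior (⋃ k, closure (M.cell k))

/-! ### Piecewise polynomial fields

A piecewise polynomial `v` is stored as the family of polynomials `v k` with `v = v k` on the
cell `k`; since a polynomial is determined by its values on an open cell, nothing is added.
The value at `x ∈ ∂K` of the polynomial of the cell `K` is the interior trace of `v`. -/

/-- Scalar fields. -/
abbrev Scalar (d : ℕ) (ι : Type*) := ι → E d → ℝ

/-- Vector fields. -/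
abbrev VField (d : ℕ) (ι : Type*) := ι → E d → E d

/-- Angular fields `v = (v_1, …, v_n)`. -/
abbrev Angular (d n : ℕ) (ι : Type*) := Fin n → Scalar d ι

/-- The scalar finite element space `V_h`. -/
def Mesh.V (M : Mesh d ι) : Submodule ℝ (Scalar d ι) where
  carrier := {v | ∀ k, v k ∈ M.Z}
  add_mem' hu hv k := M.Z.add_mem (hu k) (hv k)
  zero_mem' _ := M.Z.zero_mem
  smul_mem' c _ hv k := M.Z.smul_mem c (hv k)

/-- The tensor product space `𝒱_h`, the product of `n` copies of `V_h`. -/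
def Mesh.angularV (M : Mesh d ι) (n : ℕ) : Submodule ℝ (Angular d n ι) where
  carrier := {v | ∀ j, v j ∈ M.V}
  add_mem' hu hv j := M.V.add_mem (hu j) (hv j)
  zero_mem' _ := M.V.zero_mem
  smul_mem' c _ hv j := M.V.smul_mem c (hv j)

/-- The isotropic angular field all of whose components are `φ`. -/
def iso (n : ℕ) : Scalar d ι →ₗ[ℝ] Angular d n ι where
  toFun φ := fun _ => φ
  map_add' _ _ := rfl
  map_smul' _ _ := rfl

/-- The space `C_{h,zero}` (isotropic fields being identified with scalar ones): elements of `V_h`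
that are restrictions of a function which is continuous on `cl D` and vanishes on `∂D`. -/
def Mesh.contZero (M : Mesh d ι) : Submodule ℝ (Scalar d ι) where
  carrier := {v | v ∈ M.V ∧ ∃ f : E d → ℝ, ContinuousOn f (closure M.domain) ∧
    (∀ k, ∀ x ∈ M.cell k, f x = v k x) ∧ ∀ x ∈ frontier M.domain, f x = 0}
  add_mem' := by
    rintro u v ⟨hu, f, hf, hfu, hf0⟩ ⟨hv, g, hg, hgv, hg0⟩
    refine ⟨M.V.add_mem hu hv, fun x => f x + g x, hf.add hg, fun k x hx => ?_, fun x hx => ?_⟩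
    · simp [hfu k x hx, hgv k x hx]
    · simp [hf0 x hx, hg0 x hx]
  zero_mem' := ⟨M.V.zero_mem, fun _ => 0, continuousOn_const, fun _ _ _ => rfl, fun _ _ => rfl⟩
  smul_mem' := by
    rintro c v ⟨hv, f, hf, hfv, hf0⟩
    refine ⟨M.V.smul_mem c hv, fun x => c * f x, continuousOn_const.mul hf,
      fun k x hx => ?_, fun x hx => ?_⟩
    · simp [hfv k x hx]
    · simp [hf0 x hx]

/-- The angular average `v̄ = ∑_j w_j v_j`. -/
def Quadrature.avg (Q : Quadrature d n) (v : Angular d n ι) : Scalar d ι :=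
  fun k x => ∑ j, Q.wt j * v j k x

/-- The first angular moment `∑_j w_j Ω_j v_j`. -/
def Quadrature.moment (Q : Quadrature d n) : Angular d n ι →ₗ[ℝ] VField d ι where
  toFun v := fun k x => ∑ j, (Q.wt j * v j k x) • Q.pt j
  map_add' u v := by
    funext k x
    simp [mul_add, add_smul, Finset.sum_add_distrib]
  map_smul' c v := by
    funext k x
    simp [Finset.smul_sum, smul_smul, mul_left_comm]

/-- The angular field `Ω · ζ = (Ω_1 · ζ, …, Ω_n · ζ)`. -/
def Quadrature.dot (Q : Quadrature d n) (ζ : VField d ι) : Angular d n ι :=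
  fun j k x => inner ℝ (Q.pt j) (ζ k x)

/-- The discrete current `J = ε⁻¹ ∑_j w_j Ω_j ψ_j`. -/
def Quadrature.current (Q : Quadrature d n) (ε : ℝ) (ψ : Angular d n ι) : VField d ι :=
  ε⁻¹ • Q.moment ψ

/-! ### Normals and upwind traces -/

open Classical in
/-- The outward unit normal of a convex set `K` at `x ∈ ∂K`: the unit vector `ν` for which `K`
lies in the half space `ν · (y - x) ≤ 0`. It is set to `0` at the points (edges and vertices, a
null set of `∂K` for a polytope) where this vector is not unique. -/
def outwardNormal (K : Set (E d)) (x : E d) : E d :=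
  if h : ∃! ν : E d, ‖ν‖ = 1 ∧ ∀ y ∈ K, inner ℝ ν (y - x) ≤ 0 then h.choose else 0

open Classical in
/-- The upwind trace `lim_{δ → 0⁺} v (x - δ Ω)` of a piecewise polynomial `v` that is extended by
zero outside the cells. The only nonzero term belongs to the cell, if any, that contains
`x - δ Ω` for all small `δ > 0`. -/
def Mesh.upwind [Fintype ι] (M : Mesh d ι) (Ω : E d) (v : Scalar d ι) (x : E d) : ℝ :=
  ∑ k, if ∀ᶠ δ : ℝ in 𝓝[>] 0, x - δ • Ω ∈ M.cell k then v k x else 0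

/-! ### The scheme -/

variable [Fintype ι]

/-- The bilinear form `L(u,v)`, with cross sections `σs`, `σa`. The boundary integrals are taken
with respect to the `(d-1)`-dimensional surface measure. -/
def formL (M : Mesh d ι) (Q : Quadrature d n) (σs σa : E d → ℝ) (ε : ℝ)
    (u v : Angular d n ι) : ℝ :=
  ∑ k, ∑ j, Q.wt j *
    (-(∫ x in M.cell k, u j k x * inner ℝ (Q.pt j) (gradient (v j k) x))
      + (∫ x in frontier (M.cell k),
          M.upwind (Q.pt j) (u j) x * inner ℝ (Q.pt j) (outwardNormal (M.cell k) x) * v j k x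
            ∂μHE[d - 1])
      + ∫ x in M.cell k, (σs x / ε + ε * σa x) * u j k x * v j k x)

/-- The bilinear form `S(u,v)`. -/
def formS (M : Mesh d ι) (Q : Quadrature d n) (σs : E d → ℝ) (ε : ℝ)
    (u v : Angular d n ι) : ℝ :=
  ∑ k, ∑ j, Q.wt j * ∫ x in M.cell k, σs x / ε * Q.avg u k x * v j k x

/-- The bilinear form `B = L - S`. -/
def formB (M : Mesh d ι) (Q : Quadrature d n) (σs σa : E d → ℝ) (ε : ℝ)
    (u v : Angular d n ι) : ℝ :=
  formL M Q σs σa ε u v - formS M Q σs ε u v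

/-- The right-hand side for zero inflow data, with source `q`. -/
def load (M : Mesh d ι) (Q : Quadrature d n) (q : E d → ℝ) (ε : ℝ) (v : Angular d n ι) : ℝ :=
  ∑ k, ∑ j, Q.wt j * ∫ x in M.cell k, ε * q x * v j k x

/-- `ψ` solves the discontinuous Galerkin scheme with trial and test space `W`. -/
def IsDGSolution (M : Mesh d ι) (Q : Quadrature d n) (σs σa q : E d → ℝ)
    (W : Submodule ℝ (Angular d n ι)) (ε : ℝ) (ψ : Angular d n ι) : Prop :=
  ψ ∈ W ∧ ∀ v ∈ W, formB M Q σs σa ε ψ v = load M Q q ε v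

/-- `(ψ, J)` solves the mixed diffusion problem: `ψ` belongs to `C_{h,zero} ∩ W`, `J` to the space
of first moments of `W`, and both equations hold for all test functions in these spaces. -/
def IsMixedSolution (M : Mesh d ι) (Q : Quadrature d n) (σs σa q : E d → ℝ)
    (W : Submodule ℝ (Angular d n ι)) (ψ : Scalar d ι) (J : VField d ι) : Prop :=
  ψ ∈ M.contZero ⊓ W.comap (iso n) ∧ J ∈ W.map Q.moment ∧
  (∀ φ ∈ M.contZero ⊓ W.comap (iso n),
    ∑ k, ∫ x in M.cell k, (-(inner ℝ (J k x) (gradient (φ k) x)) + σa x * ψ k x * φ k x)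
      = ∑ k, ∫ x in M.cell k, q x * φ k x) ∧
  ∀ ζ ∈ W.map Q.moment,
    ∑ k, ∫ x in M.cell k,
      inner ℝ ((1 / 3 : ℝ) • gradient (ψ k) x + σs x • J k x) (ζ k x) = 0

/-- The norm `‖v‖` of an angular field. -/
def angularNorm (M : Mesh d ι) (Q : Quadrature d n) (v : Angular d n ι) : ℝ :=
  √(∑ k, ∑ j, Q.wt j * ∫ x in M.cell k, v j k x ^ 2)

/-- The `L²` norm of a vector field. -/
def vectorNorm (M : Mesh d ι) (ζ : VField d ι) : ℝ :=
  √(∑ k, ∫ x in M.cell k, ‖ζ k x‖ ^ 2)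

end SNDG

end

/-! The proof has an abstract limit argument and a slicing argument that shows the scheme to be of
the abstract form.

Abstract limit (`DiffusiveScheme`). Write B = A + ε⁻¹C + εG with advection A, scattering C (the
angular covariance weighted by σ_s) and absorption G. Testing (1) with ψ_h, the signs of A and C and
the coercivity of G bound ψ_h uniformly in ε; hence A(ψ_h,ψ_h) = O(ε) and C(ψ_h,ψ_h) = O(ε²). Since
∑ w_jΩ_j = 0 and ∑ w_j|Ω_j|² = d/3 ≤ 1, Cauchy–Schwarz bounds the squared first moment by the
angular variance (`norm_moment_sq_le`), so the bound on C also bounds J_h. By finite dimension limit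
points exist. At a limit point A and C vanish on the diagonal, which forces it into C_{h,zero}.
Isotropic test functions in C_{h,zero} annihilate C and, after division by ε, give the first mixed
equation. Test functions Ω·ζ, admissible by the hypothesis on W_h, give the second, with 1/3 coming
from the second moments. The mixed problem has at most one solution, so the limit points coincide
and everything converges (`diffusionLimit`); its solvability is a by-product.

Slicing. The properties of A are proved on lines parallel to one ordinate. The flux through the
boundary of a polytope is an integral over lines of exit minus entry values
(`setIntegral_frontier`), so the advection form is an integral of one-dimensional upwind forms
(`advect_eq_integral`). On a line the cells are disjoint intervals, and hanging nodes need no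
special treatment. There, twice the form on the diagonal is the sum of the squared jumps and the
squared free outflow (`form_self`), and fields without jumps can be integrated by parts.

Kernel of A. If A vanishes on an isotropic field, the field, extended by zero, has no jumps on
almost every line along every Ω_j, hence is Lipschitz along these lines. The second moments make the
Ω_j a tight frame, so every translation is a composition of translations along ordinates; the field
is then Lipschitz off the skeleton, and its Lipschitz extension vanishes outside the mesh
(`mem_contZero_of_advect_self_eq_zero`). This gives both continuity and the boundary condition. -/

noncomputable section

namespace SNDG

/-! ### Piecewise smooth functions on a line -/

/-- A finite family of nonempty, pairwise non-overlapping open intervals `(lo k, hi k)`, `k ∈ s`. -/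
structure Intervals (ι : Type*) where
  /-- the indices of the intervals -/
  s : Finset ι
  /-- the left end points -/
  lo : ι → ℝ
  /-- the right end points -/
  hi : ι → ℝ
  lt : ∀ k ∈ s, lo k < hi k
  sep : ∀ k ∈ s, ∀ l ∈ s, k ≠ l → hi k ≤ lo l ∨ hi l ≤ lo k

namespace Intervals

variable {ι : Type*} (I : Intervals ι)

theorem hi_inj {k l : ι} (hk : k ∈ I.s) (hl : l ∈ I.s) (h : I.hi k = I.hi l) : k = l := by
  by_contra hne
  have h1 := I.lt k hk
  have h2 := I.lt l hl
  rcases I.sep k hk l hl hne with h3 | h3 <;> linarith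

theorem lo_inj {k l : ι} (hk : k ∈ I.s) (hl : l ∈ I.s) (h : I.lo k = I.lo l) : k = l := by
  by_contra hne
  have h1 := I.lt k hk
  have h2 := I.lt l hl
  rcases I.sep k hk l hl hne with h3 | h3 <;> linarith

open Classical in
/-- The trace at `t` of the piece, if any, whose interval ends at `t`. -/
def left (u : ι → ℝ → ℝ) (t : ℝ) : ℝ := ∑ l ∈ I.s, if I.hi l = t then u l t else 0

open Classical in
/-- The trace at `t` of the piece, if any, whose interval begins at `t`. -/
def right (u : ι → ℝ → ℝ) (t : ℝ) : ℝ := ∑ k ∈ I.s, if I.lo k = t then u k t else 0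

/-- The one-dimensional upwind form. -/
def form (u v : ι → ℝ → ℝ) : ℝ :=
  ∑ k ∈ I.s, (-(∫ t in I.lo k..I.hi k, u k t * deriv (v k) t) + u k (I.hi k) * v k (I.hi k)
    - I.left u (I.lo k) * v k (I.lo k))

/-- The function with pieces `u k`, extended by zero, has no jumps. -/
def Matched (u : ι → ℝ → ℝ) : Prop :=
  (∀ k ∈ I.s, I.left u (I.lo k) = u k (I.lo k)) ∧ ∀ l ∈ I.s, I.right u (I.hi l) = u l (I.hi l)

theorem left_eq {u : ι → ℝ → ℝ} {t : ℝ} {l : ι} (hl : l ∈ I.s) (h : I.hi l = t) :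
    I.left u t = u l t := by
  unfold left
  rw [Finset.sum_eq_single l, if_pos h]
  · intro k hk hne
    rw [if_neg]
    exact fun h' => hne (I.hi_inj hk hl (h'.trans h.symm))
  · exact fun h' => absurd hl h'

theorem right_eq {u : ι → ℝ → ℝ} {t : ℝ} {l : ι} (hl : l ∈ I.s) (h : I.lo l = t) :
    I.right u t = u l t := by
  unfold right
  rw [Finset.sum_eq_single l, if_pos h]
  · intro k hk hne
    rw [if_neg]
    exact fun h' => hne (I.lo_inj hk hl (h'.trans h.symm))
  · exact fun h' => absurd hl h'

theorem right_eq_zero {u : ι → ℝ → ℝ} {t : ℝ} (h : ∀ l ∈ I.s, I.lo l ≠ t) : I.right u t = 0 :=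
  Finset.sum_eq_zero fun l hl => if_neg (h l hl)

/-- Summation of products of traces over the common end points. -/
theorem sum_left_mul (u v : ι → ℝ → ℝ) :
    ∑ k ∈ I.s, I.left u (I.lo k) * v k (I.lo k) = ∑ l ∈ I.s, u l (I.hi l) * I.right v (I.hi l) := by
  unfold left right
  simp only [Finset.sum_mul, Finset.mul_sum]
  rw [Finset.sum_comm]
  refine Finset.sum_congr rfl fun l _ => Finset.sum_congr rfl fun k _ => ?_
  by_cases h : I.hi l = I.lo k
  · simp [h]
  · simp [h, Ne.symm h]

/-- By `sum_left_mul` the inflow terms can be collected at the right ends, where they meet the trace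
of `v` from beyond. Without a jump of `v` they cancel the outflow terms, whatever the jumps of `u`.
-/
theorem form_right_of_matched {u v : ι → ℝ → ℝ} (hv : I.Matched v) :
    I.form u v = -∑ k ∈ I.s, ∫ t in I.lo k..I.hi k, u k t * deriv (v k) t := by
  unfold form
  have h : ∑ l ∈ I.s, u l (I.hi l) * I.right v (I.hi l) = ∑ l ∈ I.s, u l (I.hi l) * v l (I.hi l) :=
    Finset.sum_congr rfl fun l hl => by rw [hv.2 l hl]
  rw [Finset.sum_sub_distrib, Finset.sum_add_distrib, I.sum_left_mul, Finset.sum_neg_distrib, h,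
    add_sub_cancel_right]

theorem integral_mul_deriv {f g : ℝ → ℝ} (hf : ContDiff ℝ 1 f) (hg : ContDiff ℝ 1 g) (a b : ℝ) :
    ∫ t in a..b, f t * deriv g t = f b * g b - f a * g a - ∫ t in a..b, g t * deriv f t := by
  rw [intervalIntegral.integral_mul_deriv_eq_deriv_mul (u := f) (u' := deriv f)
    (fun x _ => (hf.differentiable (by simp) x).hasDerivAt)
    (fun x _ => (hg.differentiable (by simp) x).hasDerivAt)
    ((hf.continuous_deriv (by simp)).intervalIntegrable _ _)
    ((hg.continuous_deriv (by simp)).intervalIntegrable _ _)]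
  simp only [mul_comm]

/-- Without jumps of `u` the upwind trace at an entry is the interior trace, so integration by parts
removes all end point terms. -/
theorem form_left_of_matched {u v : ι → ℝ → ℝ} (hu : ∀ k, ContDiff ℝ 1 (u k))
    (hv : ∀ k, ContDiff ℝ 1 (v k)) (h : I.Matched u) :
    I.form u v = ∑ k ∈ I.s, ∫ t in I.lo k..I.hi k, v k t * deriv (u k) t := by
  unfold form
  refine Finset.sum_congr rfl fun k hk => ?_
  rw [h.1 k hk, integral_mul_deriv (hu k) (hv k)]
  ring

/-- Completing the square at each left end costs the square of the left trace. These squares are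
moved to the right ends by `sum_left_mul`, with the left trace itself as second factor. -/
theorem form_self {u : ι → ℝ → ℝ} (hu : ∀ k, ContDiff ℝ 1 (u k)) :
    2 * I.form u u = (∑ k ∈ I.s, (I.left u (I.lo k) - u k (I.lo k)) ^ 2)
      + ∑ l ∈ I.s, (u l (I.hi l) ^ 2 - u l (I.hi l) * I.right (fun _ t => I.left u t) (I.hi l)) := by
  rw [Finset.sum_sub_distrib, ← I.sum_left_mul]
  unfold form
  rw [Finset.mul_sum, ← Finset.sum_sub_distrib, ← Finset.sum_add_distrib]
  refine Finset.sum_congr rfl fun k hk => ?_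
  have := integral_mul_deriv (hu k) (hu k) (I.lo k) (I.hi k)
  have h2 : ∫ t in I.lo k..I.hi k, u k t * deriv (u k) t
      = (u k (I.hi k) ^ 2 - u k (I.lo k) ^ 2) / 2 := by linarith
  rw [h2]
  ring

-- If another interval begins at `hi l`, what leaves `l` is exactly what enters there; otherwise it
-- is lost, and its square contributes to the energy.
open Classical in
theorem defect_eq (u : ι → ℝ → ℝ) {l : ι} (hl : l ∈ I.s) :
    u l (I.hi l) ^ 2 - u l (I.hi l) * I.right (fun _ t => I.left u t) (I.hi l)
      = if ∃ k ∈ I.s, I.lo k = I.hi l then 0 else u l (I.hi l) ^ 2 := by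
  split_ifs with h
  · obtain ⟨k, hk, hkl⟩ := h
    rw [I.right_eq hk hkl, I.left_eq hl rfl]
    ring
  · rw [I.right_eq_zero fun k hk hkl => h ⟨k, hk, hkl⟩]
    ring

theorem form_self_nonneg {u : ι → ℝ → ℝ} (hu : ∀ k, ContDiff ℝ 1 (u k)) : 0 ≤ I.form u u := by
  classical
  have h := I.form_self hu
  rw [Finset.sum_congr rfl fun l hl => I.defect_eq u hl] at h
  have h1 : 0 ≤ ∑ k ∈ I.s, (I.left u (I.lo k) - u k (I.lo k)) ^ 2 :=
    Finset.sum_nonneg fun _ _ => sq_nonneg _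
  have h2 : 0 ≤ ∑ l ∈ I.s, if ∃ k ∈ I.s, I.lo k = I.hi l then 0 else u l (I.hi l) ^ 2 :=
    Finset.sum_nonneg fun l _ => by split_ifs <;> positivity
  linarith

/-- All terms in `form_self` are nonnegative, so all vanish: the squared jumps give matching at the
left ends, the lost outflow gives zero traces at the free right ends. -/
theorem matched_of_form_self_eq_zero {u : ι → ℝ → ℝ} (hu : ∀ k, ContDiff ℝ 1 (u k))
    (h0 : I.form u u = 0) : I.Matched u := by
  classical
  have h := I.form_self hu
  rw [Finset.sum_congr rfl fun l hl => I.defect_eq u hl] at h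
  have n1 : ∀ k ∈ I.s, 0 ≤ (I.left u (I.lo k) - u k (I.lo k)) ^ 2 := fun _ _ => sq_nonneg _
  have n2 : ∀ l ∈ I.s, 0 ≤ if ∃ k ∈ I.s, I.lo k = I.hi l then 0 else u l (I.hi l) ^ 2 :=
    fun l _ => by split_ifs <;> positivity
  have h1 := Finset.sum_nonneg n1
  have h2 := Finset.sum_nonneg n2
  have e1 := (Finset.sum_eq_zero_iff_of_nonneg n1).1 (by linarith)
  have e2 := (Finset.sum_eq_zero_iff_of_nonneg n2).1 (by linarith)
  have m1 : ∀ k ∈ I.s, I.left u (I.lo k) = u k (I.lo k) := fun k hk => by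
    have := e1 k hk
    nlinarith [pow_eq_zero_iff (two_ne_zero) |>.1 this]
  refine ⟨m1, fun l hl => ?_⟩
  by_cases hs : ∃ k ∈ I.s, I.lo k = I.hi l
  · obtain ⟨k, hk, hkl⟩ := hs
    rw [I.right_eq hk hkl, ← hkl, ← m1 k hk, I.left_eq hl hkl.symm]
  · have := e2 l hl
    rw [if_neg hs] at this
    rw [I.right_eq_zero fun k hk hkl => hs ⟨k, hk, hkl⟩, pow_eq_zero_iff two_ne_zero |>.1 this]

/-! ### Lipschitz bound for functions without jumps -/

open Classical in
/-- The function with pieces `u k`, extended by zero. -/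
def val (u : ι → ℝ → ℝ) (t : ℝ) : ℝ :=
  ∑ k ∈ I.s, if I.lo k < t ∧ t < I.hi k then u k t else 0

-- A telescoping sum that does not order the intervals: an interval passed completely contributes
-- its full increment, the current one a partial increment, later ones nothing, and matched traces
-- cancel. End points are excluded because `val` vanishes there.
open Classical in
theorem Matched.val_eq {I : Intervals ι} {u : ι → ℝ → ℝ} (h : I.Matched u) {t : ℝ}
    (ht : ∀ k ∈ I.s, t ≠ I.lo k ∧ t ≠ I.hi k) :
    I.val u t = ∑ k ∈ I.s, (u k (max (I.lo k) (min t (I.hi k))) - u k (I.lo k)) := by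
  -- The cancellation of traces before `t`: apply `sum_left_mul` with the indicator of `(-∞, t)` as
  -- second factor. At a free right end the trace is zero by matching.
  have key : ∑ l ∈ I.s, (if I.hi l < t then u l (I.hi l) else 0)
      = ∑ k ∈ I.s, if I.lo k < t then u k (I.lo k) else 0 := by
    have e1 : ∀ l ∈ I.s, (if I.hi l < t then u l (I.hi l) else 0)
        = u l (I.hi l) * I.right (fun _ r => if r < t then 1 else 0) (I.hi l) := fun l hl => by
      by_cases hs : ∃ k ∈ I.s, I.lo k = I.hi l
      · obtain ⟨k, hk, hkl⟩ := hs
        rw [I.right_eq hk hkl]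
        simp
      · have hz := h.2 l hl
        rw [I.right_eq_zero fun k hk hkl => hs ⟨k, hk, hkl⟩] at hz
        rw [← hz]
        simp
    rw [Finset.sum_congr rfl e1, ← I.sum_left_mul]
    refine Finset.sum_congr rfl fun k hk => ?_
    rw [h.1 k hk]
    simp
  have e : ∀ k ∈ I.s, u k (max (I.lo k) (min t (I.hi k))) - u k (I.lo k)
      = (if I.lo k < t ∧ t < I.hi k then u k t else 0)
        + ((if I.hi k < t then u k (I.hi k) else 0)
          - if I.lo k < t then u k (I.lo k) else 0) := fun k hk => by
    have hlt := I.lt k hk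
    obtain ⟨h1, h2⟩ := ht k hk
    rcases lt_or_gt_of_ne h1 with h3 | h3
    · have : ¬ I.lo k < t := by linarith
      have h5 : ¬ I.hi k < t := by linarith
      rw [min_eq_left (by linarith), max_eq_left h3.le]
      simp [this, h5]
    · rcases lt_or_gt_of_ne h2 with h4 | h4
      · have h5 : ¬ I.hi k < t := by linarith
        rw [min_eq_left h4.le, max_eq_right h3.le]
        simp [h3, h4, h5]
        ring
      · have h5 : ¬ t < I.hi k := by linarith
        rw [min_eq_right h4.le, max_eq_right hlt.le]
        simp [h3, h4, h5]
  rw [Finset.sum_congr rfl e, Finset.sum_add_distrib, Finset.sum_sub_distrib, key, sub_self,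
    add_zero]
  rfl

/-- Every summand of `val_eq` is `u k` composed with the 1-Lipschitz projection onto its interval.
The factor `card` is crude, but it is bounded by the number of cells, uniformly over all lines. -/
theorem Matched.abs_val_sub_le {I : Intervals ι} {u : ι → ℝ → ℝ} (h : I.Matched u)
    (hu : ∀ k, ContDiff ℝ 1 (u k)) {L : ℝ}
    (hL : ∀ k ∈ I.s, ∀ t ∈ Icc (I.lo k) (I.hi k), |deriv (u k) t| ≤ L) {t r : ℝ}
    (ht : ∀ k ∈ I.s, t ≠ I.lo k ∧ t ≠ I.hi k) (hr : ∀ k ∈ I.s, r ≠ I.lo k ∧ r ≠ I.hi k) :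
    |I.val u t - I.val u r| ≤ I.s.card * (L * |t - r|) := by
  rw [h.val_eq ht, h.val_eq hr, ← Finset.sum_sub_distrib, ← nsmul_eq_mul]
  refine (Finset.abs_sum_le_sum_abs _ _).trans (Finset.sum_le_card_nsmul _ _ _ fun k hk => ?_)
  rw [sub_sub_sub_cancel_right]
  have hlt := (I.lt k hk).le
  have hmem : ∀ x : ℝ, max (I.lo k) (min x (I.hi k)) ∈ Icc (I.lo k) (I.hi k) := fun x =>
    ⟨le_max_left _ _, max_le hlt (min_le_right _ _)⟩
  have h1 := (convex_Icc (I.lo k) (I.hi k)).norm_image_sub_le_of_norm_deriv_le (f := u k) (C := L)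
    (fun x _ => (hu k).differentiable (by simp) x) (fun x hx => hL k hk x hx) (hmem r) (hmem t)
  have hL0 : 0 ≤ L := (abs_nonneg _).trans (hL k hk _ (left_mem_Icc.2 hlt))
  refine h1.trans (mul_le_mul_of_nonneg_left ?_ hL0)
  rw [Real.norm_eq_abs]
  refine (abs_max_sub_max_le_max _ _ _ _).trans ?_
  rw [sub_self, abs_zero, max_eq_right (abs_nonneg _)]
  exact (abs_min_sub_min_le_max _ _ _ _).trans (by simp)

end Intervals

end SNDG

end

noncomputable section

namespace SNDG

/-! ### Parallel lines -/

/-- A unit vector together with an isometric parametrization of its orthogonal complement. -/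
structure LineFrame (d : ℕ) where
  /-- the common direction of the lines -/
  dir : E d
  /-- the parametrization of the orthogonal complement -/
  emb : E (d - 1) →ₗᵢ[ℝ] E d
  norm_dir : ‖dir‖ = 1
  inner_dir_emb : ∀ y, inner ℝ dir (emb y) = 0
  pos : 1 ≤ d

theorem exists_lineFrame {d : ℕ} (hd : 1 ≤ d) {ω : E d} (hω : ‖ω‖ = 1) :
    ∃ F : LineFrame d, F.dir = ω := by
  have : Fact (Module.finrank ℝ (E d) = (d - 1) + 1) := ⟨by simp; omega⟩
  have h0 : ω ≠ 0 := by
    rintro rfl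
    simp at hω
  let b := OrthonormalBasis.fromOrthogonalSpanSingleton (𝕜 := ℝ) (d - 1) h0
  refine ⟨⟨ω, (ℝ ∙ ω)ᗮ.subtypeₗᵢ.comp b.repr.symm.toLinearIsometry, hω, fun y => ?_, hd⟩, rfl⟩
  exact Submodule.mem_orthogonal_singleton_iff_inner_right.1 (b.repr.symm y).2

namespace LineFrame

variable {d : ℕ} (F : LineFrame d)

/-- The point with parameter `t` on the line through `emb y`. -/
def pt (y : E (d - 1)) (t : ℝ) : E d := F.emb y + t • F.dir

/-- The frame with the opposite direction. -/
def neg : LineFrame d where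
  dir := -F.dir
  emb := F.emb
  norm_dir := by rw [norm_neg, F.norm_dir]
  inner_dir_emb y := by rw [inner_neg_left, F.inner_dir_emb, neg_zero]
  pos := F.pos

theorem neg_pt (y : E (d - 1)) (t : ℝ) : F.neg.pt y t = F.pt y (-t) := by
  simp [pt, neg]

theorem inner_dir_dir : inner ℝ F.dir F.dir = (1 : ℝ) := by
  rw [real_inner_self_eq_norm_sq, F.norm_dir, one_pow]

theorem norm_pt_sq (y : E (d - 1)) (t : ℝ) : ‖F.pt y t‖ ^ 2 = ‖y‖ ^ 2 + t ^ 2 := by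
  rw [pt, norm_add_sq_real, inner_smul_right, real_inner_comm, F.inner_dir_emb, norm_smul,
    F.norm_dir, F.emb.norm_map]
  simp

/-- The isometry between the parameters of the points of the lines and the space. -/
def equiv : WithLp 2 (E (d - 1) × ℝ) ≃ₗᵢ[ℝ] E d :=
  LinearIsometry.toLinearIsometryEquiv
    { toFun := fun p => F.pt p.fst p.snd
      map_add' := fun p q => by
        simp only [pt, WithLp.add_fst, WithLp.add_snd, map_add, add_smul]
        abel
      map_smul' := fun c p => by simp [pt, smul_smul]
      norm_map' := fun p => by
        rw [← sq_eq_sq₀ (norm_nonneg _) (norm_nonneg _), WithLp.prod_norm_sq_eq_of_L2]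
        simp [F.norm_pt_sq] }
    (by
      have := F.pos
      rw [(WithLp.linearEquiv 2 ℝ (E (d - 1) × ℝ)).finrank_eq]
      simp
      omega)

theorem measurePreserving_pt :
    MeasurePreserving (fun p : E (d - 1) × ℝ => F.pt p.1 p.2) :=
  F.equiv.measurePreserving.comp (WithLp.volume_preserving_toLp _ _)

theorem exists_pt_eq (x : E d) : ∃ y t, F.pt y t = x :=
  ⟨(F.equiv.symm x).fst, (F.equiv.symm x).snd, F.equiv.apply_symm_apply x⟩

theorem measurableEmbedding_pt :
    MeasurableEmbedding (fun p : E (d - 1) × ℝ => F.pt p.1 p.2) :=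
  F.equiv.toHomeomorph.measurableEmbedding.comp
    (MeasurableEquiv.toLp 2 (E (d - 1) × ℝ)).measurableEmbedding

theorem continuous_pt : Continuous (fun p : E (d - 1) × ℝ => F.pt p.1 p.2) := by
  unfold pt
  have := F.emb.continuous
  fun_prop

theorem inner_pt (ν : E d) (y : E (d - 1)) (t : ℝ) :
    inner ℝ ν (F.pt y t) = inner ℝ ν (F.emb y) + t * inner ℝ ν F.dir := by
  rw [pt, inner_add_right, inner_smul_right]

/-! ### Hyperplanes as graphs -/

/-- The parameter at which a line meets the hyperplane `⟨ν, x⟩ = c`. -/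
def height (ν : E d) (c : ℝ) (y : E (d - 1)) : ℝ := (c - inner ℝ ν (F.emb y)) / inner ℝ ν F.dir

/-- The point at which a line meets the hyperplane `⟨ν, x⟩ = c`. -/
def graph (ν : E d) (c : ℝ) (y : E (d - 1)) : E d := F.pt y (F.height ν c y)

variable {F} {ν : E d} {c : ℝ}

theorem inner_pt_eq_iff (hν : inner ℝ ν F.dir ≠ 0) {y : E (d - 1)} {t : ℝ} :
    inner ℝ ν (F.pt y t) = c ↔ t = F.height ν c y := by
  rw [inner_pt, height, eq_div_iff hν, eq_sub_iff_add_eq, add_comm]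

theorem continuous_height : Continuous (F.height ν c) := by
  unfold height
  have := F.emb.continuous
  fun_prop

theorem continuous_graph : Continuous (F.graph ν c) :=
  F.continuous_pt.comp (continuous_id.prodMk continuous_height)

variable (F ν) in
/-- The linear part of `graph`. -/
def graphLin : E (d - 1) →ₗ[ℝ] E d where
  toFun y := F.emb y - (inner ℝ ν (F.emb y) / inner ℝ ν F.dir) • F.dir
  map_add' y z := by
    rw [map_add, inner_add_right, add_div, add_smul]
    abel
  map_smul' r y := by
    simp only [map_smul, inner_smul_right, RingHom.id_apply, mul_div_assoc, smul_sub, smul_smul]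

theorem graph_eq (y : E (d - 1)) :
    F.graph ν c y = (c / inner ℝ ν F.dir) • F.dir + F.graphLin ν y := by
  simp only [graph, pt, height, graphLin, LinearMap.coe_mk, AddHom.coe_mk, sub_div, sub_smul]
  abel

/-- With ν = emb y₀ + s • dir, the Gram operator of the graph is the identity plus the rank-one map
s⁻² y₀ ⊗ y₀. Its determinant is 1 + ‖y₀‖²/s² = s⁻², because ‖y₀‖² + s² = 1. -/
theorem normDet_graphLin (h1 : ‖ν‖ = 1) (hν : inner ℝ ν F.dir ≠ 0) :
    (F.graphLin ν).normDet = |inner ℝ ν F.dir|⁻¹ := by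
  obtain ⟨y₀, s, rfl⟩ := F.exists_pt_eq ν
  have hs : inner ℝ (F.pt y₀ s) F.dir = s := by
    rw [real_inner_comm, inner_pt, F.inner_dir_emb, F.inner_dir_dir]
    ring
  have hin : ∀ y, inner ℝ (F.pt y₀ s) (F.emb y) = inner ℝ y₀ y := fun y => by
    rw [pt, inner_add_left, inner_smul_left, F.inner_dir_emb, F.emb.inner_map_map]
    simp
  have hn := F.norm_pt_sq y₀ s
  rw [h1] at hn
  rw [hs] at hν ⊢
  have hadj : (F.graphLin (F.pt y₀ s)).adjoint ∘ₗ F.graphLin (F.pt y₀ s)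
      = LinearMap.transvection (innerₛₗ ℝ (s⁻¹ • y₀)) (s⁻¹ • y₀) := by
    ext1 y
    refine ext_inner_right ℝ fun z => ?_
    rw [LinearMap.comp_apply, LinearMap.adjoint_inner_left]
    simp only [graphLin, LinearMap.coe_mk, AddHom.coe_mk, hin, hs, inner_sub_left, inner_sub_right,
      inner_smul_left, inner_smul_right, F.emb.inner_map_map, F.inner_dir_emb, F.inner_dir_dir,
      LinearMap.transvection.apply, inner_add_left, innerₛₗ_apply_apply,
      real_inner_comm F.dir]
    simp
    ring
  have hsq := LinearMap.normDet_sq (F.graphLin (F.pt y₀ s))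
  rw [hadj, LinearMap.transvection.det, innerₛₗ_apply_apply, inner_smul_left, inner_smul_right,
    real_inner_self_eq_norm_sq] at hsq
  rw [← sq_eq_sq₀ (LinearMap.normDet_nonneg _) (by positivity), inv_pow, sq_abs]
  have : (F.graphLin (F.pt y₀ s)).normDet ^ 2 = 1 + s⁻¹ * (s⁻¹ * ‖y₀‖ ^ 2) := by
    simpa using hsq
  rw [this]
  field_simp
  linarith

/-- The area formula for a hyperplane viewed as a graph over the base of the lines. The density |ν ·
dir| is the factor that occurs in the upwind flux, so fluxes become plain integrals over lines. -/
theorem map_graph (h1 : ‖ν‖ = 1) (hν : inner ℝ ν F.dir ≠ 0) :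
    (volume : Measure (E (d - 1))).map (F.graph ν c)
      = ENNReal.ofReal |inner ℝ ν F.dir| • (μHE[d - 1] : Measure (E d)).restrict
          {x | inner ℝ ν x = c} := by
  ext A hA
  rw [Measure.map_apply continuous_graph.measurable hA, Measure.smul_apply,
    Measure.restrict_apply hA, smul_eq_mul]
  have hset : A ∩ {x | inner ℝ ν x = c}
      = (fun x => (c / inner ℝ ν F.dir) • F.dir + x) '' (F.graphLin ν '' (F.graph ν c ⁻¹' A)) := by
    rw [image_image]
    ext x
    simp only [mem_inter_iff, mem_ofPred_eq, mem_image, mem_preimage, ← graph_eq]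
    constructor
    · rintro ⟨hxA, hx⟩
      obtain ⟨y, t, rfl⟩ := F.exists_pt_eq x
      have := (inner_pt_eq_iff hν).1 hx
      subst this
      exact ⟨y, hxA, rfl⟩
    · rintro ⟨y, hy, rfl⟩
      exact ⟨hy, (inner_pt_eq_iff hν).2 rfl⟩
  have himg := LinearMap.euclideanHausdorffMeasure_image_eq_normDet_mul_volume (F.graphLin ν)
    (F.graph ν c ⁻¹' A)
  rw [finrank_euclideanSpace, Fintype.card_fin] at himg
  rw [hset, (isometry_add_left _).euclideanHausdorffMeasure_image, himg, normDet_graphLin h1 hν,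
    ← mul_assoc, ← ENNReal.ofReal_mul (abs_nonneg _), mul_inv_cancel₀ (abs_ne_zero.2 hν)]
  simp

end LineFrame

/-! ### Null sets -/

theorem volume_inner_eq_zero {m : ℕ} {a : E m} (ha : a ≠ 0) (c : ℝ) :
    volume {y : E m | inner ℝ a y = c} = 0 := by
  let f : E m →ᵃ[ℝ] ℝ := (innerₛₗ ℝ a).toAffineMap
  have hs : ({y : E m | inner ℝ a y = c} : Set (E m))
      = ((AffineSubspace.mk' c (⊥ : Submodule ℝ ℝ)).comap f : AffineSubspace ℝ (E m)) := by
    ext y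
    simp [f, AffineSubspace.mem_mk', sub_eq_zero]
  rw [hs]
  refine Measure.addHaar_affineSubspace _ _ fun htop => ?_
  have h : ∀ y : E m, inner ℝ a y = c := fun y => by
    have : y ∈ ((AffineSubspace.mk' c (⊥ : Submodule ℝ ℝ)).comap f : Set (E m)) := by
      rw [htop]
      trivial
    rw [← hs] at this
    exact this
  have h0 := h 0
  have h1 := h a
  rw [inner_zero_right] at h0
  rw [← h0, inner_self_eq_zero] at h1
  exact ha h1

/-- Equality of the heights is one affine equation in `y`. Its linear part degenerates only for
parallel normals, which are then equal, being unit vectors on the same side; in that case the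
offsets differ and the equation has no solution. This discards lines that leave a polytope through
two faces at once. -/
theorem LineFrame.ae_height_ne {d : ℕ} {F : LineFrame d} {ν ν' : E d} {c c' : ℝ} (h1 : ‖ν‖ = 1)
    (h1' : ‖ν'‖ = 1) (hν : 0 < inner ℝ ν F.dir) (hν' : 0 < inner ℝ ν' F.dir)
    (hne : (ν, c) ≠ (ν', c')) : ∀ᵐ y, F.height ν c y ≠ F.height ν' c' y := by
  obtain ⟨a, s, rfl⟩ := F.exists_pt_eq ν
  obtain ⟨a', s', rfl⟩ := F.exists_pt_eq ν'
  have hs : ∀ a s, inner ℝ (F.pt a s) F.dir = s := fun a s => by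
    rw [real_inner_comm, inner_pt, F.inner_dir_emb, F.inner_dir_dir]
    ring
  have hin : ∀ a s y, inner ℝ (F.pt a s) (F.emb y) = inner ℝ a y := fun a s y => by
    rw [pt, inner_add_left, inner_smul_left, F.inner_dir_emb, F.emb.inner_map_map]
    simp
  simp only [hs] at hν hν'
  simp only [height, hs, hin]
  have hn := F.norm_pt_sq a s
  have hn' := F.norm_pt_sq a' s'
  rw [h1] at hn
  rw [h1'] at hn'
  by_cases hz : s' • a - s • a' = 0
  · rw [sub_eq_zero] at hz
    have hnorm : s' ^ 2 * ‖a‖ ^ 2 = s ^ 2 * ‖a'‖ ^ 2 := by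
      have := congrArg (fun v => ‖v‖ ^ 2) hz
      simpa [norm_smul, mul_pow] using this
    have hss : s = s' := by
      have : s ^ 2 = s' ^ 2 := by nlinarith
      exact (sq_eq_sq₀ hν.le hν'.le).1 this
    subst hss
    have haa : a = a' := smul_right_injective _ hν.ne' hz
    subst haa
    refine Eventually.of_forall fun y h => hne ?_
    rw [div_left_inj' hν.ne', sub_left_inj] at h
    rw [h]
  · rw [ae_iff]
    refine measure_mono_null (fun y hy => ?_) (volume_inner_eq_zero hz (s' * c - s * c'))
    simp only [not_not, mem_ofPred_eq] at hy ⊢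
    rw [div_eq_div_iff hν.ne' hν'.ne'] at hy
    rw [inner_sub_left, inner_smul_left, inner_smul_left]
    simp only [conj_trivial]
    linarith

/-- In the frame with direction `ν` the first hyperplane is a graph, and the second cuts its
parameter space in a hyperplane or, if parallel, not at all. -/
theorem euclideanHausdorffMeasure_inter_hyperplanes {d : ℕ} (hd : 1 ≤ d) {ν ν' : E d} {c c' : ℝ}
    (h1 : ‖ν‖ = 1) (hne : {x : E d | inner ℝ ν x = c} ≠ {x | inner ℝ ν' x = c'})
    (h1' : ‖ν'‖ = 1) :
    μHE[d - 1] ({x : E d | inner ℝ ν x = c} ∩ {x | inner ℝ ν' x = c'}) = 0 := by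
  obtain ⟨F, rfl⟩ := exists_lineFrame hd h1
  have hdd : inner ℝ F.dir F.dir ≠ (0 : ℝ) := by
    rw [F.inner_dir_dir]
    exact one_ne_zero
  have hm := LineFrame.map_graph (c := c) h1 hdd
  rw [F.inner_dir_dir, abs_one, ENNReal.ofReal_one, one_smul] at hm
  have hmeas : MeasurableSet {x : E d | inner ℝ ν' x = c'} :=
    (isClosed_eq (by fun_prop) continuous_const).measurableSet
  rw [inter_comm, ← Measure.restrict_apply hmeas, ← hm,
    Measure.map_apply LineFrame.continuous_graph.measurable hmeas]
  obtain ⟨a, s, rfl⟩ := F.exists_pt_eq ν'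
  have hin : ∀ y t, inner ℝ (F.pt a s) (F.pt y t) = inner ℝ a y + t * s := fun y t => by
    rw [F.inner_pt, real_inner_comm F.dir, F.inner_pt, F.inner_dir_emb, F.inner_dir_dir,
      LineFrame.pt, inner_add_left, inner_smul_left, F.inner_dir_emb, F.emb.inner_map_map]
    simp
  have hh : ∀ y, F.height F.dir c y = c := fun y => by
    rw [LineFrame.height, F.inner_dir_dir, F.inner_dir_emb]
    simp
  have hset : F.graph F.dir c ⁻¹' {x | inner ℝ (F.pt a s) x = c'} = {y | inner ℝ a y = c' - c * s} := by
    ext y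
    simp only [mem_preimage, mem_ofPred_eq, LineFrame.graph, hin, hh]
    constructor <;> intro h <;> linarith
  rw [hset]
  by_cases ha : a = 0
  · subst ha
    have hn := F.norm_pt_sq 0 s
    rw [h1'] at hn
    by_cases hc : c' = c * s
    · refine absurd ?_ hne
      have hs : s * s = 1 := by simpa [sq] using hn.symm
      ext x
      obtain ⟨y, t, rfl⟩ := F.exists_pt_eq x
      simp only [mem_ofPred_eq, hin, F.inner_pt, F.inner_dir_emb, F.inner_dir_dir, inner_zero_left,
        hc]
      constructor
      · intro h
        rw [← h]
        ring
      · intro h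
        linear_combination s * h + (c - t) * hs
    · simp [Ne.symm (sub_ne_zero.2 hc)]
  · exact volume_inner_eq_zero ha _

end SNDG

end

noncomputable section

namespace SNDG

/-! ### Polytopes -/

variable {d : ℕ}

/-- `K` is the nonempty bounded open polytope cut out by the inequalities `⟨p.1, x⟩ < p.2`,
`p ∈ s`, with unit vectors `p.1`. -/
structure IsPolytope (s : Finset (E d × ℝ)) (K : Set (E d)) : Prop where
  norm_eq : ∀ p ∈ s, ‖p.1‖ = 1
  eq : K = {x | ∀ p ∈ s, inner ℝ p.1 x < p.2}
  bounded : Bornology.IsBounded K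
  nonempty : K.Nonempty

/-- The relatively open face of the polytope that lies in the hyperplane `⟨p.1, x⟩ = p.2`. -/
def face (s : Finset (E d × ℝ)) (p : E d × ℝ) : Set (E d) :=
  {x | inner ℝ p.1 x = p.2 ∧ ∀ p' ∈ s, p' ≠ p → inner ℝ p'.1 x < p'.2}

namespace IsPolytope

variable {s : Finset (E d × ℝ)} {K : Set (E d)}

theorem mem_iff (h : IsPolytope s K) {x : E d} : x ∈ K ↔ ∀ p ∈ s, inner ℝ p.1 x < p.2 := by
  rw [h.eq]
  rfl

theorem isOpen (h : IsPolytope s K) : IsOpen K := by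
  have : K = ⋂ p ∈ s, {x | inner ℝ p.1 x < p.2} := by
    ext x
    simp [h.mem_iff]
  rw [this]
  exact isOpen_biInter_finset fun p _ => isOpen_lt (by fun_prop) continuous_const

theorem convex (h : IsPolytope s K) : Convex ℝ K := by
  have : K = ⋂ p ∈ s, {x | inner ℝ p.1 x < p.2} := by
    ext x
    simp [h.mem_iff]
  rw [this]
  exact convex_iInter₂ fun p _ => convex_halfSpace_lt (innerₛₗ ℝ p.1).isLinear _

theorem isCompact_closure (h : IsPolytope s K) : IsCompact (closure K) := h.bounded.isCompact_closure

theorem le_of_mem_closure (h : IsPolytope s K) {x : E d} (hx : x ∈ closure K) {p : E d × ℝ}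
    (hp : p ∈ s) : inner ℝ p.1 x ≤ p.2 :=
  closure_minimal (t := {x | inner ℝ p.1 x ≤ p.2}) (fun _ hy => (h.mem_iff.1 hy p hp).le)
    (isClosed_le (by fun_prop) continuous_const) hx

theorem eventually_sub_mem (h : IsPolytope s K) {p : E d × ℝ} {x v : E d}
    (hx : x ∈ face s p) (hv : 0 < inner ℝ p.1 v) : ∀ᶠ δ : ℝ in 𝓝[>] 0, x - δ • v ∈ K := by
  have h1 : ∀ p' ∈ s, ∀ᶠ δ : ℝ in 𝓝[>] 0, inner ℝ p'.1 (x - δ • v) < p'.2 := fun p' hp' => by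
    by_cases hpp : p' = p
    · subst hpp
      filter_upwards [self_mem_nhdsWithin] with δ hδ
      rw [inner_sub_right, inner_smul_right, hx.1]
      have := mul_pos (mem_Ioi.1 hδ) hv
      linarith
    · refine nhdsWithin_le_nhds (ContinuousAt.eventually_lt (by fun_prop) continuousAt_const ?_)
      simpa using hx.2 p' hp' hpp
  filter_upwards [(Finset.eventually_all s).2 h1] with δ hδ
  exact h.mem_iff.2 hδ

theorem face_subset_frontier (h : IsPolytope s K) {p : E d × ℝ} (hp : p ∈ s) :
    face s p ⊆ frontier K := by
  intro x hx
  rw [h.isOpen.frontier_eq]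
  refine ⟨?_, fun hxK => (h.mem_iff.1 hxK p hp).ne hx.1⟩
  have h0 : 0 < inner ℝ p.1 p.1 := by
    rw [real_inner_self_eq_norm_sq, h.norm_eq p hp]
    norm_num
  refine mem_closure_of_tendsto (f := fun δ : ℝ => x - δ • p.1) (b := 𝓝[>] 0) ?_
    (h.eventually_sub_mem hx h0)
  have : Tendsto (fun δ : ℝ => x - δ • p.1) (𝓝 0) (𝓝 (x - (0 : ℝ) • p.1)) :=
    Continuous.tendsto (by fun_prop) 0
  rw [zero_smul, sub_zero] at this
  exact this.mono_left nhdsWithin_le_nhds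

/-- Compare the point `c • ν` with its shift by the part of `ν'` orthogonal to `ν`: both lie on the
first hyperplane, so the shift leaves ⟨ν', ·⟩ unchanged and that part is zero. -/
theorem _root_.SNDG.eq_smul_of_hyperplane_subset {ν ν' : E d} {c c' : ℝ} (h1 : ‖ν‖ = 1)
    (h1' : ‖ν'‖ = 1) (h : ∀ x : E d, inner ℝ ν x = c → inner ℝ ν' x = c') :
    ∃ r : ℝ, r * r = 1 ∧ ν' = r • ν ∧ c' = r * c := by
  obtain ⟨r, hr⟩ : ∃ r : ℝ, inner ℝ ν' ν = r := ⟨_, rfl⟩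
  have hr' : inner ℝ ν ν' = r := (real_inner_comm _ _).trans hr
  have hνν : inner ℝ ν ν = (1 : ℝ) := by rw [real_inner_self_eq_norm_sq, h1, one_pow]
  have hνν' : inner ℝ ν' ν' = (1 : ℝ) := by rw [real_inner_self_eq_norm_sq, h1', one_pow]
  have e0 := h (c • ν) (by rw [inner_smul_right, hνν, mul_one])
  have e1 := h (c • ν + (ν' - r • ν)) (by
    rw [inner_add_right, inner_sub_right, inner_smul_right, inner_smul_right, hνν, hr']
    ring)
  rw [inner_add_right, e0, inner_sub_right, inner_smul_right, hνν', hr] at e1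
  have hr2 : r * r = 1 := by linarith
  rw [inner_smul_right, hr] at e0
  refine ⟨r, hr2, ?_, by linarith⟩
  rw [← sub_eq_zero, ← norm_eq_zero, ← sq_eq_zero_iff, norm_sub_sq_real, inner_smul_right, hr,
    norm_smul, h1, h1', mul_one, Real.norm_eq_abs, sq_abs]
  linarith

/-- Two inequalities with the same hyperplane are equal or opposite, and opposite strict
inequalities would make `K` empty. -/
theorem hyperplane_ne (h : IsPolytope s K) {p p' : E d × ℝ} (hp : p ∈ s) (hp' : p' ∈ s)
    (hne : p ≠ p') : {x : E d | inner ℝ p.1 x = p.2} ≠ {x | inner ℝ p'.1 x = p'.2} := by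
  intro heq
  obtain ⟨r, hr, h1, h2⟩ := eq_smul_of_hyperplane_subset (h.norm_eq p hp) (h.norm_eq p' hp')
    fun x hx => (Set.ext_iff.1 heq x).1 hx
  rcases mul_self_eq_one_iff.1 hr with rfl | rfl
  · rw [one_smul] at h1
    rw [one_mul] at h2
    exact hne (Prod.ext h1.symm h2.symm)
  · obtain ⟨x, hx⟩ := h.nonempty
    have a1 := h.mem_iff.1 hx _ hp
    have a2 := h.mem_iff.1 hx _ hp'
    rw [h1, h2, inner_smul_left, conj_trivial] at a2
    linarith

/-- A boundary point on no open face makes two inequalities tight, so it lies in the intersection of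
two distinct hyperplanes, which is null for the surface measure. -/
theorem frontier_ae_eq (h : IsPolytope s K) (hd : 1 ≤ d) :
    frontier K =ᵐ[(μHE[d - 1] : Measure (E d))] ⋃ p ∈ s, face s p := by
  refine ae_eq_set.2 ⟨?_, ?_⟩
  · refine measure_mono_null (t := ⋃ p ∈ s, ⋃ p' ∈ s, ⋃ _ : p ≠ p',
      ({x : E d | inner ℝ p.1 x = p.2} ∩ {x | inner ℝ p'.1 x = p'.2})) ?_ ?_
    · rintro x ⟨hx, hxf⟩
      rw [h.isOpen.frontier_eq] at hx
      have hx2 : ¬ ∀ p ∈ s, inner ℝ p.1 x < p.2 := fun hh => hx.2 (h.mem_iff.2 hh)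
      push Not at hx2
      obtain ⟨p, hp, hpx⟩ := hx2
      have hpx' := le_antisymm (h.le_of_mem_closure hx.1 hp) hpx
      have : x ∉ face s p := fun hf => hxf (mem_biUnion hp hf)
      simp only [face, mem_ofPred_eq, hpx', true_and, not_forall, not_lt] at this
      obtain ⟨p', hp', hne, hle⟩ := this
      simp only [mem_iUnion]
      exact ⟨p, hp, p', hp', hne.symm, hpx', le_antisymm (h.le_of_mem_closure hx.1 hp') hle⟩
    · refine (measure_biUnion_null_iff s.countable_toSet).2 fun p hp =>
        (measure_biUnion_null_iff s.countable_toSet).2 fun p' hp' => measure_iUnion_null fun hne => ?_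
      exact euclideanHausdorffMeasure_inter_hyperplanes hd (h.norm_eq p hp)
        (h.hyperplane_ne hp hp' hne) (h.norm_eq p' hp')
  · have : (⋃ p ∈ s, face s p) ⊆ frontier K := iUnion₂_subset fun p hp => h.face_subset_frontier hp
    rw [sdiff_eq_empty.2 this, measure_empty]

/-- A competing unit normal ν has ⟨ν, p.1⟩ < 1. Moving from `x` by -δ(p.1 - ν) then leads into `K`
but increases ⟨ν, ·⟩, a contradiction. -/
theorem outwardNormal_eq (h : IsPolytope s K) {p : E d × ℝ} (hp : p ∈ s) {x : E d}
    (hx : x ∈ face s p) : outwardNormal K x = p.1 := by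
  have h1 := h.norm_eq p hp
  have hP : ‖p.1‖ = 1 ∧ ∀ y ∈ K, inner ℝ p.1 (y - x) ≤ 0 := by
    refine ⟨h1, fun y hy => ?_⟩
    rw [inner_sub_right, hx.1]
    linarith [h.mem_iff.1 hy p hp]
  have huniq : ∀ ν : E d, (‖ν‖ = 1 ∧ ∀ y ∈ K, inner ℝ ν (y - x) ≤ 0) → ν = p.1 := by
    rintro ν ⟨hν, hνK⟩
    have hpp : inner ℝ p.1 p.1 = (1 : ℝ) := by rw [real_inner_self_eq_norm_sq, h1, one_pow]
    have hνν : inner ℝ ν ν = (1 : ℝ) := by rw [real_inner_self_eq_norm_sq, hν, one_pow]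
    have hle : inner ℝ ν p.1 ≤ (1 : ℝ) := by
      have := real_inner_le_norm ν p.1
      rwa [hν, h1, one_mul] at this
    rcases hle.lt_or_eq with hlt | heq
    · have hv : 0 < inner ℝ p.1 (p.1 - ν) := by
        rw [inner_sub_right, hpp, real_inner_comm]
        linarith
      obtain ⟨δ, hδK, hδ⟩ := ((h.eventually_sub_mem hx hv).and self_mem_nhdsWithin).exists
      have := hνK _ hδK
      rw [sub_sub_cancel_left, inner_neg_right, inner_smul_right, inner_sub_right, hνν] at this
      have hδ' : 0 < δ := hδ
      nlinarith
    · exact (inner_eq_one_iff_of_norm_eq_one hν h1).1 heq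
  have hex : ∃! ν : E d, ‖ν‖ = 1 ∧ ∀ y ∈ K, inner ℝ ν (y - x) ≤ 0 := ⟨p.1, hP, huniq⟩
  rw [outwardNormal, dif_pos hex]
  exact huniq _ hex.choose_spec.1

theorem measurableSet_face (s : Finset (E d × ℝ)) (p : E d × ℝ) : MeasurableSet (face s p) := by
  have : face s p = {x | inner ℝ p.1 x = p.2} ∩
      ⋂ p' ∈ s, ⋂ _ : p' ≠ p, {x | inner ℝ p'.1 x < p'.2} := by
    ext x
    simp [face]
  rw [this]
  exact (isClosed_eq (by fun_prop) continuous_const).measurableSet.inter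
    (Finset.measurableSet_biInter _ fun p' _ => MeasurableSet.iInter fun _ =>
      (isOpen_lt (by fun_prop) continuous_const).measurableSet)

theorem pairwiseDisjoint_face (s : Finset (E d × ℝ)) : (s : Set (E d × ℝ)).PairwiseDisjoint (face s) := by
  intro p hp p' hp' hne
  rw [Function.onFun, disjoint_left]
  intro x hx hx'
  exact (hx.2 p' hp' hne.symm).ne hx'.1

end IsPolytope

/-! ### Intersections of lines with convex sets -/

theorem eq_Ioo_of_isOpen {A : Set ℝ} (ho : IsOpen A) (hc : A.OrdConnected)
    (hb : Bornology.IsBounded A) (hne : A.Nonempty) : A = Ioo (sInf A) (sSup A) := by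
  have hbb := hb.bddBelow
  have hba := hb.bddAbove
  refine Subset.antisymm (fun t ht => ?_) ?_
  · obtain ⟨ε, hε, hball⟩ := Metric.isOpen_iff.1 ho t ht
    have h1 : t - ε / 2 ∈ A := hball (by rw [Metric.mem_ball, Real.dist_eq, abs_lt]; constructor <;> linarith)
    have h2 : t + ε / 2 ∈ A := hball (by rw [Metric.mem_ball, Real.dist_eq, abs_lt]; constructor <;> linarith)
    have h3 := csInf_le hbb h1
    have h4 := le_csSup hba h2
    constructor <;> linarith
  · exact IsConnected.Ioo_csInf_csSup_subset ⟨hne, hc.isPreconnected⟩ hbb hba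

namespace LineFrame

variable (F : LineFrame d)

/-- The line through `emb y` meets `K`. -/
def Hits (K : Set (E d)) (y : E (d - 1)) : Prop := ∃ t, F.pt y t ∈ K

/-- The parameter at which the line through `emb y` enters `K`. -/
def lo (K : Set (E d)) (y : E (d - 1)) : ℝ := sInf {t | F.pt y t ∈ K}

/-- The parameter at which the line through `emb y` leaves `K`. -/
def hi (K : Set (E d)) (y : E (d - 1)) : ℝ := sSup {t | F.pt y t ∈ K}

theorem neg_hits (K : Set (E d)) (y : E (d - 1)) : F.neg.Hits K y ↔ F.Hits K y := by
  simp only [Hits, neg_pt]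
  exact ⟨fun ⟨t, ht⟩ => ⟨-t, ht⟩, fun ⟨t, ht⟩ => ⟨-t, by rwa [neg_neg]⟩⟩

theorem neg_hi (K : Set (E d)) (y : E (d - 1)) : F.neg.hi K y = -F.lo K y := by
  simp only [hi, lo, neg_pt]
  have : {t | F.pt y (-t) ∈ K} = -{t | F.pt y t ∈ K} := rfl
  rw [this, Real.sInf_def, neg_neg]

variable {F} {s : Finset (E d × ℝ)} {K : Set (E d)}

theorem continuous_pt_right (y : E (d - 1)) : Continuous (F.pt y) :=
  F.continuous_pt.comp (continuous_const.prodMk continuous_id)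

theorem pt_mem_iff (h : IsPolytope s K) {y : E (d - 1)} (hy : F.Hits K y) {t : ℝ} :
    F.pt y t ∈ K ↔ F.lo K y < t ∧ t < F.hi K y := by
  have hA : {t | F.pt y t ∈ K} = Ioo (F.lo K y) (F.hi K y) := by
    refine eq_Ioo_of_isOpen (h.isOpen.preimage (continuous_pt_right y)) ?_ ?_ hy
    · refine Convex.ordConnected fun t ht r hr a b ha hb hab => ?_
      have := h.convex ht hr ha hb hab
      have e : a • F.pt y t + b • F.pt y r = F.pt y (a • t + b • r) := by
        have h1 : F.emb y = a • F.emb y + b • F.emb y := by rw [← add_smul, hab, one_smul]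
        simp only [pt, smul_add, add_smul, smul_assoc]
        nth_rw 3 [h1]
        abel
      rwa [e] at this
    · obtain ⟨C, hC⟩ := h.bounded.exists_norm_le
      refine (Metric.isBounded_Icc (-C) C).subset fun t ht => ?_
      have h1 := hC _ ht
      have h2 := F.norm_pt_sq y t
      rw [mem_Icc, ← abs_le]
      refine abs_le_of_sq_le_sq ?_ ((norm_nonneg _).trans h1)
      nlinarith [norm_nonneg (F.pt y t), norm_nonneg y]
  exact Set.ext_iff.1 hA t

theorem lo_lt_hi (h : IsPolytope s K) {y : E (d - 1)} (hy : F.Hits K y) : F.lo K y < F.hi K y := by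
  obtain ⟨t, ht⟩ := hy
  have := (pt_mem_iff h ⟨t, ht⟩).1 ht
  exact this.1.trans this.2

theorem pt_mem_closure (h : IsPolytope s K) {y : E (d - 1)} (hy : F.Hits K y) {t : ℝ}
    (ht : t ∈ Icc (F.lo K y) (F.hi K y)) : F.pt y t ∈ closure K := by
  rw [← closure_Ioo (lo_lt_hi h hy).ne] at ht
  exact map_mem_closure (continuous_pt_right y) ht fun t ht => (pt_mem_iff h hy).2 ht

theorem pt_hi_notMem (h : IsPolytope s K) {y : E (d - 1)} (hy : F.Hits K y) :
    F.pt y (F.hi K y) ∉ K := fun hh => ((pt_mem_iff h hy).1 hh).2.false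

theorem pt_lo_notMem (h : IsPolytope s K) {y : E (d - 1)} (hy : F.Hits K y) :
    F.pt y (F.lo K y) ∉ K := fun hh => ((pt_mem_iff h hy).1 hh).1.false

/-- Just before a face with forward normal the line is inside `K`, and beyond it the inequality of
the face fails; so the line leaves `K` exactly there. -/
theorem hits_of_graph_mem_face (h : IsPolytope s K) {p : E d × ℝ} (hp : p ∈ s)
    (hν : 0 < inner ℝ p.1 F.dir) {y : E (d - 1)} (hy : F.graph p.1 p.2 y ∈ face s p) :
    F.Hits K y ∧ F.hi K y = F.height p.1 p.2 y := by
  have hev := h.eventually_sub_mem hy hν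
  have hpt : ∀ δ : ℝ, F.graph p.1 p.2 y - δ • F.dir = F.pt y (F.height p.1 p.2 y - δ) := fun δ => by
    simp only [graph, pt, sub_smul]
    abel
  simp only [hpt] at hev
  have hhit : F.Hits K y := let ⟨δ, hδ⟩ := hev.exists; ⟨_, hδ⟩
  refine ⟨hhit, le_antisymm ?_ ?_⟩
  · have hle := h.le_of_mem_closure
      (pt_mem_closure h hhit (right_mem_Icc.2 (lo_lt_hi h hhit).le)) hp
    rw [F.inner_pt] at hle
    rw [height, le_div_iff₀ hν]
    linarith
  · refine le_of_forall_pos_lt_add fun ε hε => ?_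
    obtain ⟨δ, hδ, hδε⟩ := (hev.and (nhdsWithin_le_nhds (gt_mem_nhds hε))).exists
    have := ((pt_mem_iff h hhit).1 hδ).2
    linarith

open Classical in
/-- The value of `g` where the line through `emb y` leaves `K`. -/
def exitVal (F : LineFrame d) (K : Set (E d)) (g : E d → ℝ) (y : E (d - 1)) : ℝ :=
  if F.Hits K y then g (F.pt y (F.hi K y)) else 0

/-- Almost every line that hits `K` leaves through the relative interior of exactly one face, whose
normal points forward. The exceptions meet two face hyperplanes at the same height. -/
theorem sum_indicator_graph (h : IsPolytope s K) (g : E d → ℝ) :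
    ∀ᵐ y, ∑ p ∈ s with 0 < inner ℝ p.1 F.dir,
      (F.graph p.1 p.2 ⁻¹' face s p).indicator (fun y => g (F.graph p.1 p.2 y)) y
        = F.exitVal K g y := by
  have hae : ∀ᵐ y, ∀ p ∈ s, ∀ p' ∈ s, p ≠ p' → 0 < inner ℝ p.1 F.dir → 0 < inner ℝ p'.1 F.dir →
      F.height p.1 p.2 y ≠ F.height p'.1 p'.2 y := by
    refine (Finset.eventually_all s).2 fun p hp => (Finset.eventually_all s).2 fun p' hp' => ?_
    simp only [eventually_imp_distrib_left]
    intro hne h1 h2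
    exact ae_height_ne (h.norm_eq p hp) (h.norm_eq p' hp') h1 h2 hne
  filter_upwards [hae] with y hy
  by_cases hhit : F.Hits K y
  · rw [exitVal, if_pos hhit]
    have hlt := lo_lt_hi h hhit
    have hcl := pt_mem_closure h hhit (right_mem_Icc.2 hlt.le)
    -- An inequality tight at the exit was strict earlier on the line; being affine in the
    -- parameter, its left side increases.
    have hpos : ∀ p ∈ s, inner ℝ p.1 (F.pt y (F.hi K y)) = p.2 → 0 < inner ℝ p.1 F.dir := by
      intro p hp hpe
      obtain ⟨t, ht⟩ := hhit
      have h1 := h.mem_iff.1 ht p hp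
      have h2 := ((pt_mem_iff h ⟨t, ht⟩).1 ht).2
      rw [F.inner_pt] at h1 hpe
      by_contra hle
      rw [not_lt] at hle
      nlinarith
    obtain ⟨p, hp, hpe⟩ : ∃ p ∈ s, inner ℝ p.1 (F.pt y (F.hi K y)) = p.2 := by
      have := pt_hi_notMem h hhit
      rw [h.mem_iff] at this
      push Not at this
      obtain ⟨p, hp, hle⟩ := this
      exact ⟨p, hp, le_antisymm (h.le_of_mem_closure hcl hp) hle⟩
    have hp0 := hpos p hp hpe
    have hhi := (inner_pt_eq_iff hp0.ne').1 hpe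
    have hface : F.graph p.1 p.2 y ∈ face s p := by
      rw [graph, ← hhi]
      refine ⟨hpe, fun p' hp' hne => lt_of_le_of_ne (h.le_of_mem_closure hcl hp') fun he => ?_⟩
      have hp0' := hpos p' hp' he
      exact hy p hp p' hp' hne.symm hp0 hp0' (hhi.symm.trans ((inner_pt_eq_iff hp0'.ne').1 he))
    rw [Finset.sum_eq_single p]
    · rw [indicator_of_mem (by exact hface), graph, ← hhi]
    · intro p' hp' hne
      rw [Finset.mem_filter] at hp'
      refine indicator_of_notMem (fun hf => ?_) _
      have := (hits_of_graph_mem_face h hp'.1 hp'.2 hf).2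
      exact hy p' hp'.1 p hp hne hp'.2 hp0 (this.symm.trans hhi)
    · intro hp'
      exact absurd (Finset.mem_filter.2 ⟨hp, hp0⟩) hp'
  · rw [exitVal, if_neg hhit]
    refine Finset.sum_eq_zero fun p hp => indicator_of_notMem (fun hf => hhit ?_) _
    rw [Finset.mem_filter] at hp
    exact (hits_of_graph_mem_face h hp.1 hp.2 hf).1

end LineFrame

end SNDG

end

noncomputable section

namespace SNDG

variable {d : ℕ}

/-! ### Surface fluxes and volume integrals as integrals over parallel lines -/

namespace LineFrame

variable {F : LineFrame d} {s : Finset (E d × ℝ)} {K : Set (E d)} {p : E d × ℝ} {g : E d → ℝ}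

/-- Entries are exits of the reversed lines, so only exits need to be studied. -/
theorem neg_exitVal (F : LineFrame d) (K : Set (E d)) (g : E d → ℝ) (y : E (d - 1))
    [Decidable (F.Hits K y)] :
    F.neg.exitVal K g y = if F.Hits K y then g (F.pt y (F.lo K y)) else 0 := by
  unfold exitVal
  simp only [neg_hits, neg_hi, neg_pt, neg_neg]

theorem neg_graph (F : LineFrame d) (ν : E d) (c : ℝ) : F.neg.graph ν c = F.graph ν c := by
  funext y
  rw [graph, neg_pt, graph]
  congr 1
  simp only [height, neg, inner_neg_right, div_neg, neg_neg]

theorem norm_le_norm_pt (y : E (d - 1)) (t : ℝ) : ‖y‖ ≤ ‖F.pt y t‖ := by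
  rw [← sq_le_sq₀ (norm_nonneg _) (norm_nonneg _), F.norm_pt_sq]
  nlinarith

theorem restrict_map_graph (h : IsPolytope s K) (hp : p ∈ s) (hν : inner ℝ p.1 F.dir ≠ 0) :
    ((volume : Measure (E (d - 1))).map (F.graph p.1 p.2)).restrict (face s p)
      = ENNReal.ofReal |inner ℝ p.1 F.dir| • (μHE[d - 1] : Measure (E d)).restrict (face s p) := by
  rw [map_graph (h.norm_eq p hp) hν, Measure.restrict_smul,
    Measure.restrict_restrict (IsPolytope.measurableSet_face s p)]
  congr 2
  exact inter_eq_left.2 fun x hx => hx.1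

theorem setIntegral_face (h : IsPolytope s K) (hp : p ∈ s) (hν : inner ℝ p.1 F.dir ≠ 0)
    (hg : Measurable g) :
    |inner ℝ p.1 F.dir| * ∫ x in face s p, g x ∂μHE[d - 1]
      = ∫ y in F.graph p.1 p.2 ⁻¹' face s p, g (F.graph p.1 p.2 y) := by
  rw [← setIntegral_map (IsPolytope.measurableSet_face s p) hg.aestronglyMeasurable
    continuous_graph.measurable.aemeasurable, restrict_map_graph h hp hν, integral_smul_measure,
    ENNReal.toReal_ofReal (abs_nonneg _), smul_eq_mul]

theorem integrableOn_graph (h : IsPolytope s K) (hp : p ∈ s) (hg : Measurable g)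
    (hb : ∃ C, ∀ x ∈ closure K, |g x| ≤ C) :
    IntegrableOn (fun y => g (F.graph p.1 p.2 y)) (F.graph p.1 p.2 ⁻¹' face s p) := by
  obtain ⟨C, hC⟩ := hb
  have hcl : face s p ⊆ closure K := (h.face_subset_frontier hp).trans frontier_subset_closure
  have hm : MeasurableSet (F.graph p.1 p.2 ⁻¹' face s p) :=
    continuous_graph.measurable (IsPolytope.measurableSet_face s p)
  refine IntegrableOn.of_bound ?_ (hg.comp continuous_graph.measurable).aestronglyMeasurable C
    ((ae_restrict_iff' hm).2 (Eventually.of_forall fun y hy => hC _ (hcl hy)))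
  obtain ⟨R, hR⟩ := h.bounded.closure.exists_norm_le
  refine (Metric.isBounded_closedBall (x := (0 : E (d - 1))) (r := R)).subset (fun y hy => ?_)
    |>.measure_lt_top
  rw [mem_closedBall_zero_iff]
  exact (norm_le_norm_pt y _).trans (hR _ (hcl hy))

theorem integrableOn_face (h : IsPolytope s K) (hp : p ∈ s) (hν : inner ℝ p.1 F.dir ≠ 0)
    (hg : Measurable g) (hb : ∃ C, ∀ x ∈ closure K, |g x| ≤ C) :
    IntegrableOn g (face s p) μHE[d - 1] := by
  have h1 : IntegrableOn g (face s p) ((volume : Measure (E (d - 1))).map (F.graph p.1 p.2)) := by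
    rw [IntegrableOn, Measure.restrict_map continuous_graph.measurable
      (IsPolytope.measurableSet_face s p), integrable_map_measure hg.aestronglyMeasurable
      continuous_graph.measurable.aemeasurable]
    exact integrableOn_graph h hp hg hb
  rw [IntegrableOn, restrict_map_graph h hp hν, integrable_smul_measure] at h1
  · exact h1
  · simpa using hν
  · exact ENNReal.ofReal_ne_top

theorem integrable_exitVal (h : IsPolytope s K) (hg : Measurable g)
    (hb : ∃ C, ∀ x ∈ closure K, |g x| ≤ C) : Integrable (F.exitVal K g) := by
  refine Integrable.congr ?_ (sum_indicator_graph h g)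
  refine integrable_finsetSum _ fun p hp => ?_
  rw [Finset.mem_filter] at hp
  exact (integrable_indicator_iff (continuous_graph.measurable
    (IsPolytope.measurableSet_face s p))).2 (integrableOn_graph h hp.1 hg hb)

theorem integral_exitVal (h : IsPolytope s K) (hg : Measurable g)
    (hb : ∃ C, ∀ x ∈ closure K, |g x| ≤ C) :
    ∫ y, F.exitVal K g y = ∑ p ∈ s with 0 < inner ℝ p.1 F.dir,
      ∫ y in F.graph p.1 p.2 ⁻¹' face s p, g (F.graph p.1 p.2 y) := by
  rw [← integral_congr_ae (sum_indicator_graph h g), integral_finsetSum]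
  · refine Finset.sum_congr rfl fun p _ => ?_
    rw [integral_indicator (continuous_graph.measurable (IsPolytope.measurableSet_face s p))]
  · intro p hp
    rw [Finset.mem_filter] at hp
    exact (integrable_indicator_iff (continuous_graph.measurable
      (IsPolytope.measurableSet_face s p))).2 (integrableOn_graph h hp.1 hg hb)

/-- The flux through the boundary of a polytope as an integral over lines. -/
theorem setIntegral_frontier (h : IsPolytope s K) (hg : Measurable g)
    (hb : ∃ C, ∀ x ∈ closure K, |g x| ≤ C) :
    ∫ x in frontier K, g x * inner ℝ F.dir (outwardNormal K x) ∂μHE[d - 1]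
      = ∫ y, (F.exitVal K g y - F.neg.exitVal K g y) := by
  have hcongr : ∀ p ∈ s, EqOn (fun x => g x * inner ℝ F.dir (outwardNormal K x))
      (fun x => g x * inner ℝ p.1 F.dir) (face s p) := fun p hp x hx => by
    simp only [h.outwardNormal_eq hp hx, real_inner_comm]
  have hint : ∀ p ∈ s, IntegrableOn (fun x => g x * inner ℝ F.dir (outwardNormal K x)) (face s p)
      μHE[d - 1] := fun p hp => by
    refine IntegrableOn.congr_fun ?_ (hcongr p hp).symm (IsPolytope.measurableSet_face s p)
    by_cases h0 : inner ℝ p.1 F.dir = 0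
    · simp [h0]
    · exact (integrableOn_face h hp h0 hg hb).mul_const _
  rw [setIntegral_congr_set (h.frontier_ae_eq F.pos),
    integral_biUnion_finset s (fun p _ => IsPolytope.measurableSet_face s p)
      (IsPolytope.pairwiseDisjoint_face s) hint,
    integral_sub (integrable_exitVal h hg hb) (integrable_exitVal h hg hb),
    integral_exitVal h hg hb, integral_exitVal h hg hb, Finset.sum_filter, Finset.sum_filter,
    ← Finset.sum_sub_distrib]
  refine Finset.sum_congr rfl fun p hp => ?_
  rw [setIntegral_congr_fun (IsPolytope.measurableSet_face s p) (hcongr p hp), integral_mul_const,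
    neg_graph, show F.neg.dir = -F.dir from rfl, inner_neg_right]
  -- Forward faces give the exits, backward faces the exits of the reversed frame, and faces
  -- parallel to the lines carry no flux.
  rcases lt_trichotomy (inner ℝ p.1 F.dir) 0 with h0 | h0 | h0
  · rw [if_neg h0.not_gt, if_pos (by linarith), ← setIntegral_face h hp h0.ne hg, abs_of_neg h0]
    ring
  · simp [h0]
  · rw [if_pos h0, if_neg (by linarith), ← setIntegral_face h hp h0.ne' hg, abs_of_pos h0]
    ring

open Classical in
/-- The integral of `f` over the part of the line through `emb y` that lies in `K`. -/
def lineIntegral (F : LineFrame d) (K : Set (E d)) (f : E d → ℝ) (y : E (d - 1)) : ℝ :=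
  if F.Hits K y then ∫ t in F.lo K y..F.hi K y, f (F.pt y t) else 0

theorem lineIntegral_eq (h : IsPolytope s K) (f : E d → ℝ) (y : E (d - 1)) :
    ∫ t, K.indicator f (F.pt y t) = F.lineIntegral K f y := by
  rw [lineIntegral]
  split_ifs with hy
  · rw [intervalIntegral.integral_of_le (lo_lt_hi h hy).le, integral_Ioc_eq_integral_Ioo,
      ← integral_indicator measurableSet_Ioo]
    congr 1
    funext t
    by_cases ht : F.pt y t ∈ K
    · rw [indicator_of_mem ht, indicator_of_mem (by exact (pt_mem_iff h hy).1 ht)]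
    · rw [indicator_of_notMem ht, indicator_of_notMem (by exact fun h' => ht ((pt_mem_iff h hy).2 h'))]
  · rw [← integral_zero ℝ ℝ]
    congr 1
    funext t
    exact indicator_of_notMem (fun ht => hy ⟨t, ht⟩) _

theorem integrable_lineIntegral (h : IsPolytope s K) {f : E d → ℝ} (hf : IntegrableOn f K) :
    Integrable (F.lineIntegral K f) := by
  have h1 := (F.measurePreserving_pt.integrable_comp_emb F.measurableEmbedding_pt).2
    ((integrable_indicator_iff h.isOpen.measurableSet).2 hf)
  refine (Integrable.integral_prod_left h1).congr (Eventually.of_forall fun y => ?_)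
  exact lineIntegral_eq h f y

theorem integral_lineIntegral (h : IsPolytope s K) {f : E d → ℝ} (hf : IntegrableOn f K) :
    ∫ y, F.lineIntegral K f y = ∫ x in K, f x := by
  have h1 : Integrable (fun p : E (d - 1) × ℝ => K.indicator f (F.pt p.1 p.2)) :=
    (F.measurePreserving_pt.integrable_comp_emb F.measurableEmbedding_pt).2
      ((integrable_indicator_iff h.isOpen.measurableSet).2 hf)
  rw [Measure.volume_eq_prod] at h1
  rw [← integral_indicator h.isOpen.measurableSet,
    ← F.measurePreserving_pt.integral_comp F.measurableEmbedding_pt, Measure.volume_eq_prod,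
    integral_prod _ h1]
  simp only [lineIntegral_eq h]

end LineFrame

/-! ### The cells of a mesh are polytopes -/

theorem exists_isPolytope_of_affine {I : Type*} [Fintype I] {K : Set (E d)} (g : I → E d)
    (c : I → ℝ) (hg : ∀ i, g i ≠ 0) (hK : K = {x | ∀ i, inner ℝ (g i) x < c i})
    (hb : Bornology.IsBounded K) (hne : K.Nonempty) : ∃ s, IsPolytope s K := by
  classical
  refine ⟨Finset.univ.image fun i => (‖g i‖⁻¹ • g i, ‖g i‖⁻¹ * c i), ?_, ?_, hb, hne⟩
  · intro p hp
    obtain ⟨i, -, rfl⟩ := Finset.mem_image.1 hp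
    simp [norm_smul, hg i]
  · rw [hK]
    ext x
    simp only [mem_ofPred_eq, Finset.mem_image, Finset.mem_univ, true_and, forall_exists_index,
      forall_apply_eq_imp_iff, inner_smul_left, conj_trivial]
    exact forall_congr' fun i => (mul_lt_mul_iff_right₀ (inv_pos.2 (norm_pos_iff.2 (hg i)))).symm

/-- The open simplex is the set of positive barycentric coordinates. A coordinate takes the value 1
at its own vertex and 0 at another, which exists because `1 ≤ d`; so its gradient `-g i` is not
zero. -/
theorem IsOpenSimplex.exists_isPolytope (hd : 1 ≤ d) {K : Set (E d)} (hK : IsOpenSimplex K) :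
    ∃ s, IsPolytope s K := by
  obtain ⟨S, rfl⟩ := hK
  let b : AffineBasis (Fin (d + 1)) ℝ (E d) :=
    ⟨S.points, S.independent, S.span_eq_top (by simp)⟩
  have hrange : range S.points = range b := rfl
  let g : Fin (d + 1) → E d := fun i =>
    -(InnerProductSpace.toDual ℝ (E d)).symm (LinearMap.toContinuousLinearMap (b.coord i).linear)
  have hgi : ∀ i x, inner ℝ (g i) x = -(b.coord i).linear x := fun i x => by
    simp [g]
  have hcoord : ∀ i x, b.coord i x = b.coord i 0 - inner ℝ (g i) x := fun i x => by
    rw [hgi, sub_neg_eq_add]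
    have := (b.coord i).map_vadd 0 x
    simpa [add_comm] using this
  refine exists_isPolytope_of_affine g (fun i => b.coord i 0) (fun i h0 => ?_) ?_
    ((isBounded_convexHull.2 (finite_range _).isBounded).subset interior_subset) ?_
  · obtain ⟨j, hj⟩ : ∃ j, j ≠ i := by
      have : Nontrivial (Fin (d + 1)) := Fin.nontrivial_iff_two_le.2 (by omega)
      exact exists_ne i
    have h1 := hcoord i (b i)
    have h2 := hcoord i (b j)
    rw [b.coord_apply_eq, h0, inner_zero_left] at h1
    rw [b.coord_apply_ne hj.symm, h0, inner_zero_left] at h2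
    linarith
  · rw [hrange, b.interior_convexHull]
    ext x
    simp only [mem_ofPred_eq, hcoord _ x, sub_pos]
  · rw [hrange]
    exact ⟨_, b.centroid_mem_interior_convexHull⟩

theorem IsOpenBox.exists_isPolytope {K : Set (E d)} (hK : IsOpenBox K) : ∃ s, IsPolytope s K := by
  obtain ⟨a, b, hab, rfl⟩ := hK
  refine exists_isPolytope_of_affine (I := Fin d ⊕ Fin d)
    (Sum.elim (fun i => EuclideanSpace.single i 1) fun i => -EuclideanSpace.single i 1)
    (Sum.elim (fun i => b i) fun i => -a i) ?_ ?_ ?_ ?_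
  · rintro (i | i) <;> simp
  · ext x
    simp only [mem_ofPred_eq, mem_Ioo, Sum.forall, Sum.elim_inl, Sum.elim_inr, inner_neg_left,
      EuclideanSpace.inner_single_left, map_one, one_mul, neg_lt_neg_iff, forall_and]
    exact and_comm
  · refine (Metric.isBounded_closedBall (x := (0 : E d)) (r := √(∑ i, (|a i| + |b i|) ^ 2))).subset
      fun x hx => ?_
    rw [mem_closedBall_zero_iff, EuclideanSpace.norm_eq]
    refine Real.sqrt_le_sqrt (Finset.sum_le_sum fun i _ => ?_)
    rw [Real.norm_eq_abs]
    refine pow_le_pow_left₀ (abs_nonneg _) ?_ 2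
    obtain ⟨h1, h2⟩ := hx i
    rw [abs_le]
    constructor
    · linarith [neg_abs_le (a i), abs_nonneg (b i)]
    · linarith [le_abs_self (b i), abs_nonneg (a i)]
  · refine ⟨WithLp.toLp 2 fun i => (a i + b i) / 2, fun i => ?_⟩
    have := hab i
    constructor <;> simp <;> linarith

theorem Mesh.exists_isPolytope {ι : Type*} (M : Mesh d ι) (hd : 1 ≤ d) (k : ι) :
    ∃ s, IsPolytope s (M.cell k) := by
  rcases M.shape with ⟨-, h⟩ | ⟨-, h⟩
  · exact (h k).exists_isPolytope hd
  · exact (h k).exists_isPolytope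

end SNDG

end

noncomputable section

namespace SNDG

variable {d : ℕ} {ι : Type*}

/-! ### Bilinearity of the one-dimensional form -/

namespace Intervals

variable (I : Intervals ι)

theorem left_add (u u' : ι → ℝ → ℝ) (t : ℝ) : I.left (u + u') t = I.left u t + I.left u' t := by
  simp only [left, ← Finset.sum_add_distrib]
  refine Finset.sum_congr rfl fun l _ => ?_
  split_ifs <;> simp

theorem left_smul (c : ℝ) (u : ι → ℝ → ℝ) (t : ℝ) : I.left (c • u) t = c * I.left u t := by
  simp only [left, Finset.mul_sum]
  refine Finset.sum_congr rfl fun l _ => ?_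
  split_ifs <;> simp

theorem form_add_left {u u' v : ι → ℝ → ℝ} (hu : ∀ k, Continuous (u k))
    (hu' : ∀ k, Continuous (u' k)) (hv : ∀ k, ContDiff ℝ 1 (v k)) :
    I.form (u + u') v = I.form u v + I.form u' v := by
  simp only [form, ← Finset.sum_add_distrib]
  refine Finset.sum_congr rfl fun k _ => ?_
  have hc := (hv k).continuous_deriv (by simp)
  have h : ∫ t in I.lo k..I.hi k, (u k t * deriv (v k) t + u' k t * deriv (v k) t)
      = (∫ t in I.lo k..I.hi k, u k t * deriv (v k) t)
        + ∫ t in I.lo k..I.hi k, u' k t * deriv (v k) t :=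
    intervalIntegral.integral_add (((hu k).mul hc).intervalIntegrable _ _)
      (((hu' k).mul hc).intervalIntegrable _ _)
  simp only [Pi.add_apply, add_mul, left_add, h]
  ring

theorem form_smul_left (c : ℝ) (u v : ι → ℝ → ℝ) : I.form (c • u) v = c * I.form u v := by
  simp only [form, Finset.mul_sum]
  refine Finset.sum_congr rfl fun k _ => ?_
  simp only [Pi.smul_apply, smul_eq_mul, left_smul, mul_assoc, intervalIntegral.integral_const_mul]
  ring

theorem form_add_right {u v v' : ι → ℝ → ℝ} (hu : ∀ k, Continuous (u k))
    (hv : ∀ k, ContDiff ℝ 1 (v k)) (hv' : ∀ k, ContDiff ℝ 1 (v' k)) :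
    I.form u (v + v') = I.form u v + I.form u v' := by
  simp only [form, ← Finset.sum_add_distrib]
  refine Finset.sum_congr rfl fun k _ => ?_
  have h : ∫ t in I.lo k..I.hi k, (u k t * deriv (v k) t + u k t * deriv (v' k) t)
      = (∫ t in I.lo k..I.hi k, u k t * deriv (v k) t)
        + ∫ t in I.lo k..I.hi k, u k t * deriv (v' k) t :=
    intervalIntegral.integral_add
      (((hu k).mul ((hv k).continuous_deriv (by simp))).intervalIntegrable _ _)
      (((hu k).mul ((hv' k).continuous_deriv (by simp))).intervalIntegrable _ _)
  have hd : ∀ t, deriv (v k + v' k) t = deriv (v k) t + deriv (v' k) t := fun t =>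
    deriv_add ((hv k).differentiable (by simp) t) ((hv' k).differentiable (by simp) t)
  simp only [Pi.add_apply, hd, mul_add, h]
  ring

theorem form_smul_right (c : ℝ) {u v : ι → ℝ → ℝ} (hv : ∀ k, ContDiff ℝ 1 (v k)) :
    I.form u (c • v) = c * I.form u v := by
  simp only [form, Finset.mul_sum]
  refine Finset.sum_congr rfl fun k _ => ?_
  have hd : ∀ t, deriv (c • v k) t = c * deriv (v k) t := fun t => by
    rw [deriv_const_smul _ ((hv k).differentiable (by simp) t), smul_eq_mul]
  simp only [Pi.smul_apply, hd, smul_eq_mul, mul_left_comm _ c,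
    intervalIntegral.integral_const_mul]
  ring

end Intervals

/-! ### Restriction of a mesh to a line -/

theorem isBounded_image_of_continuous {K : Set (E d)} {g : E d → ℝ} (hg : Continuous g)
    (hK : IsCompact K) : ∃ C, ∀ x ∈ K, |g x| ≤ C := by
  obtain ⟨C, hC⟩ := hK.exists_bound_of_continuousOn hg.continuousOn
  exact ⟨C, hC⟩

namespace LineFrame

variable (F : LineFrame d)

theorem contDiff_comp_pt {f : E d → ℝ} (hf : ContDiff ℝ 1 f) (y : E (d - 1)) :
    ContDiff ℝ 1 fun t => f (F.pt y t) := by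
  unfold pt
  fun_prop

theorem deriv_comp_pt {f : E d → ℝ} (hf : ContDiff ℝ 1 f) (y : E (d - 1)) (t : ℝ) :
    deriv (fun t => f (F.pt y t)) t = inner ℝ F.dir (gradient f (F.pt y t)) := by
  have h1 : HasDerivAt (F.pt y) F.dir t := by
    have := ((hasDerivAt_id t).smul_const F.dir).const_add (F.emb y)
    rwa [one_smul] at this
  have h2 := (hf.differentiable (by simp) (F.pt y t)).hasGradientAt.hasFDerivAt
  have h3 := h2.comp_hasDerivAt t h1
  rw [real_inner_comm]
  exact h3.deriv

end LineFrame

namespace Mesh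

variable (M : Mesh d ι) (F : LineFrame d)

theorem interval_sep {k l : ι} (hne : k ≠ l) {y : E (d - 1)} (hk : F.Hits (M.cell k) y)
    (hl : F.Hits (M.cell l) y) :
    F.hi (M.cell k) y ≤ F.lo (M.cell l) y ∨ F.hi (M.cell l) y ≤ F.lo (M.cell k) y := by
  obtain ⟨s, hs⟩ := M.exists_isPolytope F.pos k
  obtain ⟨s', hs'⟩ := M.exists_isPolytope F.pos l
  by_contra! h
  have h1 := LineFrame.lo_lt_hi hs hk
  have h2 := LineFrame.lo_lt_hi hs' hl
  obtain ⟨t, ht1, ht2⟩ : ∃ t, max (F.lo (M.cell k) y) (F.lo (M.cell l) y) < t ∧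
      t < min (F.hi (M.cell k) y) (F.hi (M.cell l) y) :=
    exists_between (max_lt (lt_min h1 h.2) (lt_min h.1 h2))
  rw [max_lt_iff] at ht1
  rw [lt_min_iff] at ht2
  exact (M.disjoint hne).ne_of_mem ((LineFrame.pt_mem_iff hs hk).2 ⟨ht1.1, ht2.1⟩)
    ((LineFrame.pt_mem_iff hs' hl).2 ⟨ht1.2, ht2.2⟩) rfl

-- A cell meets the line in an open interval, so points slightly upstream of `t` lie in it exactly
-- when `t` is in `(lo, hi]`. The closed right end is what makes the trace upwind.
variable {M F} in
theorem eventually_sub_mem_cell_iff {k : ι} {y : E (d - 1)} {t : ℝ} :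
    (∀ᶠ δ : ℝ in 𝓝[>] 0, F.pt y t - δ • F.dir ∈ M.cell k) ↔
      F.Hits (M.cell k) y ∧ F.lo (M.cell k) y < t ∧ t ≤ F.hi (M.cell k) y := by
  obtain ⟨s, hs⟩ := M.exists_isPolytope F.pos k
  have hpt : ∀ δ : ℝ, F.pt y t - δ • F.dir = F.pt y (t - δ) := fun δ => by
    simp only [LineFrame.pt, sub_smul]
    abel
  simp only [hpt]
  constructor
  · intro h
    have hhit : F.Hits (M.cell k) y := let ⟨δ, hδ⟩ := h.exists; ⟨_, hδ⟩
    refine ⟨hhit, ?_, ?_⟩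
    · obtain ⟨δ, hδ, hpos⟩ := (h.and self_mem_nhdsWithin).exists
      have := ((LineFrame.pt_mem_iff hs hhit).1 hδ).1
      have hpos' : 0 < δ := hpos
      linarith
    · refine le_of_forall_pos_lt_add fun ε hε => ?_
      obtain ⟨δ, hδ, hδε⟩ := (h.and (nhdsWithin_le_nhds (gt_mem_nhds hε))).exists
      have := ((LineFrame.pt_mem_iff hs hhit).1 hδ).2
      linarith
  · rintro ⟨hhit, h1, h2⟩
    filter_upwards [self_mem_nhdsWithin, nhdsWithin_le_nhds (gt_mem_nhds (sub_pos.2 h1))]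
      with δ hδ hδ'
    have hδ0 : 0 < δ := hδ
    exact (LineFrame.pt_mem_iff hs hhit).2 ⟨by linarith, by linarith⟩

variable {M} in
theorem integrableOn_cell_of_continuous (hd : 1 ≤ d) (k : ι) {f : E d → ℝ} (hf : Continuous f) :
    IntegrableOn f (M.cell k) := by
  obtain ⟨s, hs⟩ := M.exists_isPolytope hd k
  exact (hf.continuousOn.integrableOn_compact hs.isCompact_closure).mono_set subset_closure

-- Membership along a line is an interval condition, so the limit `δ → 0⁺` may be tested on the
-- sequence 1/(m+1), which turns it into countably many open conditions.
variable {M F} in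
theorem measurableSet_upwind {k : ι} :
    MeasurableSet {x : E d | ∀ᶠ δ : ℝ in 𝓝[>] 0, x - δ • F.dir ∈ M.cell k} := by
  obtain ⟨s, hs⟩ := M.exists_isPolytope F.pos k
  have hset : {x : E d | ∀ᶠ δ : ℝ in 𝓝[>] 0, x - δ • F.dir ∈ M.cell k}
      = ⋃ N : ℕ, ⋂ m : ℕ, ⋂ _ : N ≤ m, {x | x - (1 / ((m : ℝ) + 1)) • F.dir ∈ M.cell k} := by
    ext x
    simp only [mem_ofPred_eq, mem_iUnion, mem_iInter]
    constructor
    · intro h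
      have ht : Tendsto (fun m : ℕ => 1 / ((m : ℝ) + 1)) atTop (𝓝[>] 0) :=
        tendsto_nhdsWithin_iff.2 ⟨tendsto_one_div_add_atTop_nhds_zero_nat,
          Eventually.of_forall fun m => mem_Ioi.2 (by positivity)⟩
      exact eventually_atTop.1 (ht.eventually h)
    · rintro ⟨N, hN⟩
      obtain ⟨y, t, rfl⟩ := F.exists_pt_eq x
      have hpt : ∀ δ : ℝ, F.pt y t - δ • F.dir = F.pt y (t - δ) := fun δ => by
        simp only [LineFrame.pt, sub_smul]
        abel
      simp only [hpt] at hN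
      have hhit : F.Hits (M.cell k) y := ⟨_, hN N le_rfl⟩
      rw [eventually_sub_mem_cell_iff]
      refine ⟨hhit, ?_, ?_⟩
      · have := ((LineFrame.pt_mem_iff hs hhit).1 (hN N le_rfl)).1
        have h0 : (0 : ℝ) < 1 / ((N : ℝ) + 1) := by positivity
        linarith
      · refine le_of_tendsto (x := atTop) (f := fun m : ℕ => t - 1 / ((m : ℝ) + 1)) ?_ ?_
        · simpa using tendsto_one_div_add_atTop_nhds_zero_nat.const_sub t
        · filter_upwards [eventually_ge_atTop N] with m hm
          exact ((LineFrame.pt_mem_iff hs hhit).1 (hN m hm)).2.le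
  rw [hset]
  refine MeasurableSet.iUnion fun N => MeasurableSet.iInter fun m => MeasurableSet.iInter fun _ => ?_
  exact (hs.isOpen.preimage (by fun_prop)).measurableSet

variable [Fintype ι]

open Classical in
/-- The intersections of the cells with the line through `emb y`. -/
def intervals (y : E (d - 1)) : Intervals ι where
  s := Finset.univ.filter fun k => F.Hits (M.cell k) y
  lo k := F.lo (M.cell k) y
  hi k := F.hi (M.cell k) y
  lt k hk := by
    obtain ⟨s, hs⟩ := M.exists_isPolytope F.pos k
    exact LineFrame.lo_lt_hi hs (Finset.mem_filter.1 hk).2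
  sep k hk l hl hne := M.interval_sep F hne (Finset.mem_filter.1 hk).2 (Finset.mem_filter.1 hl).2

/-- The restriction of a piecewise polynomial to the line through `emb y`. -/
def _root_.SNDG.LineFrame.restrict (u : Scalar d ι) (y : E (d - 1)) : ι → ℝ → ℝ :=
  fun k t => u k (F.pt y t)

variable {M F}

theorem mem_intervals {y : E (d - 1)} {k : ι} : k ∈ (M.intervals F y).s ↔ F.Hits (M.cell k) y := by
  simp [intervals]

theorem upwind_exit (u : Scalar d ι) {y : E (d - 1)} {k : ι} (hk : F.Hits (M.cell k) y) :
    M.upwind F.dir u (F.pt y (F.hi (M.cell k) y)) = u k (F.pt y (F.hi (M.cell k) y)) := by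
  classical
  obtain ⟨s, hs⟩ := M.exists_isPolytope F.pos k
  simp only [upwind, eventually_sub_mem_cell_iff]
  have h0 := LineFrame.lo_lt_hi hs hk
  rw [Finset.sum_eq_single k, if_pos (by exact ⟨hk, h0, le_rfl⟩)]
  · intro l _ hne
    refine if_neg ?_
    rintro ⟨hl, h1, h2⟩
    rcases M.interval_sep F hne hl hk with h3 | h3 <;> linarith
  · simp

/-- The upwind cell at an entry is the one whose interval ends there. If there is none, both sides
are zero: this is the vanishing inflow. -/
theorem upwind_entry (u : Scalar d ι) {y : E (d - 1)} {k : ι} (hk : F.Hits (M.cell k) y) :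
    M.upwind F.dir u (F.pt y (F.lo (M.cell k) y))
      = (M.intervals F y).left (F.restrict u y) (F.lo (M.cell k) y) := by
  classical
  obtain ⟨s, hs⟩ := M.exists_isPolytope F.pos k
  simp only [upwind, eventually_sub_mem_cell_iff, Intervals.left, intervals, Finset.sum_filter]
  refine Finset.sum_congr rfl fun l _ => ?_
  by_cases hl : F.Hits (M.cell l) y
  · obtain ⟨s', hs'⟩ := M.exists_isPolytope F.pos l
    have h1 := LineFrame.lo_lt_hi hs hk
    have h2 := LineFrame.lo_lt_hi hs' hl
    have hiff : (F.lo (M.cell l) y < F.lo (M.cell k) y ∧ F.lo (M.cell k) y ≤ F.hi (M.cell l) y)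
        ↔ F.hi (M.cell l) y = F.lo (M.cell k) y := by
      constructor
      · rintro ⟨h3, h4⟩
        have hne : l ≠ k := by
          rintro rfl
          exact h3.false
        rcases M.interval_sep F hne hl hk with h5 | h5
        · exact le_antisymm h5 h4
        · linarith
      · intro h
        constructor <;> linarith
    simp only [hl, true_and, hiff, if_true]
    rfl
  · simp [hl]

theorem measurable_upwind {u : Scalar d ι} (hu : ∀ k, Continuous (u k)) :
    Measurable (M.upwind F.dir u) := by
  unfold upwind
  exact Finset.measurable_fun_sum _ fun k _ =>
    Measurable.ite measurableSet_upwind (hu k).measurable measurable_const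

theorem abs_upwind_le (Ω : E d) (u : Scalar d ι) (x : E d) : |M.upwind Ω u x| ≤ ∑ k, |u k x| := by
  unfold upwind
  refine (Finset.abs_sum_le_sum_abs _ _).trans (Finset.sum_le_sum fun k _ => ?_)
  split_ifs <;> simp

/-- Rescaling `δ` absorbs the length of the direction. This is needed because frames have unit
directions while ordinates may be shorter. -/
theorem upwind_smul {r : ℝ} (hr : 0 < r) (Ω : E d) (u : Scalar d ι) (x : E d) :
    M.upwind (r • Ω) u x = M.upwind Ω u x := by
  have hmap : ∀ P : ℝ → Prop, (∀ᶠ δ in 𝓝[>] 0, P (δ * r)) ↔ ∀ᶠ δ in 𝓝[>] 0, P δ := fun P => by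
    have ht : ∀ c : ℝ, 0 < c → Tendsto (fun δ : ℝ => δ * c) (𝓝[>] 0) (𝓝[>] 0) := fun c hc => by
      refine tendsto_nhdsWithin_iff.2 ⟨?_, ?_⟩
      · have : Tendsto (fun δ : ℝ => δ * c) (𝓝 0) (𝓝 (0 * c)) := Continuous.tendsto (by fun_prop) 0
        rw [zero_mul] at this
        exact this.mono_left nhdsWithin_le_nhds
      · filter_upwards [self_mem_nhdsWithin] with δ hδ
        exact mul_pos (mem_Ioi.1 hδ) hc
    refine ⟨fun h => ?_, fun h => (ht r hr).eventually h⟩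
    filter_upwards [(ht r⁻¹ (inv_pos.2 hr)).eventually h] with δ hδ
    rwa [mul_assoc, inv_mul_cancel₀ hr.ne', mul_one] at hδ
  classical
  unfold upwind
  refine Finset.sum_congr rfl fun k _ => ?_
  have := hmap fun δ => x - δ • Ω ∈ M.cell k
  simp only [mul_smul] at this
  simp only [this]

/-! ### The advection form -/

/-- The upwind discretization of the advection operator in direction `Ω`. -/
def advect (M : Mesh d ι) (Ω : E d) (u v : Scalar d ι) : ℝ :=
  ∑ k, (-(∫ x in M.cell k, u k x * inner ℝ Ω (gradient (v k) x))
    + ∫ x in frontier (M.cell k),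
        M.upwind Ω u x * inner ℝ Ω (outwardNormal (M.cell k) x) * v k x ∂μHE[d - 1])

/-- All pieces are continuously differentiable. -/
def _root_.SNDG.PiecewiseSmooth (u : Scalar d ι) : Prop := ∀ k, ContDiff ℝ 1 (u k)

theorem continuous_inner_gradient {f : E d → ℝ} (hf : ContDiff ℝ 1 f) (Ω : E d) :
    Continuous fun x => inner ℝ Ω (gradient f x) := by
  have : ∀ x, inner ℝ Ω (gradient f x) = fderiv ℝ f x Ω := fun x => by
    rw [real_inner_comm, gradient, InnerProductSpace.toDual_symm_apply]
  simp only [this]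
  exact (hf.continuous_fderiv (by simp)).clm_apply continuous_const

variable {u v : Scalar d ι}

theorem sum_integral_restrict (hu : ∀ k, Continuous (u k)) (hv : PiecewiseSmooth v) :
    Integrable (fun y => ∑ k ∈ (M.intervals F y).s, ∫ t in (M.intervals F y).lo k..
      (M.intervals F y).hi k, F.restrict u y k t * deriv (F.restrict v y k) t) ∧
    ∫ y, ∑ k ∈ (M.intervals F y).s, ∫ t in (M.intervals F y).lo k..(M.intervals F y).hi k,
        F.restrict u y k t * deriv (F.restrict v y k) t
      = ∑ k, ∫ x in M.cell k, u k x * inner ℝ F.dir (gradient (v k) x) := by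
  classical
  have h : ∀ y, ∑ k ∈ (M.intervals F y).s, ∫ t in (M.intervals F y).lo k..(M.intervals F y).hi k,
        F.restrict u y k t * deriv (F.restrict v y k) t
      = ∑ k, F.lineIntegral (M.cell k) (fun x => u k x * inner ℝ F.dir (gradient (v k) x)) y := by
    intro y
    simp only [intervals, Finset.sum_filter, LineFrame.lineIntegral]
    refine Finset.sum_congr rfl fun k _ => ?_
    split_ifs with hk
    · refine intervalIntegral.integral_congr fun t _ => ?_
      change _ * deriv (fun t => v k (F.pt y t)) t = _
      rw [F.deriv_comp_pt (hv k)]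
      rfl
    · rfl
  have hint : ∀ k, IntegrableOn (fun x => u k x * inner ℝ F.dir (gradient (v k) x)) (M.cell k) :=
    fun k => integrableOn_cell_of_continuous F.pos k
      ((hu k).mul (continuous_inner_gradient (hv k) _))
  have hpol := M.exists_isPolytope F.pos
  choose s hs using hpol
  simp only [h]
  have hi : ∀ k ∈ (Finset.univ : Finset ι), Integrable (F.lineIntegral (M.cell k)
      fun x => u k x * inner ℝ F.dir (gradient (v k) x)) := fun k _ =>
    LineFrame.integrable_lineIntegral (hs k) (hint k)
  refine ⟨integrable_finsetSum _ hi, ?_⟩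
  rw [integral_finsetSum _ hi]
  exact Finset.sum_congr rfl fun k _ => LineFrame.integral_lineIntegral (hs k) (hint k)

/-- The advection form as an integral over lines. -/
theorem advect_eq_integral {r : ℝ} (hr : 0 < r) (hu : PiecewiseSmooth u) (hv : PiecewiseSmooth v) :
    Integrable (fun y => (M.intervals F y).form (F.restrict u y) (F.restrict v y)) ∧
    M.advect (r • F.dir) u v
      = r * ∫ y, (M.intervals F y).form (F.restrict u y) (F.restrict v y) := by
  classical
  have hpol := M.exists_isPolytope F.pos
  choose s hs using hpol
  -- The upwind value may switch cells along a face at hanging nodes, so the flux density is in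
  -- general only measurable and bounded; this is all that `setIntegral_frontier` asks for.
  let g : ι → E d → ℝ := fun k x => M.upwind F.dir u x * v k x
  have hg : ∀ k, Measurable (g k) := fun k =>
    (measurable_upwind fun l => (hu l).continuous).mul (hv k).continuous.measurable
  have hb : ∀ k, ∃ C, ∀ x ∈ closure (M.cell k), |g k x| ≤ C := fun k => by
    have hc : Continuous fun x => (∑ l, |u l x|) * |v k x| := by
      refine Continuous.mul (continuous_finsetSum _ fun l _ => (hu l).continuous.abs) ?_
      exact (hv k).continuous.abs
    obtain ⟨C, hC⟩ := isBounded_image_of_continuous hc (hs k).isCompact_closure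
    refine ⟨C, fun x hx => le_trans ?_ ((le_abs_self _).trans (hC x hx))⟩
    rw [abs_mul]
    exact mul_le_mul_of_nonneg_right (abs_upwind_le _ _ _) (abs_nonneg _)
  have hsum := sum_integral_restrict (M := M) (F := F) (fun k => (hu k).continuous) hv
  have hform : ∀ y, (M.intervals F y).form (F.restrict u y) (F.restrict v y)
      = -(∑ k ∈ (M.intervals F y).s, ∫ t in (M.intervals F y).lo k..(M.intervals F y).hi k,
          F.restrict u y k t * deriv (F.restrict v y k) t)
        + ∑ k, (F.exitVal (M.cell k) (g k) y - F.neg.exitVal (M.cell k) (g k) y) := by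
    intro y
    have h2 : ∑ k, (F.exitVal (M.cell k) (g k) y - F.neg.exitVal (M.cell k) (g k) y)
        = ∑ k ∈ (M.intervals F y).s,
          (F.restrict u y k ((M.intervals F y).hi k) * F.restrict v y k ((M.intervals F y).hi k)
          - (M.intervals F y).left (F.restrict u y) ((M.intervals F y).lo k)
            * F.restrict v y k ((M.intervals F y).lo k)) := by
      rw [show (M.intervals F y).s = Finset.univ.filter fun k => F.Hits (M.cell k) y from rfl,
        Finset.sum_filter]
      refine Finset.sum_congr rfl fun k _ => ?_
      rw [F.neg_exitVal, LineFrame.exitVal]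
      split_ifs with hk
      · simp only [g]
        rw [upwind_exit u hk, upwind_entry u hk]
        rfl
      · simp
    rw [h2, Intervals.form, ← Finset.sum_neg_distrib, ← Finset.sum_add_distrib]
    exact Finset.sum_congr rfl fun k _ => by ring
  have hie : ∀ k ∈ (Finset.univ : Finset ι), Integrable
      (fun y => F.exitVal (M.cell k) (g k) y - F.neg.exitVal (M.cell k) (g k) y) := fun k _ =>
    (LineFrame.integrable_exitVal (hs k) (hg k) (hb k)).sub
      (LineFrame.integrable_exitVal (hs k) (hg k) (hb k))
  have hie' := integrable_finsetSum _ hie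
  simp only [hform]
  refine ⟨hsum.1.fun_neg.add hie', ?_⟩
  rw [integral_add hsum.1.fun_neg hie', integral_neg, hsum.2, integral_finsetSum _ hie]
  simp only [advect, upwind_smul hr, inner_smul_left, conj_trivial]
  rw [mul_add, mul_neg, Finset.mul_sum, Finset.mul_sum, ← Finset.sum_neg_distrib,
    ← Finset.sum_add_distrib]
  refine Finset.sum_congr rfl fun k _ => ?_
  have e1 : ∫ x in M.cell k, u k x * (r * inner ℝ F.dir (gradient (v k) x))
      = r * ∫ x in M.cell k, u k x * inner ℝ F.dir (gradient (v k) x) := by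
    rw [← integral_const_mul]
    simp only [mul_left_comm]
  have e2 : ∫ x in frontier (M.cell k), M.upwind F.dir u x
        * (r * inner ℝ F.dir (outwardNormal (M.cell k) x)) * v k x ∂μHE[d - 1]
      = r * ∫ x in frontier (M.cell k), g k x * inner ℝ F.dir (outwardNormal (M.cell k) x)
        ∂μHE[d - 1] := by
    rw [← integral_const_mul]
    congr 1
    funext x
    simp only [g]
    ring
  rw [← LineFrame.setIntegral_frontier (hs k) (hg k) (hb k), e1, e2]

end Mesh

end SNDG

end

noncomputable section

namespace SNDG

variable {d : ℕ} {ι : Type*}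

/-! ### Almost every point and almost every line -/

namespace LineFrame

theorem neg_lo (F : LineFrame d) (K : Set (E d)) (y : E (d - 1)) : F.neg.lo K y = -F.hi K y := by
  simp only [hi, lo, neg_pt]
  have : {t | F.pt y (-t) ∈ K} = -{t | F.pt y t ∈ K} := rfl
  rw [this, Real.sInf_def, neg_neg]

theorem ae_of_ae_line (F : LineFrame d) {P : E d → Prop} (h : ∀ᵐ x, P x) :
    ∀ᵐ y, ∀ᵐ t, P (F.pt y t) := by
  have := F.measurePreserving_pt.quasiMeasurePreserving.ae h
  rw [Measure.volume_eq_prod] at this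
  exact Measure.ae_ae_of_ae_prod this

theorem ae_exists_line (F : LineFrame d) {P : E (d - 1) → Prop} (h : ∀ᵐ y, P y) :
    ∀ᵐ x : E d, ∃ y t, F.pt y t = x ∧ P y := by
  rw [← F.measurePreserving_pt.map_eq, F.measurableEmbedding_pt.ae_map_iff,
    Measure.volume_eq_prod]
  filter_upwards [Measure.quasiMeasurePreserving_fst.ae h] with p hp
  exact ⟨p.1, p.2, rfl, hp⟩

end LineFrame

/-- The zero ordinate can occur for `d < 3`. It has no lines, but its advection form is zero. -/
theorem eq_zero_or_exists_lineFrame (hd : 1 ≤ d) (Ω : E d) :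
    Ω = 0 ∨ ∃ (F : LineFrame d) (r : ℝ), 0 < r ∧ Ω = r • F.dir := by
  by_cases h : Ω = 0
  · exact Or.inl h
  · have hn : 0 < ‖Ω‖ := norm_pos_iff.2 h
    obtain ⟨F, hF⟩ := exists_lineFrame hd (ω := ‖Ω‖⁻¹ • Ω) (by
      rw [norm_smul, norm_inv, norm_norm, inv_mul_cancel₀ hn.ne'])
    refine Or.inr ⟨F, ‖Ω‖, hn, ?_⟩
    rw [hF, smul_smul, mul_inv_cancel₀ hn.ne', one_smul]

namespace Mesh

variable (M : Mesh d ι)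

/-! ### The skeleton of a mesh -/

/-- The union of the boundaries of the cells. -/
def skeleton : Set (E d) := ⋃ k, frontier (M.cell k)

variable {M}

theorem isOpen_cell (hd : 1 ≤ d) (k : ι) : IsOpen (M.cell k) := by
  obtain ⟨s, hs⟩ := M.exists_isPolytope hd k
  exact hs.isOpen

theorem cell_subset_domain (hd : 1 ≤ d) (k : ι) : M.cell k ⊆ M.domain :=
  interior_maximal (subset_closure.trans (subset_iUnion (fun k => closure (M.cell k)) k))
    (isOpen_cell hd k)

theorem notMem_skeleton_of_mem_cell (hd : 1 ≤ d) {k : ι} {x : E d} (hx : x ∈ M.cell k) :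
    x ∉ M.skeleton := by
  intro h
  obtain ⟨l, hl⟩ := mem_iUnion.1 h
  by_cases hkl : k = l
  · subst hkl
    exact ((isOpen_cell hd k).frontier_eq ▸ hl).2 hx
  · exact disjoint_left.1 ((M.disjoint hkl).closure_right (isOpen_cell hd k)) hx
      (frontier_subset_closure hl)

theorem exists_mem_cell {x : E d} (hx : x ∉ M.skeleton) (hc : ∃ k, x ∈ closure (M.cell k)) :
    ∃ k, x ∈ M.cell k := by
  obtain ⟨k, hk⟩ := hc
  refine ⟨k, ?_⟩
  by_contra hxk
  exact hx (mem_iUnion.2 ⟨k, hk, fun h => hxk (interior_subset h)⟩)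

theorem ae_notMem_skeleton [Countable ι] (hd : 1 ≤ d) : ∀ᵐ x, x ∉ M.skeleton := by
  rw [← measure_eq_zero_iff_ae_notMem]
  refine measure_iUnion_null fun k => ?_
  obtain ⟨s, hs⟩ := M.exists_isPolytope hd k
  exact hs.convex.addHaar_frontier _

variable {u u' v v' φ : Scalar d ι} {Ω : E d} {F : LineFrame d}

theorem _root_.SNDG.PiecewiseSmooth.add (hu : PiecewiseSmooth u) (hu' : PiecewiseSmooth u') :
    PiecewiseSmooth (u + u') := fun k => (hu k).add (hu' k)

theorem _root_.SNDG.PiecewiseSmooth.smul (c : ℝ) (hu : PiecewiseSmooth u) :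
    PiecewiseSmooth (c • u) := fun k => (hu k).const_smul c

theorem _root_.SNDG.PiecewiseSmooth.restrict (hu : PiecewiseSmooth u) (F : LineFrame d)
    (y : E (d - 1)) (k : ι) : ContDiff ℝ 1 (F.restrict u y k) := F.contDiff_comp_pt (hu k) y

theorem eqOn_closure_of_continuousOn (hd : 1 ≤ d) {f : E d → ℝ}
    (hf : ContinuousOn f (closure M.domain)) (hφ : ∀ k, Continuous (φ k))
    (h : ∀ k, ∀ x ∈ M.cell k, f x = φ k x) (k : ι) : EqOn f (φ k) (closure (M.cell k)) :=
  EqOn.of_subset_closure (h k) (hf.mono (closure_mono (cell_subset_domain hd k)))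
    (hφ k).continuousOn subset_closure le_rfl

variable [Fintype ι]

/-! ### Algebraic properties of the advection form -/

theorem advect_zero_dir (u v : Scalar d ι) : M.advect 0 u v = 0 := by
  simp [advect]

/-- Bilinearity is read off on the lines, where `advect_eq_integral` already supplies the
integrability. -/
theorem advect_add_left (hd : 1 ≤ d) (hu : PiecewiseSmooth u) (hu' : PiecewiseSmooth u')
    (hv : PiecewiseSmooth v) : M.advect Ω (u + u') v = M.advect Ω u v + M.advect Ω u' v := by
  rcases eq_zero_or_exists_lineFrame hd Ω with rfl | ⟨F, r, hr, rfl⟩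
  · simp [advect_zero_dir]
  · rw [(advect_eq_integral hr hu hv).2, (advect_eq_integral hr hu' hv).2,
      (advect_eq_integral hr (hu.add hu') hv).2, ← mul_add,
      ← integral_add (advect_eq_integral hr hu hv).1 (advect_eq_integral hr hu' hv).1]
    congr 2
    funext y
    exact Intervals.form_add_left _ (fun k => (hu.restrict F y k).continuous)
      (fun k => (hu'.restrict F y k).continuous) (hv.restrict F y)

theorem advect_add_right (hd : 1 ≤ d) (hu : PiecewiseSmooth u) (hv : PiecewiseSmooth v)
    (hv' : PiecewiseSmooth v') : M.advect Ω u (v + v') = M.advect Ω u v + M.advect Ω u v' := by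
  rcases eq_zero_or_exists_lineFrame hd Ω with rfl | ⟨F, r, hr, rfl⟩
  · simp [advect_zero_dir]
  · rw [(advect_eq_integral hr hu hv).2, (advect_eq_integral hr hu hv').2,
      (advect_eq_integral hr hu (hv.add hv')).2, ← mul_add,
      ← integral_add (advect_eq_integral hr hu hv).1 (advect_eq_integral hr hu hv').1]
    congr 2
    funext y
    exact Intervals.form_add_right _ (fun k => (hu.restrict F y k).continuous)
      (hv.restrict F y) (hv'.restrict F y)

theorem advect_smul_left (hd : 1 ≤ d) (c : ℝ) (hu : PiecewiseSmooth u) (hv : PiecewiseSmooth v) :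
    M.advect Ω (c • u) v = c * M.advect Ω u v := by
  rcases eq_zero_or_exists_lineFrame hd Ω with rfl | ⟨F, r, hr, rfl⟩
  · simp [advect_zero_dir]
  · rw [(advect_eq_integral hr hu hv).2,
      (advect_eq_integral hr (hu.smul c) hv).2, mul_left_comm,
      ← integral_const_mul c]
    congr 2
    funext y
    exact Intervals.form_smul_left _ c _ _

theorem advect_smul_right (hd : 1 ≤ d) (c : ℝ) (hu : PiecewiseSmooth u) (hv : PiecewiseSmooth v) :
    M.advect Ω u (c • v) = c * M.advect Ω u v := by
  rcases eq_zero_or_exists_lineFrame hd Ω with rfl | ⟨F, r, hr, rfl⟩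
  · simp [advect_zero_dir]
  · rw [(advect_eq_integral hr hu hv).2,
      (advect_eq_integral hr hu (hv.smul c)).2, mul_left_comm,
      ← integral_const_mul c]
    congr 2
    funext y
    exact Intervals.form_smul_right _ c (hv.restrict F y)

theorem advect_self_nonneg (hd : 1 ≤ d) (hu : PiecewiseSmooth u) : 0 ≤ M.advect Ω u u := by
  rcases eq_zero_or_exists_lineFrame hd Ω with rfl | ⟨F, r, hr, rfl⟩
  · rw [advect_zero_dir]
  · rw [(advect_eq_integral hr hu hu).2]
    exact mul_nonneg hr.le (integral_nonneg fun y =>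
      Intervals.form_self_nonneg _ (hu.restrict F y))

theorem ae_matched_of_advect_self_eq_zero {r : ℝ} (hr : 0 < r) (hu : PiecewiseSmooth u)
    (h : M.advect (r • F.dir) u u = 0) :
    ∀ᵐ y, (M.intervals F y).Matched (F.restrict u y) := by
  have h1 := advect_eq_integral (M := M) (F := F) hr hu hu
  rw [h1.2, mul_eq_zero, or_iff_right hr.ne', integral_eq_zero_iff_of_nonneg (fun y =>
    Intervals.form_self_nonneg _ (hu.restrict F y)) h1.1] at h
  filter_upwards [h] with y hy
  exact Intervals.matched_of_form_self_eq_zero _ (hu.restrict F y) hy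

/-! ### Continuous fields that vanish on the boundary -/

/-- Points just beyond the exit lie in the domain and, for arbitrarily small steps, off the
skeleton, hence in cells. As there are finitely many cells, one of them is met arbitrarily close to
the exit; by disjointness its interval begins exactly there. The hypothesis `hy` excludes lines that
run inside faces. -/
theorem exists_lo_eq_hi {y : E (d - 1)} (hy : ∀ᵐ t, F.pt y t ∉ M.skeleton) {l : ι}
    (hl : F.Hits (M.cell l) y) (hD : F.pt y (F.hi (M.cell l) y) ∈ M.domain) :
    ∃ k ∈ (M.intervals F y).s, F.lo (M.cell k) y = F.hi (M.cell l) y := by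
  obtain ⟨s', hs'⟩ := M.exists_isPolytope F.pos l
  have hlt := LineFrame.lo_lt_hi hs' hl
  have hev : ∀ᶠ t in 𝓝[>] (F.hi (M.cell l) y), F.pt y t ∈ M.domain :=
    nhdsWithin_le_nhds
      ((LineFrame.continuous_pt_right y).continuousAt.eventually (isOpen_interior.mem_nhds hD))
  have hfr : ∃ᶠ t in 𝓝[>] (F.hi (M.cell l) y), F.pt y t ∉ M.skeleton := by
    rw [frequently_iff]
    intro U hU
    obtain ⟨b, hb, hbU⟩ := (mem_nhdsGT_iff_exists_Ioo_subset).1 hU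
    obtain ⟨t, ht, ht'⟩ := (Measure.dense_of_ae hy).exists_mem_open isOpen_Ioo
      (nonempty_Ioo.2 hb)
    exact ⟨t, hbU ht', ht⟩
  have hex : ∃ k, ∃ᶠ t in 𝓝[>] (F.hi (M.cell l) y), F.pt y t ∈ M.cell k := by
    by_contra! hno
    obtain ⟨t, h1, h2, h3⟩ := (hfr.and_eventually (hev.and (eventually_all.2 hno))).exists
    obtain ⟨k, hk⟩ := exists_mem_cell h1 (mem_iUnion.1 (interior_subset h2))
    exact h3 k hk
  obtain ⟨k, hk⟩ := hex
  obtain ⟨s, hs⟩ := M.exists_isPolytope F.pos k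
  have hhit : F.Hits (M.cell k) y := let ⟨t, ht⟩ := hk.exists; ⟨t, ht⟩
  have h1 : F.hi (M.cell l) y < F.hi (M.cell k) y := by
    obtain ⟨t, ht, ht'⟩ := (hk.and_eventually self_mem_nhdsWithin).exists
    exact (mem_Ioi.1 ht').trans ((LineFrame.pt_mem_iff hs hhit).1 ht).2
  have h2 : F.lo (M.cell k) y ≤ F.hi (M.cell l) y := by
    by_contra! hlt'
    obtain ⟨t, ht, ht'⟩ := (hk.and_eventually (nhdsWithin_le_nhds (gt_mem_nhds hlt'))).exists
    linarith [((LineFrame.pt_mem_iff hs hhit).1 ht).1]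
  have hne : k ≠ l := by
    rintro rfl
    exact h1.false
  refine ⟨k, mem_intervals.2 hhit, ?_⟩
  rcases M.interval_sep F hne hhit hl with h3 | h3 <;> linarith

/-- At an exit either a next cell begins, and both polynomials agree with the continuous function
`f` on the closures of their cells, or the point lies on ∂D, where `f` vanishes. -/
theorem ae_right_eq_of_mem_contZero (hφ : PiecewiseSmooth φ) (h : φ ∈ M.contZero) (F : LineFrame d) :
    ∀ᵐ y, ∀ l ∈ (M.intervals F y).s, (M.intervals F y).right (F.restrict φ y) (F.hi (M.cell l) y)
      = F.restrict φ y l (F.hi (M.cell l) y) := by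
  obtain ⟨-, f, hf, hfφ, hf0⟩ := h
  have hcl := eqOn_closure_of_continuousOn F.pos hf (fun k => (hφ k).continuous) hfφ
  filter_upwards [F.ae_of_ae_line (ae_notMem_skeleton (M := M) F.pos)] with y hy l hl
  have hl' := mem_intervals.1 hl
  obtain ⟨s, hs⟩ := M.exists_isPolytope F.pos l
  have hmem := LineFrame.pt_mem_closure hs hl' (right_mem_Icc.2 (LineFrame.lo_lt_hi hs hl').le)
  by_cases hex : ∃ k ∈ (M.intervals F y).s, F.lo (M.cell k) y = F.hi (M.cell l) y
  · obtain ⟨k, hk, hkl⟩ := hex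
    have hk' := mem_intervals.1 hk
    obtain ⟨s', hs'⟩ := M.exists_isPolytope F.pos k
    have hmem' := LineFrame.pt_mem_closure hs' hk'
      (left_mem_Icc.2 (LineFrame.lo_lt_hi hs' hk').le)
    rw [hkl] at hmem'
    rw [(M.intervals F y).right_eq hk hkl]
    exact (hcl k hmem').symm.trans (hcl l hmem)
  · rw [(M.intervals F y).right_eq_zero fun k hk hkl => hex ⟨k, hk, hkl⟩]
    have hfr : F.pt y (F.hi (M.cell l) y) ∈ frontier M.domain := by
      rw [frontier, show interior M.domain = M.domain from isOpen_interior.interior_eq]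
      exact ⟨closure_mono (cell_subset_domain F.pos l) hmem, fun hD => hex (exists_lo_eq_hi hy hl' hD)⟩
    exact (hf0 _ hfr).symm.trans (hcl l hmem)

theorem neg_right_eq_left (u : Scalar d ι) (y : E (d - 1)) (t : ℝ) :
    (M.intervals F.neg y).right (F.neg.restrict u y) (-t)
      = (M.intervals F y).left (F.restrict u y) t := by
  classical
  simp only [Intervals.right, Intervals.left, intervals, Finset.sum_filter, LineFrame.neg_hits,
    LineFrame.neg_lo, neg_inj, LineFrame.restrict, LineFrame.neg_pt, neg_neg]
  exact Finset.sum_congr rfl fun k _ => by congr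

/-- Matching at the left ends is matching at the right ends of the reversed lines. -/
theorem ae_matched_of_mem_contZero (hφ : PiecewiseSmooth φ) (h : φ ∈ M.contZero) (F : LineFrame d) :
    ∀ᵐ y, (M.intervals F y).Matched (F.restrict φ y) := by
  filter_upwards [ae_right_eq_of_mem_contZero hφ h F, ae_right_eq_of_mem_contZero hφ h F.neg]
    with y h1 h2
  refine ⟨fun k hk => ?_, h1⟩
  have := h2 k (mem_intervals.2 ((F.neg_hits _ _).2 (mem_intervals.1 hk)))
  rw [LineFrame.neg_hi, neg_right_eq_left] at this
  refine this.trans ?_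
  simp only [LineFrame.restrict, LineFrame.neg_pt, neg_neg]
  rfl

/-- Almost every line sees a matched test function, so the one-dimensional identity can be
integrated back over the lines. -/
theorem advect_right_of_mem_contZero (hd : 1 ≤ d) (hu : PiecewiseSmooth u)
    (hφ : PiecewiseSmooth φ) (h : φ ∈ M.contZero) :
    M.advect Ω u φ = -∑ k, ∫ x in M.cell k, u k x * inner ℝ Ω (gradient (φ k) x) := by
  rcases eq_zero_or_exists_lineFrame hd Ω with rfl | ⟨F, r, hr, rfl⟩
  · simp [advect_zero_dir]
  · rw [(advect_eq_integral hr hu hφ).2, integral_congr_ae (g := fun y => -_)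
      ((ae_matched_of_mem_contZero hφ h F).mono fun y hy => Intervals.form_right_of_matched _ hy),
      integral_neg, (sum_integral_restrict (fun k => (hu k).continuous) hφ).2, mul_neg,
      Finset.mul_sum]
    congr 1
    refine Finset.sum_congr rfl fun k _ => ?_
    rw [← integral_const_mul]
    simp only [inner_smul_left, conj_trivial, mul_left_comm]

theorem advect_left_of_mem_contZero (hd : 1 ≤ d) (hφ : PiecewiseSmooth φ)
    (hv : PiecewiseSmooth v) (h : φ ∈ M.contZero) :
    M.advect Ω φ v = ∑ k, ∫ x in M.cell k, v k x * inner ℝ Ω (gradient (φ k) x) := by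
  rcases eq_zero_or_exists_lineFrame hd Ω with rfl | ⟨F, r, hr, rfl⟩
  · simp [advect_zero_dir]
  · rw [(advect_eq_integral hr hφ hv).2, integral_congr_ae
      ((ae_matched_of_mem_contZero hφ h F).mono fun y hy => Intervals.form_left_of_matched _
        (hφ.restrict F y) (hv.restrict F y) hy),
      (sum_integral_restrict (fun k => (hv k).continuous) hφ).2, Finset.mul_sum]
    refine Finset.sum_congr rfl fun k _ => ?_
    rw [← integral_const_mul]
    simp only [inner_smul_left, conj_trivial, mul_left_comm]

end Mesh

end SNDG

end

noncomputable section

namespace SNDG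

variable {d n : ℕ} {ι : Type*} [Fintype ι]

namespace Mesh

variable {M : Mesh d ι} {u : Scalar d ι} {Ω : E d} {F : LineFrame d}

/-! ### Fields without jumps are continuous -/

/-- The function given by a piecewise polynomial, extended by zero outside the cells. -/
def toFun (M : Mesh d ι) (u : Scalar d ι) (x : E d) : ℝ := ∑ k, (M.cell k).indicator (u k) x

theorem toFun_of_mem {k : ι} {x : E d} (hx : x ∈ M.cell k) : M.toFun u x = u k x := by
  unfold toFun
  rw [Finset.sum_eq_single k, indicator_of_mem hx]
  · exact fun l _ hne => indicator_of_notMem (disjoint_left.1 (M.disjoint hne.symm) hx) _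
  · simp

theorem toFun_of_notMem {x : E d} (hx : ∀ k, x ∉ M.cell k) : M.toFun u x = 0 :=
  Finset.sum_eq_zero fun k _ => indicator_of_notMem (hx k) _

theorem continuousAt_toFun (hu : ∀ k, Continuous (u k)) {x : E d} (hx : x ∉ M.skeleton) :
    ContinuousAt (M.toFun u) x := by
  unfold toFun
  exact tendsto_finsetSum _ fun k _ =>
    ((hu k).continuousOn.continuousAt_indicator fun h => hx (mem_iUnion.2 ⟨k, h⟩))

theorem toFun_pt (u : Scalar d ι) (y : E (d - 1)) (t : ℝ) :
    M.toFun u (F.pt y t) = (M.intervals F y).val (F.restrict u y) t := by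
  classical
  unfold toFun Intervals.val
  rw [show (M.intervals F y).s = Finset.univ.filter fun k => F.Hits (M.cell k) y from rfl,
    Finset.sum_filter]
  refine Finset.sum_congr rfl fun k _ => ?_
  obtain ⟨s, hs⟩ := M.exists_isPolytope F.pos k
  by_cases hk : F.Hits (M.cell k) y
  · rw [if_pos hk]
    by_cases ht : F.pt y t ∈ M.cell k
    · exact (indicator_of_mem ht _).trans (if_pos ((LineFrame.pt_mem_iff hs hk).1 ht)).symm
    · exact (indicator_of_notMem ht _).trans
        (if_neg fun h => ht ((LineFrame.pt_mem_iff hs hk).2 h)).symm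
  · rw [if_neg hk, indicator_of_notMem fun h => hk ⟨t, h⟩]

theorem ne_lo_hi_of_notMem_skeleton {y : E (d - 1)} {t : ℝ} (ht : F.pt y t ∉ M.skeleton) :
    ∀ k ∈ (M.intervals F y).s, t ≠ (M.intervals F y).lo k ∧ t ≠ (M.intervals F y).hi k := by
  intro k hk
  have hk' := mem_intervals.1 hk
  obtain ⟨s, hs⟩ := M.exists_isPolytope F.pos k
  have hlt := (LineFrame.lo_lt_hi hs hk').le
  constructor
  · rintro rfl
    refine ht (mem_iUnion.2 ⟨k, LineFrame.pt_mem_closure hs hk' (left_mem_Icc.2 hlt), ?_⟩)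
    rw [hs.isOpen.interior_eq]
    exact LineFrame.pt_lo_notMem hs hk'
  · rintro rfl
    refine ht (mem_iUnion.2 ⟨k, LineFrame.pt_mem_closure hs hk' (right_mem_Icc.2 hlt), ?_⟩)
    rw [hs.isOpen.interior_eq]
    exact LineFrame.pt_hi_notMem hs hk'

theorem ae_translate {P : E d → Prop} (h : ∀ᵐ x, P x) (a : E d) : ∀ᵐ x, P (x + a) :=
  (measurePreserving_add_right volume a).quasiMeasurePreserving.ae h

theorem exists_abs_inner_gradient_le (hd : 1 ≤ d) (hu : PiecewiseSmooth u) (Ω : E d) :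
    ∃ L : ℝ, 0 ≤ L ∧ ∀ k, ∀ x ∈ closure (M.cell k), |inner ℝ Ω (gradient (u k) x)| ≤ L := by
  have h : ∀ k, ∃ C, ∀ x ∈ closure (M.cell k), |inner ℝ Ω (gradient (u k) x)| ≤ C := fun k => by
    obtain ⟨s, hs⟩ := M.exists_isPolytope hd k
    exact isBounded_image_of_continuous (continuous_inner_gradient (hu k) Ω) hs.isCompact_closure
  choose C hC using h
  refine ⟨∑ k, |C k|, Finset.sum_nonneg fun _ _ => abs_nonneg _, fun k x hx => ?_⟩
  exact (hC k x hx).trans ((le_abs_self _).trans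
    (Finset.single_le_sum (f := fun k => |C k|) (fun _ _ => abs_nonneg _) (Finset.mem_univ k)))

/-- The extension by zero is `val` on each line, and the bounds on derivatives and on the number of
intervals do not depend on the line. The exceptional null set depends on `r`, so this is not yet a
pointwise Lipschitz bound. -/
theorem exists_ae_abs_sub_le_of_matched (hu : PiecewiseSmooth u)
    (h : ∀ᵐ y, (M.intervals F y).Matched (F.restrict u y)) :
    ∃ C : ℝ, 0 ≤ C ∧ ∀ r : ℝ, ∀ᵐ x, |M.toFun u (x + r • F.dir) - M.toFun u x| ≤ C * |r| := by
  obtain ⟨L, hL0, hL⟩ := exists_abs_inner_gradient_le (M := M) F.pos hu F.dir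
  refine ⟨Fintype.card ι * L, by positivity, fun r => ?_⟩
  have hsk := ae_notMem_skeleton (M := M) F.pos
  filter_upwards [hsk, ae_translate hsk (r • F.dir), F.ae_exists_line h] with x hx hxr hline
  obtain ⟨y, t, rfl, hm⟩ := hline
  have hpt : F.pt y t + r • F.dir = F.pt y (t + r) := by
    simp only [LineFrame.pt, add_smul, add_assoc]
  rw [hpt] at hxr ⊢
  rw [toFun_pt, toFun_pt]
  refine (hm.abs_val_sub_le (hu.restrict F y) (L := L) ?_ (ne_lo_hi_of_notMem_skeleton hxr)
    (ne_lo_hi_of_notMem_skeleton hx)).trans ?_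
  · intro k hk τ hτ
    obtain ⟨s, hs⟩ := M.exists_isPolytope F.pos k
    have := hL k _ (LineFrame.pt_mem_closure hs (mem_intervals.1 hk) hτ)
    rwa [← F.deriv_comp_pt (hu k)] at this
  · rw [add_sub_cancel_left, ← mul_assoc]
    have : ((M.intervals F y).s.card : ℝ) ≤ Fintype.card ι := by
      exact_mod_cast Finset.card_le_univ _
    gcongr

theorem exists_ae_abs_sub_le (hd : 1 ≤ d) (hu : PiecewiseSmooth u) (h : M.advect Ω u u = 0) :
    ∃ C : ℝ, 0 ≤ C ∧ ∀ r : ℝ, ∀ᵐ x, |M.toFun u (x + r • Ω) - M.toFun u x| ≤ C * |r| := by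
  rcases eq_zero_or_exists_lineFrame hd Ω with rfl | ⟨F, c, hc, rfl⟩
  · exact ⟨0, le_rfl, fun r => Eventually.of_forall fun x => by simp⟩
  · obtain ⟨C, hC0, hC⟩ := exists_ae_abs_sub_le_of_matched hu
      (ae_matched_of_advect_self_eq_zero hc hu h)
    refine ⟨C * c, by positivity, fun r => ?_⟩
    filter_upwards [hC (r * c)] with x hx
    rw [smul_smul, mul_assoc, mul_comm c, ← abs_of_pos hc, ← abs_mul, abs_of_pos hc]
    exact hx

/-- The second moment condition says that the ordinates form a tight frame; in particular they span,
with coefficients bounded linearly in `h`. -/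
theorem _root_.SNDG.Quadrature.sum_smul_pt (Q : Quadrature d n) (h : E d) :
    ∑ j, (3 * Q.wt j * inner ℝ (Q.pt j) h) • Q.pt j = h := by
  ext a
  have h1 : ∀ b : Fin d, ∑ j, 3 * Q.wt j * (Q.pt j b * h b) * Q.pt j a
      = if a = b then h b else 0 := fun b => by
    have : ∀ j, 3 * Q.wt j * (Q.pt j b * h b) * Q.pt j a
        = 3 * h b * (Q.wt j * (Q.pt j a * Q.pt j b)) := fun j => by ring
    simp only [this]
    rw [← Finset.mul_sum, Q.sum_wt_pt_pt]
    split_ifs <;> ring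
  have h2 : ∀ j, inner ℝ (Q.pt j) h = ∑ b, Q.pt j b * h b := fun j => by
    simp [PiLp.inner_apply, mul_comm]
  simp only [WithLp.ofLp_sum, WithLp.ofLp_smul, Finset.sum_apply, Pi.smul_apply, smul_eq_mul, h2,
    Finset.mul_sum, Finset.sum_mul]
  rw [Finset.sum_comm, Finset.sum_congr rfl fun b _ => h1 b]
  simp

/-- Translate by `a` in steps along the ordinates, with the frame coefficients. Null sets are
translation invariant, so the estimate for each step holds at almost every intermediate point. -/
theorem exists_ae_abs_sub_le_norm (hd : 1 ≤ d) (Q : Quadrature d n) (hu : PiecewiseSmooth u)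
    (h : ∀ j, M.advect (Q.pt j) u u = 0) :
    ∃ C : ℝ, 0 ≤ C ∧ ∀ a : E d, ∀ᵐ x, |M.toFun u (x + a) - M.toFun u x| ≤ C * ‖a‖ := by
  choose C hC0 hC using fun j => exists_ae_abs_sub_le hd hu (h j)
  have hsum : ∀ (r : Fin n → ℝ) (T : Finset (Fin n)), ∀ᵐ x,
      |M.toFun u (x + ∑ j ∈ T, r j • Q.pt j) - M.toFun u x| ≤ ∑ j ∈ T, C j * |r j| := by
    intro r T
    induction T using Finset.cons_induction with
    | empty => simp
    | cons i T hi ih =>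
      simp only [Finset.sum_cons]
      filter_upwards [ih, ae_translate (hC i (r i)) (∑ j ∈ T, r j • Q.pt j)] with x h1 h2
      rw [add_assoc, add_comm (∑ j ∈ T, r j • Q.pt j)] at h2
      exact (abs_sub_le _ _ _).trans (add_le_add h2 h1)
  refine ⟨∑ j, C j * (3 * Q.wt j * ‖Q.pt j‖), Finset.sum_nonneg fun j _ => ?_, fun a => ?_⟩
  · have := hC0 j
    have := Q.wt_pos j
    positivity
  · have h1 := hsum (fun j => 3 * Q.wt j * inner ℝ (Q.pt j) a) Finset.univ
    rw [Q.sum_smul_pt] at h1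
    filter_upwards [h1] with x hx
    refine hx.trans ?_
    rw [Finset.sum_mul]
    refine Finset.sum_le_sum fun j _ => ?_
    have hw := Q.wt_pos j
    rw [mul_assoc (C j), abs_mul, abs_of_pos (by positivity : 0 < 3 * Q.wt j),
      mul_assoc (3 * Q.wt j)]
    have := abs_real_inner_le_norm (Q.pt j) a
    have := hC0 j
    gcongr

theorem mem_contZero_of_advect_self_eq_zero (hd : 1 ≤ d) (Q : Quadrature d n)
    (hu : PiecewiseSmooth u) (huV : u ∈ M.V) (h : ∀ j, M.advect (Q.pt j) u u = 0) :
    u ∈ M.contZero := by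
  obtain ⟨C, hC0, hC⟩ := exists_ae_abs_sub_le_norm hd Q hu h
  have hcont : ∀ {x}, x ∉ M.skeleton → ContinuousAt (M.toFun u) x := fun hx =>
    continuousAt_toFun (fun k => (hu k).continuous) hx
  have hlip : LipschitzOnWith ⟨C, hC0⟩ (M.toFun u) M.skeletonᶜ := by
    refine LipschitzOnWith.of_dist_le_mul fun y hy x hx => ?_
    rw [dist_eq_norm, dist_eq_norm, Real.norm_eq_abs]
    -- For the fixed shift `y - x` the estimate holds on a set of full measure, hence dense;
    -- continuity at `x` and at `y`, both off the skeleton, carries it to this pair.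
    have hfr : ∃ᶠ z in 𝓝 x, |M.toFun u (z + (y - x)) - M.toFun u z| ≤ C * ‖y - x‖ :=
      mem_closure_iff_frequently.1 (Measure.dense_of_ae (hC (y - x)) x)
    have hlim : Tendsto (fun z => |M.toFun u (z + (y - x)) - M.toFun u z|) (𝓝 x)
        (𝓝 |M.toFun u y - M.toFun u x|) := by
      refine Tendsto.abs (Tendsto.sub ?_ (hcont hx))
      have h1 : Tendsto (fun z => z + (y - x)) (𝓝 x) (𝓝 y) := by
        have : Tendsto (fun z => z + (y - x)) (𝓝 x) (𝓝 (x + (y - x))) :=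
          Continuous.tendsto (by fun_prop) x
        rwa [add_sub_cancel] at this
      exact (hcont hy).tendsto.comp h1
    exact le_of_tendsto_of_frequently hlim hfr
  obtain ⟨f, hf, hfu⟩ := hlip.extend_real
  refine ⟨huV, f, hf.continuous.continuousOn, fun k x hx => ?_, fun x hx => ?_⟩
  · rw [← toFun_of_mem (u := u) hx]
    exact (hfu (notMem_skeleton_of_mem_cell hd hx)).symm
  -- The extension by zero makes `f` vanish off the closed cells, hence by continuity on ∂D.
  · have hzero : EqOn f 0 (⋃ k, closure (M.cell k))ᶜ := fun z hz => by
      have hz' : ∀ k, z ∉ closure (M.cell k) := fun k hk => hz (mem_iUnion.2 ⟨k, hk⟩)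
      rw [← hfu, toFun_of_notMem fun k hk => hz' k (subset_closure hk)]
      · rfl
      · exact fun hs => let ⟨k, hk⟩ := mem_iUnion.1 hs; hz' k (frontier_subset_closure hk)
    have hx' : x ∈ closure (⋃ k, closure (M.cell k))ᶜ := by
      have := frontier_interior_subset hx
      rw [frontier_eq_closure_inter_closure] at this
      exact this.2
    exact hzero.closure hf.continuous continuous_const hx'

end Mesh

end SNDG

end

noncomputable section

namespace SNDG

/-! ### An abstract diffusion limit -/

/-- A finite-dimensional scheme `A + ε⁻¹ C + ε G = ε ℓ` together with the structure that makes its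
solutions converge to those of a mixed problem as `ε → 0⁺`. -/
structure DiffusiveScheme (X Y : Type*) [AddCommGroup X] [Module ℝ X] [AddCommGroup Y]
    [Module ℝ Y] where
  /-- advection -/
  A : X →ₗ[ℝ] X →ₗ[ℝ] ℝ
  /-- scattering -/
  C : X →ₗ[ℝ] X →ₗ[ℝ] ℝ
  /-- absorption -/
  G : X →ₗ[ℝ] X →ₗ[ℝ] ℝ
  /-- the inner product of the angular fields -/
  P : X →ₗ[ℝ] X →ₗ[ℝ] ℝ
  /-- the scattering form of the currents -/
  R : Y →ₗ[ℝ] Y →ₗ[ℝ] ℝ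
  /-- the absorption form of the currents -/
  H : Y →ₗ[ℝ] Y →ₗ[ℝ] ℝ
  /-- the inner product of the currents -/
  N : Y →ₗ[ℝ] Y →ₗ[ℝ] ℝ
  /-- the pairing of currents with gradients -/
  D : Y →ₗ[ℝ] X →ₗ[ℝ] ℝ
  /-- the source -/
  load : X →ₗ[ℝ] ℝ
  /-- the first moment -/
  moment : X →ₗ[ℝ] Y
  /-- the angular field that belongs to a current -/
  dot : Y →ₗ[ℝ] X
  /-- the isotropic fields without jumps -/
  X₀ : Submodule ℝ X
  /-- the coercivity constant -/
  κ : ℝ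
  κ_pos : 0 < κ
  A_nonneg : ∀ x, 0 ≤ A x x
  C_ge : ∀ x, κ * N (moment x) (moment x) ≤ C x x
  G_ge : ∀ x, κ * P x x ≤ G x x
  R_ge : ∀ y, κ * N y y ≤ R y y
  P_pos : ∀ x, x ≠ 0 → 0 < P x x
  N_pos : ∀ y, y ≠ 0 → 0 < N y y
  mem_X₀ : ∀ x, A x x = 0 → C x x = 0 → x ∈ X₀
  A_right : ∀ u, ∀ φ ∈ X₀, A u φ = -D (moment u) φ
  C_right : ∀ u, ∀ φ ∈ X₀, C u φ = 0
  A_dot : ∀ φ ∈ X₀, ∀ ζ, A φ (dot ζ) = 1 / 3 * D ζ φ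
  C_dot : ∀ u ζ, C u (dot ζ) = R (moment u) ζ
  G_dot : ∀ u ζ, G u (dot ζ) = H (moment u) ζ
  load_dot : ∀ ζ, load (dot ζ) = 0

namespace DiffusiveScheme

/-! ### Unique solvability of the scheme and uniqueness for the mixed problem -/

section Algebra

variable {X Y : Type*} [AddCommGroup X] [Module ℝ X] [AddCommGroup Y] [Module ℝ Y]
  (S : DiffusiveScheme X Y)

/-- `ψ` solves the scheme. -/
def IsSolution (ε : ℝ) (ψ : X) : Prop :=
  ∀ v, S.A ψ v + ε⁻¹ * S.C ψ v + ε * S.G ψ v = ε * S.load v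

/-- `(x, y)` solves the mixed problem. -/
def IsMixed (x : X) (y : Y) : Prop :=
  x ∈ S.X₀ ∧ (∀ φ ∈ S.X₀, -S.D y φ + S.G x φ = S.load φ) ∧
    ∀ ζ, 1 / 3 * S.D ζ x + S.R y ζ = 0

variable {S}

theorem P_nonneg (x : X) : 0 ≤ S.P x x := by
  by_cases h : x = 0
  · simp [h]
  · exact (S.P_pos x h).le

theorem N_nonneg (y : Y) : 0 ≤ S.N y y := by
  by_cases h : y = 0
  · simp [h]
  · exact (S.N_pos y h).le

theorem C_nonneg (x : X) : 0 ≤ S.C x x :=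
  (mul_nonneg S.κ_pos.le (N_nonneg _)).trans (S.C_ge x)

theorem eq_zero_of_P_le {x : X} (h : S.P x x ≤ 0) : x = 0 := by
  by_contra hx
  exact (S.P_pos x hx).not_ge h

theorem eq_zero_of_N_le {y : Y} (h : S.N y y ≤ 0) : y = 0 := by
  by_contra hy
  exact (S.N_pos y hy).not_ge h

/-- A homogeneous solution tested with itself gives G(x,x) ≤ 0, because A and C are nonnegative; so
x = 0, and in finite dimension injectivity suffices. -/
theorem existsUnique_isSolution [FiniteDimensional ℝ X] {ε : ℝ} (hε : 0 < ε) :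
    ∃! ψ, S.IsSolution ε ψ := by
  let T : X →ₗ[ℝ] Module.Dual ℝ X := S.A + ε⁻¹ • S.C + ε • S.G
  have hT : ∀ ψ v, T ψ v = S.A ψ v + ε⁻¹ * S.C ψ v + ε * S.G ψ v := fun ψ v => by simp [T]
  have hinj : Function.Injective T := by
    refine (injective_iff_map_eq_zero T).2 fun x hx => eq_zero_of_P_le (S := S) ?_
    have h0 := hT x x
    rw [hx, LinearMap.zero_apply] at h0
    have h1 := S.A_nonneg x
    have h2 := mul_nonneg (inv_nonneg.2 hε.le) (C_nonneg (S := S) x)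
    have h3 : S.G x x ≤ 0 := by
      by_contra! hG
      have := mul_pos hε hG
      linarith
    have h4 := S.G_ge x
    by_contra! hP
    have := mul_pos S.κ_pos hP
    linarith
  have hbij : Function.Bijective T := ⟨hinj,
    (LinearMap.injective_iff_surjective_of_finrank_eq_finrank
      (Subspace.dual_finrank_eq (K := ℝ) (V := X)).symm).1 hinj⟩
  obtain ⟨ψ, hψ, huniq⟩ := hbij.existsUnique (ε • S.load)
  refine ⟨ψ, fun v => ?_, fun ψ' h' => huniq ψ' (LinearMap.ext fun v => ?_)⟩
  · rw [← hT, hψ]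
    rfl
  · rw [hT, h' v]
    rfl

/-- Test the two equations for the differences with the differences themselves. The first plus three
times the second eliminates D and leaves G + 3R = 0. -/
theorem IsMixed.unique {x x' : X} {y y' : Y} (h : S.IsMixed x y) (h' : S.IsMixed x' y') :
    x = x' ∧ y = y' := by
  have hx := S.X₀.sub_mem h.1 h'.1
  have e1 : -S.D (y - y') (x - x') + S.G (x - x') (x - x') = 0 := by
    have a1 := h.2.1 _ hx
    have a2 := h'.2.1 _ hx
    rw [map_sub S.D, map_sub S.G, LinearMap.sub_apply, LinearMap.sub_apply]
    linarith
  have e2 : 1 / 3 * S.D (y - y') (x - x') + S.R (y - y') (y - y') = 0 := by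
    have a1 := h.2.2 (y - y')
    have a2 := h'.2.2 (y - y')
    rw [map_sub (S.D (y - y')), map_sub S.R, LinearMap.sub_apply]
    linarith
  have g1 := S.G_ge (x - x')
  have g2 := S.R_ge (y - y')
  have p1 := mul_nonneg S.κ_pos.le (P_nonneg (S := S) (x - x'))
  have p2 := mul_nonneg S.κ_pos.le (N_nonneg (S := S) (y - y'))
  constructor
  · refine sub_eq_zero.1 (eq_zero_of_P_le (S := S) ?_)
    by_contra! hP
    have := mul_pos S.κ_pos hP
    linarith
  · refine sub_eq_zero.1 (eq_zero_of_N_le (S := S) ?_)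
    by_contra! hP
    have := mul_pos S.κ_pos hP
    linarith

end Algebra

/-! ### Uniform bounds and passage to the limit -/

section Normed

variable {X Y : Type*} [NormedAddCommGroup X] [NormedSpace ℝ X] [FiniteDimensional ℝ X]
  [NormedAddCommGroup Y] [NormedSpace ℝ Y] [FiniteDimensional ℝ Y]

theorem _root_.SNDG.tendsto_bilin {α : Type*} {l : Filter α} (B : X →ₗ[ℝ] Y →ₗ[ℝ] ℝ)
    {f : α → X} {g : α → Y} {x : X} {y : Y} (hf : Tendsto f l (𝓝 x)) (hg : Tendsto g l (𝓝 y)) :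
    Tendsto (fun a => B (f a) (g a)) l (𝓝 (B x y)) := by
  let T : X →ₗ[ℝ] Y →L[ℝ] ℝ :=
    (LinearMap.toContinuousLinearMap : (Y →ₗ[ℝ] ℝ) ≃ₗ[ℝ] Y →L[ℝ] ℝ).toLinearMap ∘ₗ B
  have hT : Continuous T := T.continuous_of_finiteDimensional
  have h : Tendsto (fun a => T (f a)) l (𝓝 (T x)) := (hT.tendsto x).comp hf
  exact ((isBoundedBilinearMap_apply (𝕜 := ℝ) (E := Y) (F := ℝ)).continuous.tendsto
    (T x, y)).comp (h.prodMk_nhds hg)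

theorem _root_.SNDG.exists_mul_norm_sq_le (B : X →ₗ[ℝ] X →ₗ[ℝ] ℝ) (hB : ∀ x, x ≠ 0 → 0 < B x x) :
    ∃ c : ℝ, 0 < c ∧ ∀ x, c * ‖x‖ ^ 2 ≤ B x x := by
  have hcont : Continuous fun x => B x x :=
    continuous_iff_continuousAt.2 fun x => tendsto_bilin B tendsto_id tendsto_id
  have hprop : ProperSpace X := FiniteDimensional.proper ℝ X
  obtain ⟨c, hc, hcB⟩ : ∃ c : ℝ, 0 < c ∧ ∀ x ∈ Metric.sphere (0 : X) 1, c ≤ B x x := by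
    rcases (Metric.sphere (0 : X) 1).eq_empty_or_nonempty with he | hne
    · exact ⟨1, one_pos, by simp [he]⟩
    · obtain ⟨x₀, hx₀, hmin⟩ := (isCompact_sphere (0 : X) 1).exists_isMinOn hne hcont.continuousOn
      refine ⟨B x₀ x₀, hB x₀ ?_, fun x hx => hmin hx⟩
      rintro rfl
      simp at hx₀
  refine ⟨c, hc, fun x => ?_⟩
  by_cases hx : x = 0
  · simp [hx]
  · have hn : 0 < ‖x‖ := norm_pos_iff.2 hx
    have := hcB (‖x‖⁻¹ • x) (by
      rw [mem_sphere_zero_iff_norm, norm_smul, norm_inv, norm_norm, inv_mul_cancel₀ hn.ne'])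
    simp only [map_smul, LinearMap.smul_apply, smul_eq_mul] at this
    calc c * ‖x‖ ^ 2 ≤ (‖x‖⁻¹ * (‖x‖⁻¹ * B x x)) * ‖x‖ ^ 2 := by gcongr
      _ = B x x := by field_simp

variable {S : DiffusiveScheme X Y}

/-- The energy identity A + ε⁻¹C + εG = ε ℓ on the diagonal: absorption bounds ψ, then the right
side is at most εK, which bounds A by εK and C by ε²K; finally `C_ge` turns the order ε² into a
bound for the scaled moment. -/
theorem exists_bound : ∃ r K : ℝ, ∀ ε : ℝ, 0 < ε → ∀ ψ, S.IsSolution ε ψ →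
    ‖ψ‖ ≤ r ∧ ‖ε⁻¹ • S.moment ψ‖ ≤ r ∧ S.A ψ ψ ≤ ε * K ∧ S.C ψ ψ ≤ ε ^ 2 * K := by
  obtain ⟨c, hc, hcP⟩ := exists_mul_norm_sq_le S.P S.P_pos
  obtain ⟨c', hc', hcN⟩ := exists_mul_norm_sq_le S.N S.N_pos
  let ℓ : X →L[ℝ] ℝ := LinearMap.toContinuousLinearMap S.load
  have hℓ : ∀ x, S.load x ≤ ‖ℓ‖ * ‖x‖ := fun x => (le_abs_self _).trans (ℓ.le_opNorm x)
  have hκ := S.κ_pos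
  set L := ‖ℓ‖ with hL
  have hL0 : 0 ≤ L := norm_nonneg _
  -- The norm of the source functional times the bound for ‖ψ‖, hence a bound for the source term.
  set K := L * (L / (S.κ * c)) with hK
  refine ⟨max (L / (S.κ * c)) √(K / (S.κ * c')), K, fun ε hε ψ hψ => ?_⟩
  have hen := hψ ψ
  have hA := S.A_nonneg ψ
  have hC := C_nonneg (S := S) ψ
  have hC' := mul_nonneg (inv_nonneg.2 hε.le) hC
  have hG0 := (mul_nonneg hκ.le (P_nonneg (S := S) ψ)).trans (S.G_ge ψ)
  have hG0' := mul_nonneg hε.le hG0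
  have h1 : ‖ψ‖ ≤ L / (S.κ * c) := by
    have h2 : ε * S.G ψ ψ ≤ ε * S.load ψ := by linarith
    have h3 := le_of_mul_le_mul_left h2 hε
    have h4 : S.κ * c * ‖ψ‖ * ‖ψ‖ ≤ L * ‖ψ‖ := by
      have := mul_le_mul_of_nonneg_left (hcP ψ) hκ.le
      linarith [S.G_ge ψ, hℓ ψ]
    rcases (norm_nonneg ψ).eq_or_lt with h0 | h0
    · rw [← h0]
      positivity
    · rw [le_div_iff₀ (by positivity), mul_comm]
      exact le_of_mul_le_mul_right h4 h0
  have h2 : S.load ψ ≤ K := (hℓ ψ).trans (mul_le_mul_of_nonneg_left h1 hL0)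
  have h2' := mul_le_mul_of_nonneg_left h2 hε.le
  have h3 : S.C ψ ψ ≤ ε ^ 2 * K := by
    have : ε⁻¹ * S.C ψ ψ ≤ ε * K := by linarith
    rw [inv_mul_le_iff₀ hε] at this
    linarith
  refine ⟨h1.trans (le_max_left _ _), ?_, by linarith, h3⟩
  refine le_trans (Real.le_sqrt_of_sq_le ?_) (le_max_right _ _)
  rw [norm_smul, mul_pow, norm_inv, Real.norm_eq_abs, abs_of_pos hε, le_div_iff₀ (by positivity)]
  have h4 := mul_le_mul_of_nonneg_left (hcN (S.moment ψ)) hκ.le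
  have h5 : S.κ * (c' * ‖S.moment ψ‖ ^ 2) ≤ ε ^ 2 * K := h4.trans ((S.C_ge ψ).trans h3)
  calc ε⁻¹ ^ 2 * ‖S.moment ψ‖ ^ 2 * (S.κ * c') = ε⁻¹ ^ 2 * (S.κ * (c' * ‖S.moment ψ‖ ^ 2)) := by ring
    _ ≤ ε⁻¹ ^ 2 * (ε ^ 2 * K) := by gcongr
    _ = K := by field_simp

theorem isMixed_of_tendsto {l : Filter ℝ} [l.NeBot] (hl : l ≤ 𝓝[>] 0) {ψ : ℝ → X}
    (hψ : ∀ ε, 0 < ε → S.IsSolution ε (ψ ε)) {x : X} {y : Y} (hx : Tendsto ψ l (𝓝 x))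
    (hy : Tendsto (fun ε => ε⁻¹ • S.moment (ψ ε)) l (𝓝 y)) : S.IsMixed x y := by
  obtain ⟨r, K, hb⟩ := exists_bound (S := S)
  have hpos : ∀ᶠ ε in l, 0 < ε := hl self_mem_nhdsWithin
  have hε : Tendsto (fun ε : ℝ => ε) l (𝓝 0) := hl.trans nhdsWithin_le_nhds
  have hA : S.A x x = 0 := by
    refine tendsto_nhds_unique (tendsto_bilin S.A hx hx)
      (tendsto_of_tendsto_of_tendsto_of_le_of_le' tendsto_const_nhds (h := fun ε => ε * K) ?_
        (Eventually.of_forall fun ε => S.A_nonneg _) (hpos.mono fun ε h => (hb ε h _ (hψ ε h)).2.2.1))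
    simpa using hε.mul_const K
  have hC : S.C x x = 0 := by
    refine tendsto_nhds_unique (tendsto_bilin S.C hx hx)
      (tendsto_of_tendsto_of_tendsto_of_le_of_le' tendsto_const_nhds (h := fun ε => ε ^ 2 * K) ?_
        (Eventually.of_forall fun ε => C_nonneg _) (hpos.mono fun ε h => (hb ε h _ (hψ ε h)).2.2.2))
    simpa using (hε.pow 2).mul_const K
  have hX := S.mem_X₀ x hA hC
  refine ⟨hX, fun φ hφ => ?_, fun ζ => ?_⟩
  · refine tendsto_nhds_unique (((tendsto_bilin S.D hy (tendsto_const_nhds (x := φ))).neg).add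
      (tendsto_bilin S.G hx (tendsto_const_nhds (x := φ)))) (tendsto_const_nhds.congr' ?_)
    -- The scheme divided by ε: the advection term becomes minus the pairing of the scaled moment
    -- with φ.
    filter_upwards [hpos] with ε h
    have := hψ ε h φ
    rw [S.A_right _ φ hφ, S.C_right _ φ hφ] at this
    simp only [map_smul, LinearMap.smul_apply, smul_eq_mul]
    field_simp
    linarith
  · rw [← S.A_dot x hX]
    -- No division here: scattering against `dot ζ` already contains the scaled moment, and
    -- absorption is ε² times `H` of it, which drops out.
    have hlim := ((tendsto_bilin S.A hx (tendsto_const_nhds (x := S.dot ζ))).add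
      (tendsto_bilin S.R hy (tendsto_const_nhds (x := ζ)))).add
        ((hε.pow 2).mul (tendsto_bilin S.H hy (tendsto_const_nhds (x := ζ))))
    have h0 := tendsto_nhds_unique hlim (tendsto_const_nhds (x := (0 : ℝ)) |>.congr' ?_)
    · simpa using h0
    · filter_upwards [hpos] with ε h
      have := hψ ε h (S.dot ζ)
      rw [S.C_dot, S.G_dot, S.load_dot] at this
      simp only [map_smul, LinearMap.smul_apply, smul_eq_mul]
      rw [mul_zero] at this
      rw [← this]
      field_simp

/-- By compactness every ultrafilter finer than `𝓝[>] 0` yields limits, which solve the mixed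
problem. Uniqueness identifies them, so the full families converge. -/
theorem diffusionLimit_of_normed : ∃ x y, S.IsMixed x y ∧ ∀ ψ : ℝ → X,
    (∀ ε, 0 < ε → S.IsSolution ε (ψ ε)) →
    Tendsto (fun ε => S.P (ψ ε - x) (ψ ε - x)) (𝓝[>] 0) (𝓝 0) ∧
    Tendsto (fun ε => S.N (ε⁻¹ • S.moment (ψ ε) - y) (ε⁻¹ • S.moment (ψ ε) - y)) (𝓝[>] 0) (𝓝 0) := by
  obtain ⟨r, K, hb⟩ := exists_bound (S := S)
  have hpX : ProperSpace X := FiniteDimensional.proper ℝ X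
  have hpY : ProperSpace Y := FiniteDimensional.proper ℝ Y
  have hultra : ∀ ψ : ℝ → X, (∀ ε, 0 < ε → S.IsSolution ε (ψ ε)) → ∀ U : Ultrafilter ℝ,
      (U : Filter ℝ) ≤ 𝓝[>] 0 → ∃ x y, S.IsMixed x y ∧ Tendsto ψ U (𝓝 x) ∧
        Tendsto (fun ε => ε⁻¹ • S.moment (ψ ε)) U (𝓝 y) := by
    intro ψ hψ U hU
    have hpos : ∀ᶠ ε in (U : Filter ℝ), 0 < ε := hU self_mem_nhdsWithin
    obtain ⟨x, -, hx⟩ := (isCompact_closedBall (0 : X) r).ultrafilter_le_nhds (U.map ψ)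
      (by
        rw [le_principal_iff]
        exact hpos.mono fun ε h => mem_closedBall_zero_iff.2 (hb ε h _ (hψ ε h)).1)
    obtain ⟨y, -, hy⟩ := (isCompact_closedBall (0 : Y) r).ultrafilter_le_nhds
      (U.map fun ε => ε⁻¹ • S.moment (ψ ε))
      (by
        rw [le_principal_iff]
        exact hpos.mono fun ε h => mem_closedBall_zero_iff.2 (hb ε h _ (hψ ε h)).2.1)
    exact ⟨x, y, isMixed_of_tendsto hU hψ hx hy, hx, hy⟩
  -- One auxiliary family of solutions produces the mixed solution before the family in the
  -- statement is fixed.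
  have hsol : ∀ ε : ℝ, ∃ ψ, 0 < ε → S.IsSolution ε ψ := fun ε => by
    by_cases h : 0 < ε
    · exact let ⟨ψ, hψ, _⟩ := existsUnique_isSolution (S := S) h; ⟨ψ, fun _ => hψ⟩
    · exact ⟨0, fun h' => absurd h' h⟩
  choose ψ₀ hψ₀ using hsol
  obtain ⟨x, y, hxy, -⟩ := hultra ψ₀ hψ₀ (Ultrafilter.of (𝓝[>] 0)) (Ultrafilter.of_le _)
  refine ⟨x, y, hxy, fun ψ hψ => ?_⟩
  have hlim : Tendsto ψ (𝓝[>] 0) (𝓝 x) ∧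
      Tendsto (fun ε => ε⁻¹ • S.moment (ψ ε)) (𝓝[>] 0) (𝓝 y) := by
    constructor <;> refine (tendsto_iff_ultrafilter _ _ _).2 fun U hU => ?_ <;>
      obtain ⟨x', y', hxy', h1, h2⟩ := hultra ψ hψ U hU <;>
      obtain ⟨rfl, rfl⟩ := hxy.unique hxy'
    · exact h1
    · exact h2
  constructor
  · have := tendsto_bilin S.P (hlim.1.sub_const x) (hlim.1.sub_const x)
    simpa using this
  · have := tendsto_bilin S.N (hlim.2.sub_const y) (hlim.2.sub_const y)
    simpa using this

end Normed

/-- The solutions of a diffusive scheme and their scaled moments converge to the solution of the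
mixed problem. -/
theorem diffusionLimit {X Y : Type*} [AddCommGroup X] [Module ℝ X] [AddCommGroup Y] [Module ℝ Y]
    [FiniteDimensional ℝ X] [FiniteDimensional ℝ Y] (S : DiffusiveScheme X Y) :
    ∃ x y, S.IsMixed x y ∧ ∀ ψ : ℝ → X, (∀ ε, 0 < ε → S.IsSolution ε (ψ ε)) →
    Tendsto (fun ε => S.P (ψ ε - x) (ψ ε - x)) (𝓝[>] 0) (𝓝 0) ∧
    Tendsto (fun ε => S.N (ε⁻¹ • S.moment (ψ ε) - y) (ε⁻¹ • S.moment (ψ ε) - y)) (𝓝[>] 0) (𝓝 0) := by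
  -- The statement mentions only bilinear forms, so any norm will do, here one from coordinates.
  let eX := (Module.finBasis ℝ X).equivFun
  let eY := (Module.finBasis ℝ Y).equivFun
  let _ : NormedAddCommGroup X := NormedAddCommGroup.induced X _ eX eX.injective
  let _ : NormedSpace ℝ X := NormedSpace.induced ℝ X _ eX
  let _ : NormedAddCommGroup Y := NormedAddCommGroup.induced Y _ eY eY.injective
  let _ : NormedSpace ℝ Y := NormedSpace.induced ℝ Y _ eY
  exact diffusionLimit_of_normed (S := S)

end DiffusiveScheme

end SNDG

end

noncomputable section

namespace SNDG

variable {d n : ℕ} {ι : Type*}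

/-! ### The local polynomial spaces -/

/-- Analyticity provides smooth pieces and, through the identity theorem, shows that a piece
vanishing on its cell is zero. -/
theorem analyticOnNhd_of_mem_P1 {f : E d → ℝ} (hf : f ∈ P1 d) : AnalyticOnNhd ℝ f univ := by
  induction hf using Submodule.span_induction with
  | mem f hf =>
    rcases hf with rfl | ⟨i, rfl⟩
    · exact analyticOnNhd_const
    · exact (EuclideanSpace.proj (𝕜 := ℝ) i).analyticOnNhd _
  | zero => exact analyticOnNhd_const
  | add f g _ _ hf hg => exact hf.add hg
  | smul c f _ hf => exact analyticOnNhd_const.mul hf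

theorem analyticOnNhd_of_mem_Q1 {f : E d → ℝ} (hf : f ∈ Q1 d) : AnalyticOnNhd ℝ f univ := by
  induction hf using Submodule.span_induction with
  | mem f hf =>
    obtain ⟨s, rfl⟩ := hf
    exact Finset.analyticOnNhd_fun_prod _ fun i _ => (EuclideanSpace.proj (𝕜 := ℝ) i).analyticOnNhd _
  | zero => exact analyticOnNhd_const
  | add f g _ _ hf hg => exact hf.add hg
  | smul c f _ hf => exact analyticOnNhd_const.mul hf

namespace Mesh

variable {M : Mesh d ι}

theorem analyticOnNhd_of_mem_Z {f : E d → ℝ} (hf : f ∈ M.Z) : AnalyticOnNhd ℝ f univ := by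
  rcases M.shape with ⟨h, -⟩ | ⟨h, -⟩ <;> rw [h] at hf
  · exact analyticOnNhd_of_mem_P1 hf
  · exact analyticOnNhd_of_mem_Q1 hf

theorem contDiff_of_mem_Z {f : E d → ℝ} (hf : f ∈ M.Z) : ContDiff ℝ 1 f :=
  contDiffOn_univ.1 (analyticOnNhd_of_mem_Z hf).contDiffOn_of_completeSpace

theorem finiteDimensional_Z : FiniteDimensional ℝ M.Z := by
  rcases M.shape with ⟨h, -⟩ | ⟨h, -⟩ <;> rw [h]
  · exact FiniteDimensional.span_of_finite ℝ ((finite_singleton _).union (finite_range _))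
  · exact FiniteDimensional.span_of_finite ℝ (finite_range _)

theorem eq_zero_of_mem_Z (hd : 1 ≤ d) {f : E d → ℝ} (hf : f ∈ M.Z) {k : ι}
    (h : ∀ x ∈ M.cell k, f x = 0) : f = 0 := by
  obtain ⟨s, hs⟩ := M.exists_isPolytope hd k
  obtain ⟨x, hx⟩ := hs.nonempty
  have h0 : f =ᶠ[𝓝 x] 0 := Filter.mem_of_superset (hs.isOpen.mem_nhds hx) h
  exact (analyticOnNhd_of_mem_Z hf).eq_of_eventuallyEq analyticOnNhd_const h0

theorem piecewiseSmooth_of_mem_V {u : Scalar d ι} (hu : u ∈ M.V) : PiecewiseSmooth u :=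
  fun k => contDiff_of_mem_Z (hu k)

theorem finiteDimensional_of_le_angularV [Finite ι] {W : Submodule ℝ (Angular d n ι)}
    (hW : W ≤ M.angularV n) : FiniteDimensional ℝ W := by
  have := finiteDimensional_Z (M := M)
  let f : (Fin n → ι → M.Z) →ₗ[ℝ] Angular d n ι :=
    { toFun := fun v j k => v j k
      map_add' := fun _ _ => rfl
      map_smul' := fun _ _ => rfl }
  have hle : W ≤ LinearMap.range f := fun v hv => ⟨fun j k => ⟨v j k, hW hv j k⟩, rfl⟩
  exact Submodule.finiteDimensional_of_le hle

/-! ### Weighted integrals of continuous fields -/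

theorem integrableOn_cell_mul (hd : 1 ≤ d) {σ : E d → ℝ} (hσ : IntegrableOn σ M.domain) (k : ι)
    {f : E d → ℝ} (hf : Continuous f) : IntegrableOn (fun x => σ x * f x) (M.cell k) := by
  obtain ⟨s, hs⟩ := M.exists_isPolytope hd k
  exact (hσ.mono_set (cell_subset_domain hd k)).mul_continuousOn_of_subset hf.continuousOn
    hs.isOpen.measurableSet hs.isCompact_closure subset_closure

theorem integrableOn_one [Finite ι] (hd : 1 ≤ d) : IntegrableOn (fun _ : E d => (1 : ℝ)) M.domain := by
  have hc : IsCompact (⋃ k, closure (M.cell k)) := isCompact_iUnion fun k => by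
    obtain ⟨s, hs⟩ := M.exists_isPolytope hd k
    exact hs.isCompact_closure
  exact (continuous_const.continuousOn.integrableOn_compact hc).mono_set interior_subset

variable [Fintype ι]

/-- The integral over all cells with the weight `σ`. -/
def mass (M : Mesh d ι) (hd : 1 ≤ d) (σ : E d → ℝ) (hσ : IntegrableOn σ M.domain) :
    (ι → C(E d, ℝ)) →ₗ[ℝ] ℝ where
  toFun f := ∑ k, ∫ x in M.cell k, σ x * f k x
  map_add' f g := by
    rw [← Finset.sum_add_distrib]
    refine Finset.sum_congr rfl fun k _ => ?_
    rw [← integral_add (integrableOn_cell_mul hd hσ k (f k).continuous)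
      (integrableOn_cell_mul hd hσ k (g k).continuous)]
    simp only [Pi.add_apply, ContinuousMap.add_apply, mul_add]
  map_smul' c f := by
    rw [RingHom.id_apply, smul_eq_mul, Finset.mul_sum]
    refine Finset.sum_congr rfl fun k _ => ?_
    rw [← integral_const_mul]
    simp only [Pi.smul_apply, ContinuousMap.smul_apply, smul_eq_mul, mul_left_comm]

variable {σ : E d → ℝ} {f g : ι → C(E d, ℝ)} {κ : ℝ}

theorem mass_apply (hd : 1 ≤ d) (hσ : IntegrableOn σ M.domain) (f : ι → C(E d, ℝ)) :
    M.mass hd σ hσ f = ∑ k, ∫ x in M.cell k, σ x * f k x := rfl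

theorem mul_mass_one_le (hd : 1 ≤ d) (hσ : IntegrableOn σ M.domain)
    (h : ∀ᵐ x ∂volume.restrict M.domain, κ ≤ σ x) (hκ : 0 ≤ κ) (hf : ∀ k x, 0 ≤ f k x)
    (hgf : ∀ k x, g k x ≤ f k x) :
    κ * M.mass hd _ (integrableOn_one hd) g ≤ M.mass hd σ hσ f := by
  rw [mass_apply, mass_apply, Finset.mul_sum]
  refine Finset.sum_le_sum fun k _ => ?_
  rw [← integral_const_mul]
  refine integral_mono_ae ((integrableOn_cell_mul hd (integrableOn_one hd) k
    (g k).continuous).const_mul κ) (integrableOn_cell_mul hd hσ k (f k).continuous) ?_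
  filter_upwards [ae_restrict_of_ae_restrict_of_subset (cell_subset_domain hd k) h] with x hx
  rw [one_mul]
  exact (mul_le_mul_of_nonneg_left (hgf k x) hκ).trans (mul_le_mul_of_nonneg_right hx (hf k x))

theorem eq_zero_of_mass_one_le (hd : 1 ≤ d) (hf : ∀ k x, 0 ≤ f k x)
    (h : M.mass hd _ (integrableOn_one hd) f ≤ 0) (k : ι) {x : E d} (hx : x ∈ M.cell k) :
    f k x = 0 := by
  have hnn : ∀ k ∈ (Finset.univ : Finset ι), 0 ≤ ∫ x in M.cell k, (1 : ℝ) * f k x := fun k _ =>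
    integral_nonneg fun x => by simpa using hf k x
  have h0 : ∫ x in M.cell k, (1 : ℝ) * f k x = 0 :=
    (Finset.sum_eq_zero_iff_of_nonneg hnn).1 (le_antisymm h (Finset.sum_nonneg hnn)) k
      (Finset.mem_univ k)
  simp only [one_mul] at h0
  rw [setIntegral_eq_zero_iff_of_nonneg_ae (Eventually.of_forall (hf k))
    (integrableOn_cell_of_continuous hd k (f k).continuous)] at h0
  exact Measure.eqOn_open_of_ae_eq h0 (isOpen_cell hd k) (f k).continuous.continuousOn
    continuousOn_const hx

end Mesh

/-! ### Angular quadrature -/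

namespace Quadrature

variable (Q : Quadrature d n)

theorem sum_inner_mul_inner (a b : E d) :
    ∑ j, Q.wt j * (inner ℝ (Q.pt j) a * inner ℝ (Q.pt j) b) = 1 / 3 * inner ℝ a b := by
  have h := congrArg (fun v => inner ℝ v b) (Q.sum_smul_pt a)
  simp only [sum_inner, inner_smul_left, conj_trivial] at h
  rw [← h, Finset.mul_sum]
  exact Finset.sum_congr rfl fun j _ => by ring

theorem sum_wt_inner (a : E d) : ∑ j, Q.wt j * inner ℝ (Q.pt j) a = 0 := by
  have h := congrArg (fun v => inner ℝ v a) Q.sum_wt_pt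
  simpa only [sum_inner, inner_smul_left, conj_trivial, inner_zero_left] using h

theorem sum_wt_norm_sq (hd : d ≤ 3) : ∑ j, Q.wt j * ‖Q.pt j‖ ^ 2 ≤ 1 := by
  have h : ∀ j, Q.wt j * ‖Q.pt j‖ ^ 2 = ∑ a, Q.wt j * (Q.pt j a * Q.pt j a) := fun j => by
    rw [EuclideanSpace.real_norm_sq_eq, Finset.mul_sum]
    exact Finset.sum_congr rfl fun a _ => by ring
  rw [Finset.sum_congr rfl fun j _ => h j, Finset.sum_comm]
  simp only [Q.sum_wt_pt_pt, if_true, Finset.sum_const, Finset.card_univ, Fintype.card_fin,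
    nsmul_eq_mul]
  have : (d : ℝ) ≤ 3 := by exact_mod_cast hd
  linarith

theorem sum_wt_sub_sq (a : Fin n → ℝ) :
    ∑ j, Q.wt j * (a j - ∑ i, Q.wt i * a i) ^ 2
      = ∑ j, Q.wt j * (a j * a j) - (∑ j, Q.wt j * a j) * ∑ j, Q.wt j * a j := by
  set m := ∑ i, Q.wt i * a i with hm
  have : ∀ j, Q.wt j * (a j - m) ^ 2
      = Q.wt j * (a j * a j) - 2 * m * (Q.wt j * a j) + m * m * Q.wt j := fun j => by ring
  rw [Finset.sum_congr rfl fun j _ => this j, Finset.sum_add_distrib, Finset.sum_sub_distrib,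
    ← Finset.mul_sum, ← Finset.mul_sum, Q.sum_wt, ← hm]
  ring

/-- As ∑ w_jΩ_j = 0, subtracting the mean from `a` does not change the moment. Cauchy–Schwarz with
weights `w` then leaves the variance times ∑ w_j|Ω_j|² = d/3 ≤ 1. -/
theorem norm_moment_sq_le (hd : d ≤ 3) (a : Fin n → ℝ) :
    ‖∑ j, (Q.wt j * a j) • Q.pt j‖ ^ 2
      ≤ ∑ j, Q.wt j * (a j * a j) - (∑ j, Q.wt j * a j) * ∑ j, Q.wt j * a j := by
  rw [← sum_wt_sub_sq]
  set m := ∑ i, Q.wt i * a i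
  have h1 : ∑ j, (Q.wt j * a j) • Q.pt j = ∑ j, (Q.wt j * (a j - m)) • Q.pt j := by
    have : ∀ j, (Q.wt j * (a j - m)) • Q.pt j
        = (Q.wt j * a j) • Q.pt j - m • (Q.wt j • Q.pt j) := fun j => by
      rw [smul_smul, ← sub_smul]
      congr 1
      ring
    rw [Finset.sum_congr rfl fun j _ => this j, Finset.sum_sub_distrib, ← Finset.smul_sum,
      Q.sum_wt_pt, smul_zero, sub_zero]
  have h2 : ‖∑ j, (Q.wt j * (a j - m)) • Q.pt j‖
      ≤ ∑ j, (√(Q.wt j) * |a j - m|) * (√(Q.wt j) * ‖Q.pt j‖) := by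
    refine (norm_sum_le _ _).trans_eq (Finset.sum_congr rfl fun j _ => ?_)
    have hw := (Q.wt_pos j).le
    rw [norm_smul, Real.norm_eq_abs, abs_mul, abs_of_nonneg hw]
    nth_rw 1 [← Real.mul_self_sqrt hw]
    ring
  rw [h1]
  refine (pow_le_pow_left₀ (norm_nonneg _) h2 2).trans
    ((Finset.sum_mul_sq_le_sq_mul_sq _ _ _).trans ?_)
  have h3 : ∀ j, (√(Q.wt j) * |a j - m|) ^ 2 = Q.wt j * (a j - m) ^ 2 := fun j => by
    rw [mul_pow, Real.sq_sqrt (Q.wt_pos j).le, sq_abs]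
  have h4 : ∀ j, (√(Q.wt j) * ‖Q.pt j‖) ^ 2 = Q.wt j * ‖Q.pt j‖ ^ 2 := fun j => by
    rw [mul_pow, Real.sq_sqrt (Q.wt_pos j).le]
  simp only [h3, h4]
  refine mul_le_of_le_one_right (Finset.sum_nonneg fun j _ => ?_) (Q.sum_wt_norm_sq hd)
  have := (Q.wt_pos j).le
  positivity

end Quadrature

end SNDG

end

noncomputable section

namespace SNDG

variable {d n : ℕ} {ι : Type*}

/-! ### Pointwise products of angular fields and currents -/

theorem continuous_gradient {f : E d → ℝ} (hf : ContDiff ℝ 1 f) : Continuous (gradient f) :=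
  (InnerProductSpace.toDual ℝ (E d)).symm.continuous.comp (hf.continuous_fderiv one_ne_zero)

/-- The pointwise inner product of piecewise continuous vector fields. -/
def innerField (d : ℕ) (ι : Type*) :
    (ι → C(E d, E d)) →ₗ[ℝ] (ι → C(E d, E d)) →ₗ[ℝ] (ι → C(E d, ℝ)) :=
  LinearMap.mk₂ ℝ (fun f g k => ⟨fun x => inner ℝ (f k x) (g k x), by fun_prop⟩)
    (fun f f' g => by ext k x; simp [inner_add_left])
    (fun c f g => by ext k x; simp [inner_smul_left])
    (fun f g g' => by ext k x; simp [inner_add_right])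
    (fun c f g => by ext k x; simp [inner_smul_right])

theorem Quadrature.avg_iso (Q : Quadrature d n) (φ : Scalar d ι) : Q.avg (iso n φ) = φ := by
  funext k x
  change ∑ j, Q.wt j * φ k x = φ k x
  rw [← Finset.sum_mul, Q.sum_wt, one_mul]

theorem Quadrature.iso_injective (Q : Quadrature d n) : Function.Injective (iso n (d := d) (ι := ι)) :=
  Function.LeftInverse.injective Q.avg_iso

theorem Quadrature.inner_moment (Q : Quadrature d n) (v : Angular d n ι) (k : ι) (x a : E d) :
    inner ℝ (Q.moment v k x) a = ∑ j, Q.wt j * (v j k x * inner ℝ (Q.pt j) a) := by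
  change inner ℝ (∑ j, (Q.wt j * v j k x) • Q.pt j) a = _
  simp only [sum_inner, inner_smul_left, conj_trivial, mul_assoc]

namespace Mesh

variable {M : Mesh d ι} {Q : Quadrature d n} {W : Submodule ℝ (Angular d n ι)}

theorem avg_mem_V (hWV : W ≤ M.angularV n) {v : Angular d n ι} (hv : v ∈ W) : Q.avg v ∈ M.V := by
  intro k
  have : Q.avg v k = ∑ j, Q.wt j • v j k := by
    funext x
    simp [Quadrature.avg]
  rw [this]
  exact M.Z.sum_mem fun j _ => M.Z.smul_mem _ (hWV hv j k)

/-- Components of currents stay in the local polynomial space, so the identity theorem applies to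
currents as well. -/
theorem inner_mem_Z (hWV : W ≤ M.angularV n) {ζ : VField d ι} (hζ : ζ ∈ W.map Q.moment) (a : E d)
    (k : ι) : (fun x => inner ℝ (ζ k x) a) ∈ M.Z := by
  obtain ⟨v, hv, rfl⟩ := hζ
  have : (fun x => inner ℝ (Q.moment v k x) a)
      = ∑ j, (Q.wt j * inner ℝ (Q.pt j) a) • v j k := by
    funext x
    simp only [Q.inner_moment, Finset.sum_apply, Pi.smul_apply, smul_eq_mul]
    exact Finset.sum_congr rfl fun j _ => by ring
  rw [this]
  exact M.Z.sum_mem fun j _ => M.Z.smul_mem _ (hWV hv j k)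

theorem continuous_of_mem_map_moment (hWV : W ≤ M.angularV n) {ζ : VField d ι}
    (hζ : ζ ∈ W.map Q.moment) (k : ι) : Continuous (ζ k) := by
  obtain ⟨v, hv, rfl⟩ := hζ
  have h : ∀ j, Continuous (v j k) := fun j => (contDiff_of_mem_Z (hWV hv j k)).continuous
  change Continuous fun x => ∑ j, (Q.wt j * v j k x) • Q.pt j
  fun_prop

/-! ### The linear maps into piecewise continuous fields -/

/-- The `j`-th component of an angular field. -/
def component (hWV : W ≤ M.angularV n) (j : Fin n) : W →ₗ[ℝ] (ι → C(E d, ℝ)) where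
  toFun v k := ⟨v.1 j k, (contDiff_of_mem_Z (hWV v.2 j k)).continuous⟩
  map_add' _ _ := rfl
  map_smul' _ _ := rfl

/-- The angular average. -/
def average (Q : Quadrature d n) (hWV : W ≤ M.angularV n) : W →ₗ[ℝ] (ι → C(E d, ℝ)) :=
  ∑ j, Q.wt j • component hWV j

/-- The gradient of the angular average. -/
def gradAverage (Q : Quadrature d n) (hWV : W ≤ M.angularV n) : W →ₗ[ℝ] (ι → C(E d, E d)) where
  toFun v k := ⟨gradient (Q.avg v.1 k),
    continuous_gradient (contDiff_of_mem_Z (avg_mem_V hWV v.2 k))⟩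
  map_add' u v := by
    have h : ∀ w : W, ∀ k, Differentiable ℝ (Q.avg w.1 k) := fun w k =>
      (contDiff_of_mem_Z (avg_mem_V hWV w.2 k)).differentiable one_ne_zero
    have h' : ∀ k, Q.avg (u + v).1 k = Q.avg u.1 k + Q.avg v.1 k := fun k => by
      funext x
      simp [Quadrature.avg, mul_add, Finset.sum_add_distrib]
    ext1 k
    refine ContinuousMap.ext fun x => ?_
    change gradient (Q.avg (u + v).1 k) x = gradient (Q.avg u.1 k) x + gradient (Q.avg v.1 k) x
    rw [h', gradient, fderiv_add (h u k x) (h v k x), map_add]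
    rfl
  map_smul' c v := by
    have h : ∀ k, Differentiable ℝ (Q.avg v.1 k) := fun k =>
      (contDiff_of_mem_Z (avg_mem_V hWV v.2 k)).differentiable one_ne_zero
    have h' : ∀ k, Q.avg (c • v).1 k = c • Q.avg v.1 k := fun k => by
      funext x
      simp [Quadrature.avg, Finset.mul_sum, mul_left_comm]
    ext1 k
    refine ContinuousMap.ext fun x => ?_
    change gradient (Q.avg (c • v).1 k) x = c • gradient (Q.avg v.1 k) x
    rw [h', gradient, fderiv_const_smul (h k x), map_smulₛₗ]
    rfl

/-- A current as a piecewise continuous vector field. -/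
def currentField (hWV : W ≤ M.angularV n) : W.map Q.moment →ₗ[ℝ] (ι → C(E d, E d)) where
  toFun ζ k := ⟨ζ.1 k, continuous_of_mem_map_moment hWV ζ.2 k⟩
  map_add' _ _ := rfl
  map_smul' _ _ := rfl

/-- The pointwise angular product `∑_j w_j u_j v_j`. -/
def angularProduct (Q : Quadrature d n) (hWV : W ≤ M.angularV n) :
    W →ₗ[ℝ] W →ₗ[ℝ] (ι → C(E d, ℝ)) :=
  ∑ j, Q.wt j • (LinearMap.mul ℝ (ι → C(E d, ℝ))).compl₁₂ (component hWV j) (component hWV j)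

/-- The pointwise product of the angular averages. -/
def averageProduct (Q : Quadrature d n) (hWV : W ≤ M.angularV n) :
    W →ₗ[ℝ] W →ₗ[ℝ] (ι → C(E d, ℝ)) :=
  (LinearMap.mul ℝ (ι → C(E d, ℝ))).compl₁₂ (average Q hWV) (average Q hWV)

/-- The pointwise angular covariance `∑_j w_j u_j v_j - ū v̄`. -/
def covariance (Q : Quadrature d n) (hWV : W ≤ M.angularV n) :
    W →ₗ[ℝ] W →ₗ[ℝ] (ι → C(E d, ℝ)) :=
  angularProduct Q hWV - averageProduct Q hWV

/-- The pointwise inner product of currents. -/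
def currentProduct (Q : Quadrature d n) (hWV : W ≤ M.angularV n) :
    W.map Q.moment →ₗ[ℝ] W.map Q.moment →ₗ[ℝ] (ι → C(E d, ℝ)) :=
  (innerField d ι).compl₁₂ (currentField hWV) (currentField hWV)

/-- The pointwise pairing of a current with the gradient of an angular average. -/
def gradientPairing (Q : Quadrature d n) (hWV : W ≤ M.angularV n) :
    W.map Q.moment →ₗ[ℝ] W →ₗ[ℝ] (ι → C(E d, ℝ)) :=
  (innerField d ι).compl₁₂ (currentField hWV) (gradAverage Q hWV)

section Apply

variable (hWV : W ≤ M.angularV n) (u v : W) (ζ ξ : W.map Q.moment) (k : ι) (x : E d)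

theorem component_apply (j : Fin n) : component hWV j v k x = v.1 j k x := rfl

theorem average_apply : average Q hWV v k x = Q.avg v.1 k x := by
  simp [average, Quadrature.avg, component_apply]

theorem angularProduct_apply :
    angularProduct Q hWV u v k x = ∑ j, Q.wt j * (u.1 j k x * v.1 j k x) := by
  simp [angularProduct, component_apply]

theorem averageProduct_apply :
    averageProduct Q hWV u v k x = Q.avg u.1 k x * Q.avg v.1 k x := by
  simp [averageProduct, average_apply]

theorem covariance_apply : covariance Q hWV u v k x
    = ∑ j, Q.wt j * (u.1 j k x * v.1 j k x) - Q.avg u.1 k x * Q.avg v.1 k x := by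
  rw [← angularProduct_apply, ← averageProduct_apply]
  rfl

theorem currentProduct_apply : currentProduct Q hWV ζ ξ k x = inner ℝ (ζ.1 k x) (ξ.1 k x) := rfl

theorem gradientPairing_apply :
    gradientPairing Q hWV ζ v k x = inner ℝ (ζ.1 k x) (gradient (Q.avg v.1 k) x) := rfl

end Apply

/-- The covariance with a constant is zero: scattering does not see isotropic test functions. -/
theorem covariance_iso (hWV : W ≤ M.angularV n) (u v : W) {φ : Scalar d ι} (h : iso n φ = v.1) :
    covariance Q hWV u v = 0 := by
  ext k x
  rw [covariance_apply, ← h, Q.avg_iso]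
  change ∑ j, Q.wt j * (u.1 j k x * φ k x) - (∑ j, Q.wt j * u.1 j k x) * φ k x = 0
  rw [Finset.sum_mul, sub_eq_zero]
  exact Finset.sum_congr rfl fun j _ => by ring

theorem avg_dot (ζ : VField d ι) : Q.avg (Q.dot ζ) = 0 := by
  funext k x
  exact Q.sum_wt_inner (ζ k x)

theorem angularProduct_dot (hWV : W ≤ M.angularV n) (u v : W) (ζ ξ : W.map Q.moment)
    (hu : Q.moment u.1 = ζ.1) (hv : v.1 = Q.dot ξ.1) :
    angularProduct Q hWV u v = currentProduct Q hWV ζ ξ := by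
  ext k x
  rw [angularProduct_apply, currentProduct_apply, ← hu, Q.inner_moment, hv]
  rfl

/-- The field Ω·ζ has mean zero, so its covariance with `u` is the plain product, which depends on
`u` only through its first moment. -/
theorem covariance_dot (hWV : W ≤ M.angularV n) (u v : W) (ζ ξ : W.map Q.moment)
    (hu : Q.moment u.1 = ζ.1) (hv : v.1 = Q.dot ξ.1) :
    covariance Q hWV u v = currentProduct Q hWV ζ ξ := by
  rw [← angularProduct_dot hWV u v ζ ξ hu hv]
  ext k x
  rw [covariance_apply, angularProduct_apply, hv, avg_dot]
  simp

/-! ### Advection -/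

variable [Fintype ι]

/-- The advection form of the scheme. -/
def advection (Q : Quadrature d n) (hd : 1 ≤ d) (hWV : W ≤ M.angularV n) : W →ₗ[ℝ] W →ₗ[ℝ] ℝ :=
  have hW : ∀ u : W, ∀ j, PiecewiseSmooth (u.1 j) := fun u j => piecewiseSmooth_of_mem_V (hWV u.2 j)
  LinearMap.mk₂ ℝ (fun u v => ∑ j, Q.wt j * M.advect (Q.pt j) (u.1 j) (v.1 j))
    (fun u u' v => by
      rw [← Finset.sum_add_distrib]
      exact Finset.sum_congr rfl fun j _ =>
        (congrArg _ (advect_add_left hd (hW u j) (hW u' j) (hW v j))).trans (mul_add _ _ _))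
    (fun c u v => by
      rw [smul_eq_mul, Finset.mul_sum]
      exact Finset.sum_congr rfl fun j _ =>
        (congrArg _ (advect_smul_left hd c (hW u j) (hW v j))).trans (mul_left_comm _ _ _))
    (fun u v v' => by
      rw [← Finset.sum_add_distrib]
      exact Finset.sum_congr rfl fun j _ =>
        (congrArg _ (advect_add_right hd (hW u j) (hW v j) (hW v' j))).trans (mul_add _ _ _))
    (fun c u v => by
      rw [smul_eq_mul, Finset.mul_sum]
      exact Finset.sum_congr rfl fun j _ =>
        (congrArg _ (advect_smul_right hd c (hW u j) (hW v j))).trans (mul_left_comm _ _ _))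

theorem advection_apply (hd : 1 ≤ d) (hWV : W ≤ M.angularV n) (u v : W) :
    advection Q hd hWV u v = ∑ j, Q.wt j * M.advect (Q.pt j) (u.1 j) (v.1 j) := rfl

theorem sum_sum_integral (hd : 1 ≤ d) (c : Fin n → ℝ) {f : Fin n → ι → E d → ℝ}
    (hf : ∀ j k, Continuous (f j k)) :
    ∑ j, c j * ∑ k, ∫ x in M.cell k, f j k x = ∑ k, ∫ x in M.cell k, ∑ j, c j * f j k x := by
  simp only [Finset.mul_sum]
  rw [Finset.sum_comm]
  refine Finset.sum_congr rfl fun k _ => ?_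
  rw [integral_finsetSum _ fun j _ => (integrableOn_cell_of_continuous hd k (hf j k)).const_mul _]
  exact Finset.sum_congr rfl fun j _ => (integral_const_mul _ _).symm

/-- The gradient of an isotropic test function is common to all ordinates, so the weighted sum over
`j` collects the first moment of `u`. -/
theorem advection_iso_right (hd : 1 ≤ d) (hWV : W ≤ M.angularV n) (u v : W) (ζ : W.map Q.moment)
    (hu : Q.moment u.1 = ζ.1) {φ : Scalar d ι} (hφ : φ ∈ M.contZero) (h : iso n φ = v.1) :
    advection Q hd hWV u v = -M.mass hd _ (integrableOn_one hd) (gradientPairing Q hWV ζ v) := by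
  have hs : PiecewiseSmooth φ := piecewiseSmooth_of_mem_V hφ.1
  have hW : ∀ j, PiecewiseSmooth (u.1 j) := fun j => piecewiseSmooth_of_mem_V (hWV u.2 j)
  have e : ∀ j, v.1 j = φ := fun j => (congrFun h j).symm
  simp only [advection_apply, e, advect_right_of_mem_contZero hd (hW _) hs hφ, mul_neg,
    Finset.sum_neg_distrib]
  have hc : ∀ j k, Continuous fun x => u.1 j k x * inner ℝ (Q.pt j) (gradient (φ k) x) :=
    fun j k => (hW j k).continuous.mul (continuous_inner_gradient (hs k) _)
  rw [sum_sum_integral hd _ hc, mass_apply]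
  simp only [gradientPairing_apply, ← hu, Q.inner_moment, ← h, Q.avg_iso, one_mul]

/-- The sum over `j` contains each ordinate twice, in Ω_j·ζ and in Ω_j·∇φ; the second moment
condition yields the factor 1/3. -/
theorem advection_iso_left (hd : 1 ≤ d) (hWV : W ≤ M.angularV n) (u v : W) (ζ : W.map Q.moment)
    (hv : v.1 = Q.dot ζ.1) {φ : Scalar d ι} (hφ : φ ∈ M.contZero) (h : iso n φ = u.1) :
    advection Q hd hWV u v
      = 1 / 3 * M.mass hd _ (integrableOn_one hd) (gradientPairing Q hWV ζ u) := by
  have hs : PiecewiseSmooth φ := piecewiseSmooth_of_mem_V hφ.1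
  have hW : ∀ j, PiecewiseSmooth (v.1 j) := fun j => piecewiseSmooth_of_mem_V (hWV v.2 j)
  have e : ∀ j, u.1 j = φ := fun j => (congrFun h j).symm
  simp only [advection_apply, e, advect_left_of_mem_contZero hd hs (hW _) hφ]
  have hc : ∀ j k, Continuous fun x => v.1 j k x * inner ℝ (Q.pt j) (gradient (φ k) x) :=
    fun j k => (hW j k).continuous.mul (continuous_inner_gradient (hs k) _)
  rw [sum_sum_integral hd _ hc, mass_apply, Finset.mul_sum]
  refine Finset.sum_congr rfl fun k _ => ?_
  rw [← integral_const_mul]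
  simp only [gradientPairing_apply, ← h, Q.avg_iso, one_mul, hv, ← Q.sum_inner_mul_inner]
  rfl

/-! ### The scheme as a diffusive scheme -/

theorem eq_zero_of_angularProduct (hd : 1 ≤ d) (hWV : W ≤ M.angularV n) {v : W}
    (h : M.mass hd _ (integrableOn_one hd) (angularProduct Q hWV v v) ≤ 0) : v = 0 := by
  have hnn : ∀ k x, ∀ j ∈ Finset.univ, 0 ≤ Q.wt j * (v.1 j k x * v.1 j k x) := fun k x j _ =>
    mul_nonneg (Q.wt_pos j).le (mul_self_nonneg _)
  refine Subtype.ext (funext fun j => funext fun k => eq_zero_of_mem_Z (k := k) hd (hWV v.2 j k) fun x hx => ?_)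
  have h0 := eq_zero_of_mass_one_le hd (fun k x => by
    rw [angularProduct_apply]; exact Finset.sum_nonneg (hnn k x)) h k hx
  rw [angularProduct_apply, Finset.sum_eq_zero_iff_of_nonneg (hnn k x)] at h0
  simpa [(Q.wt_pos j).ne'] using h0 j (Finset.mem_univ j)

theorem eq_zero_of_currentProduct (hd : 1 ≤ d) (hWV : W ≤ M.angularV n) {ζ : W.map Q.moment}
    (h : M.mass hd _ (integrableOn_one hd) (currentProduct Q hWV ζ ζ) ≤ 0) : ζ = 0 := by
  refine Subtype.ext (funext fun k => funext fun x => ext_inner_right ℝ fun a => ?_)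
  refine (congrFun (eq_zero_of_mem_Z (k := k) hd (inner_mem_Z hWV ζ.2 a k) fun x hx => ?_) x).trans
    (inner_zero_left a).symm
  have h0 := eq_zero_of_mass_one_le hd (fun k x => by
    rw [currentProduct_apply]; exact real_inner_self_nonneg) h k hx
  rw [currentProduct_apply, inner_self_eq_zero] at h0
  rw [h0, inner_zero_left]

/-- Zero variance on the cells makes all components equal to the average. As the weights are
positive and every advection form is nonnegative, each of them vanishes on the average, which
therefore has no jumps. -/
theorem exists_iso_eq (hd : 1 ≤ d) (hWV : W ≤ M.angularV n) {v : W}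
    (hA : advection Q hd hWV v v = 0)
    (hC : M.mass hd _ (integrableOn_one hd) (covariance Q hWV v v) ≤ 0) :
    v.1 ∈ M.contZero.map (iso n) := by
  have hvar : ∀ k x, covariance Q hWV v v k x
      = ∑ j, Q.wt j * (v.1 j k x - Q.avg v.1 k x) ^ 2 := fun k x => by
    rw [covariance_apply]
    exact (Q.sum_wt_sub_sq fun j => v.1 j k x).symm
  have hnn : ∀ k x, ∀ j ∈ Finset.univ, 0 ≤ Q.wt j * (v.1 j k x - Q.avg v.1 k x) ^ 2 :=
    fun k x j _ => mul_nonneg (Q.wt_pos j).le (sq_nonneg _)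
  have hV := avg_mem_V (Q := Q) hWV v.2
  have heq : ∀ j, v.1 j = Q.avg v.1 := fun j => funext fun k => sub_eq_zero.1 <|
    eq_zero_of_mem_Z (k := k) hd (M.Z.sub_mem (hWV v.2 j k) (hV k)) fun x hx => by
      have h0 := eq_zero_of_mass_one_le hd (fun k x => by
        rw [hvar]; exact Finset.sum_nonneg (hnn k x)) hC k hx
      rw [hvar, Finset.sum_eq_zero_iff_of_nonneg (hnn k x)] at h0
      simpa [(Q.wt_pos j).ne'] using h0 j (Finset.mem_univ j)
  have hs : PiecewiseSmooth (Q.avg v.1) := piecewiseSmooth_of_mem_V hV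
  refine ⟨Q.avg v.1, mem_contZero_of_advect_self_eq_zero hd Q hs hV fun j => ?_,
    (funext heq).symm⟩
  simp only [advection_apply, heq] at hA
  rw [Finset.sum_eq_zero_iff_of_nonneg fun j _ =>
    mul_nonneg (Q.wt_pos j).le (advect_self_nonneg hd hs)] at hA
  simpa [(Q.wt_pos j).ne'] using hA j (Finset.mem_univ j)

variable {σs σa q : E d → ℝ} {δ : ℝ}

/-- The scheme with trial and test space `W`. -/
def diffusiveScheme (hd1 : 1 ≤ d) (hd3 : d ≤ 3) (hσs : IntegrableOn σs M.domain)
    (hσa : IntegrableOn σa M.domain) (hq : IntegrableOn q M.domain) (hδ : 0 < δ)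
    (hs : ∀ᵐ x ∂volume.restrict M.domain, δ ≤ σs x)
    (ha : ∀ᵐ x ∂volume.restrict M.domain, δ ≤ σa x) (hWV : W ≤ M.angularV n)
    (hW : ∀ ζ ∈ W.map Q.moment, Q.dot ζ ∈ W) : DiffusiveScheme W (W.map Q.moment) where
  A := advection Q hd1 hWV
  C := (covariance Q hWV).compr₂ (M.mass hd1 σs hσs)
  G := (angularProduct Q hWV).compr₂ (M.mass hd1 σa hσa)
  P := (angularProduct Q hWV).compr₂ (M.mass hd1 _ (integrableOn_one hd1))
  R := (currentProduct Q hWV).compr₂ (M.mass hd1 σs hσs)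
  H := (currentProduct Q hWV).compr₂ (M.mass hd1 σa hσa)
  N := (currentProduct Q hWV).compr₂ (M.mass hd1 _ (integrableOn_one hd1))
  D := (gradientPairing Q hWV).compr₂ (M.mass hd1 _ (integrableOn_one hd1))
  load := M.mass hd1 q hq ∘ₗ average Q hWV
  moment := Q.moment.restrict fun v hv => Submodule.mem_map_of_mem hv
  dot :=
    { toFun := fun ζ => ⟨Q.dot ζ.1, hW ζ.1 ζ.2⟩
      map_add' := fun ζ ξ => Subtype.ext <| by
        funext j k x
        exact inner_add_right _ _ _
      map_smul' := fun c ζ => Subtype.ext <| by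
        funext j k x
        exact inner_smul_right _ _ _ }
  X₀ := (M.contZero.map (iso n)).comap W.subtype
  κ := δ
  κ_pos := hδ
  A_nonneg v := (advection_apply hd1 hWV v v).symm ▸ Finset.sum_nonneg fun j _ => mul_nonneg (Q.wt_pos j).le
    (advect_self_nonneg hd1 (piecewiseSmooth_of_mem_V (hWV v.2 j)))
  -- The variance bounds the squared current pointwise, and the weight is at least δ.
  C_ge v := by
    have h : ∀ k x, currentProduct Q hWV ⟨Q.moment v.1, Submodule.mem_map_of_mem v.2⟩
        ⟨Q.moment v.1, Submodule.mem_map_of_mem v.2⟩ k x ≤ covariance Q hWV v v k x := fun k x => by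
      rw [covariance_apply, currentProduct_apply, real_inner_self_eq_norm_sq]
      exact Q.norm_moment_sq_le hd3 fun j => v.1 j k x
    exact mul_mass_one_le hd1 hσs hs hδ.le (fun k x =>
      le_trans (real_inner_self_nonneg (x := Q.moment v.1 k x)) (h k x)) h
  G_ge v := mul_mass_one_le hd1 hσa ha hδ.le (fun k x => by
    rw [angularProduct_apply]
    exact Finset.sum_nonneg fun j _ => mul_nonneg (Q.wt_pos j).le (mul_self_nonneg _))
    fun k x => le_rfl
  R_ge ζ := mul_mass_one_le hd1 hσs hs hδ.le (fun k x =>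
    real_inner_self_nonneg (x := ζ.1 k x)) fun k x => le_rfl
  P_pos v hv := not_le.1 fun h => hv (eq_zero_of_angularProduct hd1 hWV h)
  N_pos ζ hζ := not_le.1 fun h => hζ (eq_zero_of_currentProduct hd1 hWV h)
  -- Since σ_s ≥ δ > 0, vanishing of the weighted variance forces vanishing of the unweighted one.
  mem_X₀ v hA hC := exists_iso_eq hd1 hWV hA <| by
    have h := mul_mass_one_le (f := covariance Q hWV v v) hd1 hσs hs hδ.le (fun k x => by
      rw [covariance_apply]
      exact (sq_nonneg _).trans (Q.norm_moment_sq_le hd3 fun j => v.1 j k x)) fun k x => le_rfl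
    rw [LinearMap.compr₂_apply] at hC
    rw [hC] at h
    by_contra! h'
    exact (mul_pos hδ h').not_ge h
  A_right := by
    rintro u v ⟨φ, hφ, h⟩
    exact advection_iso_right hd1 hWV u v _ rfl hφ h
  C_right := by
    rintro u v ⟨φ, hφ, h⟩
    rw [LinearMap.compr₂_apply, covariance_iso hWV u v h, map_zero]
  A_dot := by
    rintro u ⟨φ, hφ, h⟩ ζ
    exact advection_iso_left hd1 hWV u _ ζ rfl hφ h
  C_dot u ζ := congrArg (M.mass hd1 σs hσs) (covariance_dot hWV u _ _ ζ rfl rfl)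
  G_dot u ζ := congrArg (M.mass hd1 σa hσa) (angularProduct_dot hWV u _ _ ζ rfl rfl)
  load_dot ζ := by
    refine (congrArg (M.mass hd1 q hq) ?_).trans (map_zero _)
    ext k x
    rw [average_apply]
    exact congrFun (congrFun (avg_dot ζ.1) k) x

end Mesh

end SNDG

end

noncomputable section

namespace SNDG

variable {d n : ℕ} {ι : Type*}

namespace Mesh

variable [Fintype ι] {M : Mesh d ι} {Q : Quadrature d n} {W : Submodule ℝ (Angular d n ι)}
  {σ σs σa q : E d → ℝ} {ε : ℝ}

/-! ### The forms of the scheme as weighted integrals -/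

theorem mass_angularProduct (hd : 1 ≤ d) (hσ : IntegrableOn σ M.domain) (hWV : W ≤ M.angularV n)
    (u v : W) : M.mass hd σ hσ (angularProduct Q hWV u v)
      = ∑ j, Q.wt j * ∑ k, ∫ x in M.cell k, σ x * (u.1 j k x * v.1 j k x) := by
  simp only [angularProduct, LinearMap.sum_apply, LinearMap.smul_apply, map_sum, map_smul,
    smul_eq_mul]
  rfl

theorem mass_averageProduct (hd : 1 ≤ d) (hσ : IntegrableOn σ M.domain) (hWV : W ≤ M.angularV n)
    (u v : W) : M.mass hd σ hσ (averageProduct Q hWV u v)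
      = ∑ j, Q.wt j * ∑ k, ∫ x in M.cell k, σ x * (Q.avg u.1 k x * v.1 j k x) := by
  have h : averageProduct Q hWV u v
      = ∑ j, Q.wt j • (average Q hWV u * component hWV j v) := by
    change average Q hWV u * average Q hWV v = _
    nth_rw 2 [average]
    rw [LinearMap.sum_apply, Finset.mul_sum]
    exact Finset.sum_congr rfl fun j _ => by
      rw [LinearMap.smul_apply, mul_smul_comm]
  simp only [h, map_sum, map_smul, smul_eq_mul, mass_apply, Pi.mul_apply, ContinuousMap.mul_apply,
    average_apply, component_apply]

theorem mass_average (hd : 1 ≤ d) (hσ : IntegrableOn σ M.domain) (hWV : W ≤ M.angularV n)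
    (v : W) : M.mass hd σ hσ (average Q hWV v)
      = ∑ j, Q.wt j * ∑ k, ∫ x in M.cell k, σ x * v.1 j k x := by
  simp only [average, LinearMap.sum_apply, LinearMap.smul_apply, map_sum, map_smul, smul_eq_mul]
  rfl

theorem formL_eq (hd : 1 ≤ d) (hσs : IntegrableOn σs M.domain) (hσa : IntegrableOn σa M.domain)
    (hWV : W ≤ M.angularV n) (u v : W) :
    formL M Q σs σa ε u.1 v.1 = advection Q hd hWV u v
      + ε⁻¹ * M.mass hd σs hσs (angularProduct Q hWV u v)
      + ε * M.mass hd σa hσa (angularProduct Q hWV u v) := by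
  have hc : ∀ j k, Continuous fun x => u.1 j k x * v.1 j k x := fun j k =>
    (contDiff_of_mem_Z (hWV u.2 j k)).continuous.mul (contDiff_of_mem_Z (hWV v.2 j k)).continuous
  have hI : ∀ j k, ∫ x in M.cell k, (σs x / ε + ε * σa x) * u.1 j k x * v.1 j k x
      = ε⁻¹ * (∫ x in M.cell k, σs x * (u.1 j k x * v.1 j k x))
        + ε * ∫ x in M.cell k, σa x * (u.1 j k x * v.1 j k x) := fun j k => by
    rw [← integral_const_mul, ← integral_const_mul, ← integral_add
      ((integrableOn_cell_mul hd hσs k (hc j k)).const_mul _)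
      ((integrableOn_cell_mul hd hσa k (hc j k)).const_mul _)]
    refine integral_congr_ae (Eventually.of_forall fun x => ?_)
    simp only [div_eq_inv_mul]
    ring
  rw [formL, Finset.sum_comm, mass_angularProduct, mass_angularProduct, advection_apply,
    Finset.mul_sum, Finset.mul_sum, ← Finset.sum_add_distrib, ← Finset.sum_add_distrib]
  refine Finset.sum_congr rfl fun j _ => ?_
  rw [mul_left_comm ε⁻¹, mul_left_comm ε, ← mul_add, ← mul_add, advect]
  simp only [hI, Finset.mul_sum, Finset.sum_add_distrib, mul_add, add_assoc]

theorem formS_eq (hd : 1 ≤ d) (hσs : IntegrableOn σs M.domain) (hWV : W ≤ M.angularV n) (u v : W) :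
    formS M Q σs ε u.1 v.1 = ε⁻¹ * M.mass hd σs hσs (averageProduct Q hWV u v) := by
  rw [formS, Finset.sum_comm, mass_averageProduct, Finset.mul_sum]
  refine Finset.sum_congr rfl fun j _ => ?_
  rw [mul_left_comm, Finset.mul_sum, Finset.mul_sum]
  refine Finset.sum_congr rfl fun k _ => congrArg (Q.wt j * ·) ?_
  rw [← integral_const_mul]
  refine integral_congr_ae (Eventually.of_forall fun x => ?_)
  simp only [div_eq_inv_mul]
  ring

/-- The σ_s/ε term of `formL` and the mean-value term of `formS` combine to the covariance. -/
theorem formB_eq (hd : 1 ≤ d) (hσs : IntegrableOn σs M.domain) (hσa : IntegrableOn σa M.domain)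
    (hWV : W ≤ M.angularV n) (u v : W) :
    formB M Q σs σa ε u.1 v.1 = advection Q hd hWV u v
      + ε⁻¹ * M.mass hd σs hσs (covariance Q hWV u v)
      + ε * M.mass hd σa hσa (angularProduct Q hWV u v) := by
  rw [formB, formL_eq hd hσs hσa hWV, formS_eq hd hσs hWV, covariance, LinearMap.sub_apply,
    LinearMap.sub_apply, map_sub]
  ring

theorem load_eq (hd : 1 ≤ d) (hq : IntegrableOn q M.domain) (hWV : W ≤ M.angularV n) (v : W) :
    SNDG.load M Q q ε v.1 = ε * M.mass hd q hq (average Q hWV v) := by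
  rw [SNDG.load, Finset.sum_comm, mass_average, Finset.mul_sum]
  refine Finset.sum_congr rfl fun j _ => ?_
  simp only [Finset.mul_sum, mul_left_comm ε]
  refine Finset.sum_congr rfl fun k _ => congrArg (Q.wt j * ·) ?_
  rw [← integral_const_mul]
  simp only [mul_assoc]

theorem angularNorm_eq (hd : 1 ≤ d) (hWV : W ≤ M.angularV n) (v : W) :
    angularNorm M Q v.1 = √(M.mass hd _ (integrableOn_one hd) (angularProduct Q hWV v v)) := by
  rw [angularNorm, Finset.sum_comm, mass_angularProduct]
  simp only [← Finset.mul_sum, one_mul, sq]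

theorem vectorNorm_eq (hd : 1 ≤ d) (hWV : W ≤ M.angularV n) (ζ : W.map Q.moment) :
    vectorNorm M ζ.1 = √(M.mass hd _ (integrableOn_one hd) (currentProduct Q hWV ζ ζ)) := by
  simp only [vectorNorm, mass_apply, currentProduct_apply, one_mul, real_inner_self_eq_norm_sq]

theorem sum_integral_flux_add (hd : 1 ≤ d) (hσa : IntegrableOn σa M.domain) (hWV : W ≤ M.angularV n)
    {ψ φ : Scalar d ι} {v w : W} (hv : iso n ψ = v.1) (hw : iso n φ = w.1) (J : W.map Q.moment) :
    ∑ k, ∫ x in M.cell k, (-(inner ℝ (J.1 k x) (gradient (φ k) x)) + σa x * ψ k x * φ k x)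
      = -M.mass hd _ (integrableOn_one hd) (gradientPairing Q hWV J w)
        + M.mass hd σa hσa (angularProduct Q hWV v w) := by
  have hp : ∀ k x, angularProduct Q hWV v w k x = ψ k x * φ k x := fun k x => by
    rw [angularProduct_apply, ← hv, ← hw]
    change ∑ j, Q.wt j * (ψ k x * φ k x) = _
    rw [← Finset.sum_mul, Q.sum_wt, one_mul]
  have hg : ∀ k x, gradientPairing Q hWV J w k x = inner ℝ (J.1 k x) (gradient (φ k) x) :=
    fun k x => by rw [gradientPairing_apply, ← hw, Q.avg_iso]
  rw [mass_apply, mass_apply, ← Finset.sum_neg_distrib, ← Finset.sum_add_distrib]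
  refine Finset.sum_congr rfl fun k _ => ?_
  rw [← integral_neg, ← integral_add (f := fun x => -(1 * gradientPairing Q hWV J w k x))
    (integrableOn_cell_mul hd (integrableOn_one hd) k (gradientPairing Q hWV J w k).continuous).neg
    (integrableOn_cell_mul hd hσa k (angularProduct Q hWV v w k).continuous)]
  simp only [hp, hg, one_mul, mul_assoc]

theorem sum_integral_inner_flux (hd : 1 ≤ d) (hσs : IntegrableOn σs M.domain)
    (hWV : W ≤ M.angularV n) {ψ : Scalar d ι} {v : W} (hv : iso n ψ = v.1) (J ζ : W.map Q.moment) :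
    ∑ k, ∫ x in M.cell k, inner ℝ ((1 / 3 : ℝ) • gradient (ψ k) x + σs x • J.1 k x) (ζ.1 k x)
      = 1 / 3 * M.mass hd _ (integrableOn_one hd) (gradientPairing Q hWV ζ v)
        + M.mass hd σs hσs (currentProduct Q hWV J ζ) := by
  have hg : ∀ k x, gradientPairing Q hWV ζ v k x = inner ℝ (ζ.1 k x) (gradient (ψ k) x) :=
    fun k x => by rw [gradientPairing_apply, ← hv, Q.avg_iso]
  rw [mass_apply, mass_apply, Finset.mul_sum, ← Finset.sum_add_distrib]
  refine Finset.sum_congr rfl fun k _ => ?_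
  rw [← integral_const_mul, ← integral_add
    ((integrableOn_cell_mul hd (integrableOn_one hd) k
      (gradientPairing Q hWV ζ v k).continuous).const_mul _)
    (integrableOn_cell_mul hd hσs k (currentProduct Q hWV J ζ k).continuous)]
  simp only [hg, currentProduct_apply, one_mul, inner_add_left, real_inner_smul_left,
    real_inner_comm (gradient (ψ k) _)]

theorem mass_average_iso (hd : 1 ≤ d) (hq : IntegrableOn q M.domain) (hWV : W ≤ M.angularV n)
    {φ : Scalar d ι} {w : W} (hw : iso n φ = w.1) :
    M.mass hd q hq (average Q hWV w) = ∑ k, ∫ x in M.cell k, q x * φ k x := by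
  simp only [mass_apply, average_apply, ← hw, Q.avg_iso]

/-! ### The concrete problems as instances of the abstract ones -/

section Scheme

variable {δ : ℝ} (hd1 : 1 ≤ d) (hd3 : d ≤ 3) (hσs : IntegrableOn σs M.domain)
    (hσa : IntegrableOn σa M.domain) (hq : IntegrableOn q M.domain) (hδ : 0 < δ)
    (hs : ∀ᵐ x ∂volume.restrict M.domain, δ ≤ σs x)
    (ha : ∀ᵐ x ∂volume.restrict M.domain, δ ≤ σa x) (hWV : W ≤ M.angularV n)
    (hW : ∀ ζ ∈ W.map Q.moment, Q.dot ζ ∈ W)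

theorem isSolution_iff (ψ : W) :
    (diffusiveScheme hd1 hd3 hσs hσa hq hδ hs ha hWV hW).IsSolution ε ψ
      ↔ IsDGSolution M Q σs σa q W ε ψ := by
  have h : ∀ v : W, (formB M Q σs σa ε ψ.1 v.1 = SNDG.load M Q q ε v.1) ↔
      advection Q hd1 hWV ψ v + ε⁻¹ * M.mass hd1 σs hσs (covariance Q hWV ψ v)
      + ε * M.mass hd1 σa hσa (angularProduct Q hWV ψ v)
        = ε * M.mass hd1 q hq (average Q hWV v) := fun v => by
    rw [formB_eq hd1 hσs hσa hWV, load_eq hd1 hq hWV]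
  exact ⟨fun hψ => ⟨ψ.2, fun v hv => (h ⟨v, hv⟩).2 (hψ ⟨v, hv⟩)⟩,
    fun hψ v => (h v).1 (hψ.2 v v.2)⟩

/-- The abstract problem speaks of isotropic elements of `W`, the concrete one of scalars. The
passage loses nothing because `iso n` is injective, with the angular average as left inverse. -/
theorem isMixed_iff {ψ : Scalar d ι} {v : W} (hv : iso n ψ = v.1) (J : W.map Q.moment) :
    (diffusiveScheme hd1 hd3 hσs hσa hq hδ hs ha hWV hW).IsMixed v J
      ↔ IsMixedSolution M Q σs σa q W ψ J := by
  have h1 : v ∈ (M.contZero.map (iso n)).comap W.subtype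
      ↔ ψ ∈ M.contZero ⊓ W.comap (iso n) :=
    ⟨fun ⟨φ, hφ, h⟩ => ⟨Q.iso_injective (h.trans hv.symm) ▸ hφ,
      show iso n ψ ∈ W from hv ▸ v.2⟩, fun h => ⟨ψ, h.1, hv⟩⟩
  refine and_congr h1 ⟨fun ⟨h2, h3⟩ => ⟨J.2, fun φ hφ => ?_, fun ζ hζ => ?_⟩,
    fun ⟨_, h2, h3⟩ => ⟨?_, fun ζ => ?_⟩⟩
  · rw [sum_integral_flux_add (w := ⟨iso n φ, hφ.2⟩) hd1 hσa hWV hv rfl,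
      ← mass_average_iso (Q := Q) (w := ⟨iso n φ, hφ.2⟩) hd1 hq hWV rfl]
    exact h2 _ ⟨φ, hφ.1, rfl⟩
  · exact (sum_integral_inner_flux hd1 hσs hWV hv J ⟨ζ, hζ⟩).trans (h3 ⟨ζ, hζ⟩)
  · rintro w ⟨φ, hφ, hw⟩
    have h := h2 φ ⟨hφ, show iso n φ ∈ W from hw ▸ w.2⟩
    rw [sum_integral_flux_add hd1 hσa hWV hv hw, ← mass_average_iso (Q := Q) hd1 hq hWV hw] at h
    exact h
  · exact (sum_integral_inner_flux hd1 hσs hWV hv J ζ).symm.trans (h3 ζ ζ.2)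

end Scheme

end Mesh

end SNDG

end

/-! ### The diffusion limit of the scheme -/

theorem mainTheorem1 {d n : ℕ} (hd1 : 1 ≤ d) (hd3 : d ≤ 3) {ι : Type*} [Fintype ι]
    (M : SNDG.Mesh d ι) (Q : SNDG.Quadrature d n)
    (σs σa q : SNDG.E d → ℝ)
    (hσs : IntegrableOn σs M.domain) (hσa : IntegrableOn σa M.domain)
    (hq : IntegrableOn q M.domain)
    (δs δa : ℝ) (hδs : 0 < δs) (hδa : 0 < δa)
    (hs : ∀ᵐ x ∂volume.restrict M.domain, δs ≤ σs x)
    (ha : ∀ᵐ x ∂volume.restrict M.domain, δa ≤ σa x)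
    (W : Submodule ℝ (SNDG.Angular d n ι)) (hWV : W ≤ M.angularV n)
    (hW : ∀ ζ ∈ W.map Q.moment, Q.dot ζ ∈ W) :
    (∀ ε : ℝ, 0 < ε → ∃! ψ, SNDG.IsDGSolution M Q σs σa q W ε ψ) ∧
    ∃ (ψ₀ : SNDG.Scalar d ι) (J₀ : SNDG.VField d ι),
      ψ₀ ∈ M.contZero ∧ SNDG.iso n ψ₀ ∈ W ∧ J₀ ∈ W.map Q.moment ∧
      (∀ ψ : ℝ → SNDG.Angular d n ι,
        (∀ ε : ℝ, 0 < ε → SNDG.IsDGSolution M Q σs σa q W ε (ψ ε)) →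
        Tendsto (fun ε => SNDG.angularNorm M Q (ψ ε - SNDG.iso n ψ₀)) (𝓝[>] 0) (𝓝 0) ∧
        Tendsto (fun ε => SNDG.vectorNorm M (Q.current ε (ψ ε) - J₀)) (𝓝[>] 0) (𝓝 0)) ∧
      SNDG.IsMixedSolution M Q σs σa q W ψ₀ J₀ ∧
      ∀ (ψ' : SNDG.Scalar d ι) (J' : SNDG.VField d ι),
        SNDG.IsMixedSolution M Q σs σa q W ψ' J' → ψ' = ψ₀ ∧ J' = J₀ := by
  -- The abstract scheme has a single coercivity constant for scattering and absorption.
  have hδ : 0 < min δs δa := lt_min hδs hδa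
  have hs' : ∀ᵐ x ∂volume.restrict M.domain, min δs δa ≤ σs x :=
    hs.mono fun x hx => (min_le_left _ _).trans hx
  have ha' : ∀ᵐ x ∂volume.restrict M.domain, min δs δa ≤ σa x :=
    ha.mono fun x hx => (min_le_right _ _).trans hx
  have := SNDG.Mesh.finiteDimensional_of_le_angularV hWV
  let S := SNDG.Mesh.diffusiveScheme hd1 hd3 hσs hσa hq hδ hs' ha' hWV hW
  have hsol : ∀ ε, ∀ ψ : W, S.IsSolution ε ψ ↔ SNDG.IsDGSolution M Q σs σa q W ε ψ :=
    fun ε ψ => SNDG.Mesh.isSolution_iff hd1 hd3 hσs hσa hq hδ hs' ha' hWV hW ψ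
  refine ⟨fun ε hε => ?_, ?_⟩
  · obtain ⟨ψ, hψ, h⟩ := SNDG.DiffusiveScheme.existsUnique_isSolution (S := S) hε
    exact ⟨ψ, (hsol ε ψ).1 hψ,
      fun ψ' h' => congrArg Subtype.val (h ⟨ψ', h'.1⟩ ((hsol ε ⟨ψ', h'.1⟩).2 h'))⟩
  obtain ⟨v, J, hmix, hlim⟩ := S.diffusionLimit
  obtain ⟨ψ₀, hψ₀, hv⟩ := hmix.1
  have hiff : ∀ {ψ : SNDG.Scalar d ι} {v : W}, SNDG.iso n ψ = v.1 → ∀ J : W.map Q.moment,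
      S.IsMixed v J ↔ SNDG.IsMixedSolution M Q σs σa q W ψ J := fun hv J =>
    SNDG.Mesh.isMixed_iff hd1 hd3 hσs hσa hq hδ hs' ha' hWV hW hv J
  refine ⟨ψ₀, J, hψ₀, hv ▸ v.2, J.2, fun ψ hψ => ?_, (hiff hv J).1 hmix, fun ψ' J' h' => ?_⟩
  -- The abstract limit concerns the squared norms.
  · have hsq : Tendsto Real.sqrt (𝓝 0) (𝓝 0) := by
      simpa using Real.continuous_sqrt.tendsto 0
    -- For ε ≤ 0 nothing is known about `ψ ε`; the value 0 there is invisible to `𝓝[>] 0`.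
    let ψ' : ℝ → W := fun ε => if h : 0 < ε then ⟨ψ ε, (hψ ε h).1⟩ else 0
    have hψ' : ∀ ε, 0 < ε → (ψ' ε).1 = ψ ε := fun ε h => by simp only [ψ', dif_pos h]
    obtain ⟨h1, h2⟩ := hlim ψ' fun ε hε => (hsol ε _).2 (by rw [hψ' ε hε]; exact hψ ε hε)
    constructor
    · refine (hsq.comp h1).congr' ?_
      filter_upwards [self_mem_nhdsWithin] with ε hε
      rw [← hψ' ε hε, hv]
      exact (SNDG.Mesh.angularNorm_eq hd1 hWV (ψ' ε - v)).symm
    · refine (hsq.comp h2).congr' ?_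
      filter_upwards [self_mem_nhdsWithin] with ε hε
      rw [← hψ' ε hε]
      exact (SNDG.Mesh.vectorNorm_eq hd1 hWV (ε⁻¹ • S.moment (ψ' ε) - J)).symm
  · have hu := (((hiff (v := ⟨SNDG.iso n ψ', h'.1.2⟩) rfl ⟨J', h'.2.1⟩).2 h').unique hmix)
    refine ⟨?_, congrArg Subtype.val hu.2⟩
    rw [← Q.avg_iso ψ', ← Q.avg_iso ψ₀]
    exact congrArg Q.avg ((congrArg Subtype.val hu.1).trans hv.symm)
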